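/- Let $p(u,v)=u^4+16uv^3+10v^4+16v-4$ and $q(T,x,y)=x^4+y^4+1+T(x^4+xy^3+y+1)$, let $X$ be the affine plane curve $p(u,v)=0$ over $\mathbb{Q}$, and for an element $t$ of a field let $Y_t$ be the affine plane curve $q(t,x,y)=0$ over that field. For a graph $G=(V,E)$ (symmetric, irreflexive), let $K=\mathbb{Q}(\prod_{i\in V}X)$ be the function field of the product of copies of $X$ indexed by $V$, with $(u_i,v_i)$ the coordinate functions on the $i$-th copy. For each two-element subset $\{i,j\}$ of $V$ let $Z_{\{i,j\}}$ be the $K$-curve $Y_{u_iu_j}$ if $\{i,j\}\in E$ and $Y_{u_i+u_j}$ if $\{i,j\}\notin E$. Let $\mathscr{F}(G)=K(\prod Z_{\{i,j\}})$ be the function field over $K$ of the product of all these curves, with $(x_{ij},y_{ij})$ the coordinate functions on $Z_{\{i,j\}}$. Let $G$ be a graph with vertex set $\omega=\{0,1,2,\dots\}$. Let $\mathscr{F}_\omega(G)$ be the following standard presentation of $\mathscr{F}(G)$ with underlying set $\omega$. Fix the pairing function $\pi:\omega\times\omega\to\omega$ and divide $\omega$ into the columns $\omega^{[n]}=\pi(\{n\}\times\omega)$.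 Column $0$ names the elements of $\mathbb{Q}$. For $i=0,1,2,\dots$ in turn, column $2i+2$ names the new elements that appear when $\mathbb{Q}(u_0,v_0,\dots,u_{i-1},v_{i-1})$ is extended by $u_i,v_i$; so the even columns together name $K$. Then, with the pairs $(i,j)$, $i>j$, in lexicographic order, for $k=1,2,\dots$ in turn column $2k-1$ names the new elements that appear when the field obtained so far is extended by $x_{ij},y_{ij}$, where $(i,j)$ is the $k$-th pair. The naming is uniform: when a field $k$ whose elements already have names is extended by $x,y$ to the function field $k(x,y)=k(x)\oplus k(x)y\oplus k(x)y^2\oplus k(x)y^3$ of a curve, the new column lists without repetition the elements outside $k$ in a sequence that begins with $x,y$ and then runs through the codes of all four-tuples of fractions of polynomials in $x$ whose coefficients are given by names of elements of $k$; the rational numbers in column $0$ are listed likewise, without repetition, in a standard sequence. The field operations on $\omega$ are those of $\mathscr{F}(G)$, transported along this naming. **Proposition.** For every graph $G$ on $\omega$, the naming is a bijection $\omega\to\mathscr{F}(G)$, and $\mathscr{F}_\omega(G)$ is isomorphic to a subfield of $\mathbb{R}$. Moreover, the field homomorphism $f:\mathscr{F}_\omega(G)\hookrightarrow\mathbb{R}$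 may be chosen so that the induced ordering $\{(a,b)\in\omega^2 : f(a)<f(b)\}$ on $\mathscr{F}_\omega(G)$ is computable from $G$, that is, Turing computable with an oracle for the edge relation of $G$. -/

import Mathlib

/-! ### The curves -/

/-- The polynomial `p(u,v)`; the affine plane curve `X` over `ℚ` is `p(u,v) = 0`. -/
def curveP {R : Type*} [CommRing R] (u v : R) : R :=
  u ^ 4 + 16 * u * v ^ 3 + 10 * v ^ 4 + 16 * v - 4

/-- The polynomial `q(T,x,y)`; the affine plane curve `Y_t` is `q(t,x,y) = 0`. -/
def curveQ {R : Type*} [CommRing R] (t x y : R) : R :=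
  x ^ 4 + y ^ 4 + 1 + t * (x ^ 4 + x * y ^ 3 + y + 1)

/-! ### The field attached to a graph -/

/-- The ideal of the product `∏_{i ∈ V} X`, generated by the `p(u_i, v_i)` in the polynomial ring
over `ℚ` on `u_i = X (i, 0)` and `v_i = X (i, 1)`. -/
noncomputable def idealX (V : Type*) : Ideal (MvPolynomial (V × Fin 2) ℚ) :=
  Ideal.span (Set.range fun i : V => curveP (MvPolynomial.X (i, 0)) (MvPolynomial.X (i, 1)))

/-- The coordinate ring of `∏_{i ∈ V} X` over `ℚ`. -/
abbrev CoordX (V : Type*) : Type _ := MvPolynomial (V × Fin 2) ℚ ⧸ idealX V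

/-- The function field `K = ℚ(∏_{i ∈ V} X)`, as the ring of fractions of the coordinate ring. -/
def FieldK (V : Type*) : Type _ := FractionRing (CoordX V)

noncomputable instance (V : Type*) : CommRing (FieldK V) :=
  inferInstanceAs (CommRing (FractionRing (CoordX V)))

noncomputable instance (V : Type*) : Algebra (CoordX V) (FieldK V) :=
  inferInstanceAs (Algebra (CoordX V) (FractionRing (CoordX V)))

instance (V : Type*) : IsFractionRing (CoordX V) (FieldK V) :=
  inferInstanceAs (IsFractionRing (CoordX V) (FractionRing (CoordX V)))

/-- The rational function `u` on the `i`-th copy of `X`. -/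
noncomputable def uK {V : Type*} (i : V) : FieldK V :=
  algebraMap (CoordX V) (FieldK V) (Ideal.Quotient.mk (idealX V) (MvPolynomial.X (i, 0)))

/-- The rational function `v` on the `i`-th copy of `X`. -/
noncomputable def vK {V : Type*} (i : V) : FieldK V :=
  algebraMap (CoordX V) (FieldK V) (Ideal.Quotient.mk (idealX V) (MvPolynomial.X (i, 1)))

/-- The two-element subsets of `V`. -/
abbrev TwoSubset (V : Type*) : Type _ := {e : Sym2 V // ¬ e.IsDiag}

open Classical in
/-- The parameter of the curve `Z_{i,j}`: it is `u_i u_j` if `{i,j}` is an edge of the graph and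
`u_i + u_j` otherwise. -/
noncomputable def curveParam {V : Type*} (G : SimpleGraph V) (e : TwoSubset V) : FieldK V :=
  if e.1 ∈ G.edgeSet then
    Sym2.lift ⟨fun i j => uK i * uK j, fun i j => mul_comm (uK i) (uK j)⟩ e.1
  else
    Sym2.lift ⟨fun i j => uK i + uK j, fun i j => add_comm (uK i) (uK j)⟩ e.1

/-- The ideal of the product of the curves `Z_{i,j} = Y_t`, `t` being the parameter of `{i,j}`, in
the polynomial ring over `K` on `x_e = X (e, 0)` and `y_e = X (e, 1)`. -/
noncomputable def idealZ {V : Type*} (G : SimpleGraph V) :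
    Ideal (MvPolynomial (TwoSubset V × Fin 2) (FieldK V)) :=
  Ideal.span (Set.range fun e : TwoSubset V =>
    curveQ (MvPolynomial.C (curveParam G e)) (MvPolynomial.X (e, 0)) (MvPolynomial.X (e, 1)))

/-- The coordinate ring over `K` of the product of the curves `Z_{i,j}`. -/
abbrev CoordZ {V : Type*} (G : SimpleGraph V) : Type _ :=
  MvPolynomial (TwoSubset V × Fin 2) (FieldK V) ⧸ idealZ G

/-- The field `F(G) = K(∏ Z_{i,j})`, as the ring of fractions of the coordinate ring. -/
def FieldF {V : Type*} (G : SimpleGraph V) : Type _ := FractionRing (CoordZ G)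

noncomputable instance {V : Type*} (G : SimpleGraph V) : CommRing (FieldF G) :=
  inferInstanceAs (CommRing (FractionRing (CoordZ G)))

noncomputable instance {V : Type*} (G : SimpleGraph V) : Algebra (CoordZ G) (FieldF G) :=
  inferInstanceAs (Algebra (CoordZ G) (FractionRing (CoordZ G)))

instance {V : Type*} (G : SimpleGraph V) : IsFractionRing (CoordZ G) (FieldF G) :=
  inferInstanceAs (IsFractionRing (CoordZ G) (FractionRing (CoordZ G)))

section Generators

variable {V : Type*} (G : SimpleGraph V)

/-- The element of `F(G)` given by a polynomial over `K` in the `x_e` and `y_e`. -/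
noncomputable def ofPoly (P : MvPolynomial (TwoSubset V × Fin 2) (FieldK V)) : FieldF G :=
  algebraMap (CoordZ G) (FieldF G) (Ideal.Quotient.mk (idealZ G) P)

/-- The map `K → F(G)`. -/
noncomputable def ofK (a : FieldK V) : FieldF G := ofPoly G (MvPolynomial.C a)

/-- The generator `u_i` of `F(G)`. -/
noncomputable def uF (i : V) : FieldF G := ofK G (uK i)

/-- The generator `v_i` of `F(G)`. -/
noncomputable def vF (i : V) : FieldF G := ofK G (vK i)

/-- The generator `x_{ij}` of `F(G)`. -/
noncomputable def xF (e : TwoSubset V) : FieldF G :=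
  ofPoly G (MvPolynomial.X (e, 0))

/-- The generator `y_{ij}` of `F(G)`. -/
noncomputable def yF (e : TwoSubset V) : FieldF G :=
  ofPoly G (MvPolynomial.X (e, 1))

end Generators

/-! ### Presentations with domain `ω`

The `n`-th column of `ω` is the set of all `Nat.pair n m`. A partial presentation, with domain a
union of columns, is recorded by the map from names to elements, extended by `0` to all other
natural numbers. -/

/-- The list without repetitions of those terms of the sequence `w` that do not lie in `D`, each at
its first occurrence. -/
noncomputable def enumNew {R : Type*} (D : Set R) (w : ℕ → R) (m : ℕ) : R :=
  w (Nat.nth (fun c => w c ∉ D ∧ ∀ c' < c, w c' ≠ w c) m)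

section Extension

variable {R : Type*} [CommRing R]

/-- The value at `x` of the polynomial whose coefficients have the names in the list. -/
def evalPoly (s : ℕ → R) (x : R) (l : List ℕ) : R :=
  l.foldr (fun a r => s a + x * r) 0

/-- The value at `x` of the rational function with the given numerator and denominator
(`0` if the denominator is not invertible). -/
noncomputable def evalFrac (s : ℕ → R) (x : R) (r : List ℕ × List ℕ) : R :=
  evalPoly s x r.1 * Ring.inverse (evalPoly s x r.2)

/-- A sequence through `k(x) ⊕ k(x) y ⊕ k(x) y ^ 2 ⊕ k(x) y ^ 3`, where `k` is the range of `s`. It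
starts with `x` and `y`, and goes on through all codes of four rational functions over `k`. -/
noncomputable def extensionSeq (s : ℕ → R) (x y : R) : ℕ → R
  | 0 => x
  | 1 => y
  | c + 2 =>
    let r := Denumerable.ofNat ((List ℕ × List ℕ) × (List ℕ × List ℕ) ×
      (List ℕ × List ℕ) × (List ℕ × List ℕ)) c
    evalFrac s x r.1 + evalFrac s x r.2.1 * y + evalFrac s x r.2.2.1 * y ^ 2 +
      evalFrac s x r.2.2.2 * y ^ 3

/-- Extend a presentation `s` of `k` to one of the function field `k(x, y)` of a curve of
`y`-degree four, by naming the elements outside `k` with the elements of the `n`-th column. -/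
noncomputable def extendBy (s : ℕ → R) (n : ℕ) (x y : R) (a : ℕ) : R :=
  if a.unpair.1 = n then enumNew (Set.range s) (extensionSeq s x y) a.unpair.2 else s a

end Extension

section Presentation

variable (G : SimpleGraph ℕ)

/-- A sequence through the rational numbers in `F(G)`. -/
noncomputable def ratSeq (c : ℕ) : FieldF G :=
  ((c.unpair.1.unpair.1 : FieldF G) - c.unpair.1.unpair.2) *
    Ring.inverse ((c.unpair.2 : FieldF G) + 1)

/-- The presentation of `K_i = ℚ(u_0, v_0, …, u_{i-1}, v_{i-1})` on the columns
`0, 2, 4, …, 2 i`; column `0` names the rational numbers. -/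
noncomputable def stageK : ℕ → ℕ → FieldF G
  | 0 => fun a => if a.unpair.1 = 0 then enumNew ∅ (ratSeq G) a.unpair.2 else 0
  | i + 1 => extendBy (stageK i) (2 * i + 2) (uF G i) (vF G i)

/-- The pairs `(i, j)` with `i > j` in lexicographic order: `(1,0), (2,0), (2,1), (3,0), …`. -/
def pairAt : ℕ → {ij : ℕ × ℕ // ij.2 < ij.1}
  | 0 => ⟨(1, 0), Nat.zero_lt_one⟩
  | k + 1 =>
    if h : (pairAt k).1.2 + 1 < (pairAt k).1.1 then
      ⟨((pairAt k).1.1, (pairAt k).1.2 + 1), h⟩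
    else ⟨((pairAt k).1.1 + 1, 0), Nat.succ_pos _⟩

/-- The two-element subset `{i, j}`, where `(i, j)` is the `k`-th pair, counted from `0`. -/
def twoSubsetAt (k : ℕ) : TwoSubset ℕ :=
  ⟨s((pairAt k).1.1, (pairAt k).1.2), fun h =>
    absurd (Sym2.mk_isDiag_iff.mp h) (Nat.ne_of_gt (pairAt k).2)⟩

/-- The presentation of `F_k`, on all the even columns and the first `k` odd columns. Stage `0` is
the union `K` of the `K_i`; a name in column `2 i` is in use from stage `i` of `stageK` on. Then the
`k`-th odd column is used for adjoining the function field of the `k`-th curve `Z_{i,j}`. -/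
noncomputable def stageF : ℕ → ℕ → FieldF G
  | 0 => fun a => stageK G a.unpair.1 a
  | k + 1 => extendBy (stageF k) (2 * k + 1) (xF G (twoSubsetAt k)) (yF G (twoSubsetAt k))

/-- The element of `F(G)` named by the natural number `a` in the standard presentation, i.e. in
the union of the presentations of the `F_k`. -/
noncomputable def element (a : ℕ) : FieldF G := stageF G a.unpair.1 a

/-- `F_ω(G)`: the set `ω`, with the operations transported from `F(G)` along `element G`. -/
def FOmega (_G : SimpleGraph ℕ) : Type := ℕ

/-- The natural number that names a given element of `F(G)`. -/
noncomputable def name (z : FieldF G) : FOmega G :=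
  show ℕ from Function.invFun (element G) z

noncomputable instance FOmega.instAdd : Add (FOmega G) :=
  ⟨fun a b => name G (element G a + element G b)⟩

noncomputable instance FOmega.instMul : Mul (FOmega G) :=
  ⟨fun a b => name G (element G a * element G b)⟩

end Presentation

/-! ### Computability -/

open Classical in
/-- The characteristic function of a binary relation on `ω`. -/
noncomputable def relChar (R : ℕ → ℕ → Prop) : ℕ →. ℕ := fun n =>
  Part.some (if R n.unpair.1 n.unpair.2 then 1 else 0)

/-- The binary relation `R` on `ω` is computable with an oracle for the binary relation `S`. -/
def RelComputableFrom (R S : ℕ → ℕ → Prop) : Prop :=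
  TuringReducible (relChar R) (relChar S)

/-- The ordering on `ω` induced by a map from `F_ω(G)` to the real numbers. -/
def inducedLT {G : SimpleGraph ℕ} (f : FOmega G → ℝ) (a b : ℕ) : Prop :=
  f (show FOmega G from a) < f (show FOmega G from b)

/-! The embedding is evaluation at a real point. Let `gapNum j` be lacunary binary series with
pairwise disjoint supports. They are algebraically independent (`algebraicIndependent_gapNum`) and
have explicit rational approximations. Put `u_i = 2 + gapNum (2 i)` and `x_k = 1 + gapNum (2 k +
1)`. In this range `p(u, ·)` is strictly increasing on `(-1, 0)` with a root there, and so is `q(t,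
x, ·)` on `(-2, 0)`, whether `t` is `u_i u_j` or `u_i + u_j`. These roots serve as `v_i` and `y_k`.

Up to scaling both curves have the form `y ^ 4 + s x y ^ 3 + s y + m (x ^ 4 + n) = 0`. Comparing
coefficients shows that this quartic does not factor over `ℝ[x]`, so by Gauss's lemma it is
irreducible over `k(x)` for each subfield `k` of `ℝ` that contains `s`, `m`, `n`. If `x` is moreover
transcendental over `k`, then `1, y, y ^ 2, y ^ 3` are independent over `k(x)`
(`isQuarticExtension_of_quartic`). Adjoining one curve after another, evaluation stays injective
(`eq_zero_of_mem_closure_range`). So the coordinate rings are domains, `F(G)` is a field inside `ℝ`,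
and the naming can be studied through its image in `ℝ` (`map_element`, `realElement_pair`), where it
is seen to be injective and onto the generated field.

For computability no algorithm is written down. Instead there is a formal calculus with primitive
recursive rules. Its facts are equations and positivity of terms, and assertions about which entries
of a column's sequence get names. The graph enters only through the axioms for the curve parameters
`t_k`. Derivability from a finite part of the graph is `Σ₁`. If the calculus proves exactly the true
inequalities between named elements, the ordering and its complement are both recognizable from `G`,
and a search decides between them (`relComputableFrom_of_isSigmaOne`).

Completeness is proved in the ring of terms modulo provable equality. The elements all of whose
rational bounds are provable form a subring, which contains the generators because signs of `p` and
`q` at rational points locate `v_i` and `y_k`. This gives provability of strict inequalities in the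
ring generated by the generators. True equalities there are provable because the tower argument
applies again, now to the value map on terms. Both facts extend to fractions, and an induction on
columns shows that each name provably equals such a fraction (`TermRing.isRegular_named`). In this
induction, newness of an element must have a finite proof. It has one because membership of a coded
element of `k(x, y)` in `k` amounts to polynomial equations in the coefficients
(`IsQuarticExtension.div_mem_iff`). -/

/-! ### Computability with an oracle -/

section Oracle

/-- Total functions on the natural numbers that are recursive in `O`. -/
def TotalRecursiveIn (O : Set (ℕ →. ℕ)) (f : ℕ → ℕ) : Prop :=
  Nat.RecursiveIn O fun n => Part.some (f n)

variable {O : Set (ℕ →. ℕ)}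

theorem TotalRecursiveIn.of_primrec {f : ℕ → ℕ} (hf : Primrec f) : TotalRecursiveIn O f :=
  (Primrec.nat_iff.mp hf).recursiveIn

theorem TotalRecursiveIn.comp {f g : ℕ → ℕ} (hf : TotalRecursiveIn O f)
    (hg : TotalRecursiveIn O g) : TotalRecursiveIn O fun n => f (g n) :=
  (Nat.RecursiveIn.comp hf hg).of_eq fun n => by simp

theorem TotalRecursiveIn.pair {f g : ℕ → ℕ} (hf : TotalRecursiveIn O f)
    (hg : TotalRecursiveIn O g) : TotalRecursiveIn O fun n => Nat.pair (f n) (g n) :=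
  (Nat.RecursiveIn.pair hf hg).of_eq fun n => by simp [Seq.seq]

theorem TotalRecursiveIn.rec {h : ℕ → ℕ} (c : ℕ) (hh : TotalRecursiveIn O h) :
    TotalRecursiveIn O fun n => Nat.rec c (fun y i => h (Nat.pair y i)) n := by
  have hc : TotalRecursiveIn O fun _ => c := .of_primrec (Primrec.const c)
  have hr : TotalRecursiveIn O fun n => h n.unpair.2 := hh.comp (.of_primrec (by
    exact Primrec.snd.comp Primrec.unpair))
  have key := (Nat.RecursiveIn.prec hc hr)
  have hz : TotalRecursiveIn O fun n => Nat.pair 0 n :=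
    .of_primrec (Primrec₂.natPair.comp (Primrec.const 0) Primrec.id)
  refine (Nat.RecursiveIn.comp key hz).of_eq fun n => ?_
  simp only [Part.bind_eq_bind, Part.bind_some, Nat.unpair_pair]
  induction n with
  | zero => rfl
  | succ n ih => simp only [ih]; simp

/-- The first `N` values of a function. -/
def initialSegment (χ : ℕ → ℕ) (N : ℕ) : List ℕ := (List.range N).map χ

/-- This is the only use of the oracle: everything else is primitive recursive in a finite list of
its values. -/
theorem TotalRecursiveIn.encode_initialSegment {χ : ℕ → ℕ} (hχ : TotalRecursiveIn O χ) :
    TotalRecursiveIn O fun N => Encodable.encode (initialSegment χ N) := by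
  have happ : Primrec fun n : ℕ => Encodable.encode
      (((Encodable.decode (α := List ℕ) n.unpair.1).getD []) ++ [n.unpair.2]) := by
    refine Primrec.encode.comp (Primrec.list_concat.comp (Primrec.option_getD.comp
      (Primrec.decode.comp ?_) (Primrec.const [])) ?_)
    · exact Primrec.fst.comp Primrec.unpair
    · exact Primrec.snd.comp Primrec.unpair
  have hstep : TotalRecursiveIn O fun n => Encodable.encode
      (((Encodable.decode (α := List ℕ) n.unpair.2).getD []) ++ [χ n.unpair.1]) := by
    have := (TotalRecursiveIn.of_primrec (O := O) happ).comp
      (TotalRecursiveIn.pair (f := fun n => n.unpair.2) (g := fun n => χ n.unpair.1)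
        (.of_primrec (Primrec.snd.comp Primrec.unpair))
        (hχ.comp (.of_primrec (f := fun n => n.unpair.1) (Primrec.fst.comp Primrec.unpair))))
    simpa using this
  have := TotalRecursiveIn.rec (Encodable.encode ([] : List ℕ)) hstep
  convert this using 2 with N
  induction N with
  | zero => rfl
  | succ N ih => simp only [← ih]; simp [initialSegment, List.range_succ]

/-! ### `Σ₁` sets, search, and derivability -/

/-- Sets that are projections of primitive recursive relations. -/
def IsSigmaOne {α : Type*} [Primcodable α] (S : α → Prop) : Prop :=
  ∃ c : α → ℕ → Bool, Primrec₂ c ∧ ∀ a, S a ↔ ∃ w, c a w = true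

variable {α β π : Type*} [Primcodable α] [Primcodable β] [Primcodable π]

/-- Witnesses of any `Primcodable` type are represented by their codes; a number that is not a code
certifies nothing. -/
theorem IsSigmaOne.of_exists {S : α → Prop} {R : α → β → Prop} (hR : PrimrecRel R)
    (h : ∀ a, S a ↔ ∃ b, R a b) : IsSigmaOne S := by
  classical
  have hc : Primrec₂ fun (a : α) (w : ℕ) =>
      ((Encodable.decode (α := β) w).map fun b => decide (R a b)).getD false := by
    refine Primrec.option_getD.comp (Primrec.option_map (Primrec.decode.comp Primrec.snd) ?_)
      (Primrec.const false)
    exact hR.decide.comp (Primrec.fst.comp Primrec.fst) Primrec.snd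
  refine ⟨_, hc, fun a => (h a).trans ⟨?_, ?_⟩⟩
  · rintro ⟨b, hb⟩
    exact ⟨Encodable.encode b, by simpa using hb⟩
  · rintro ⟨w, hw⟩
    rcases hd : (Encodable.decode (α := β) w) with _ | b
    · simp [hd] at hw
    · exact ⟨b, by simpa [hd] using hw⟩

theorem IsSigmaOne.comp {S : β → Prop} (hS : IsSigmaOne S) {f : α → β} (hf : Primrec f) :
    IsSigmaOne fun a => S (f a) := by
  obtain ⟨c, hc, h⟩ := hS
  exact ⟨fun a w => c (f a) w, hc.comp (hf.comp Primrec.fst) Primrec.snd, fun a => h _⟩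

theorem IsSigmaOne.or {S T : α → Prop} (hS : IsSigmaOne S) (hT : IsSigmaOne T) :
    IsSigmaOne fun a => S a ∨ T a := by
  obtain ⟨c, hc, h⟩ := hS
  obtain ⟨d, hd, h'⟩ := hT
  refine ⟨fun a w => c a w || d a w, Primrec.or.comp₂ hc hd, fun a => ?_⟩
  simp only [h, h', Bool.or_eq_true, exists_or]

/-- A relation on `ω` is computable from `T` if it and its complement can be recognized by
certificates that refer to initial segments of the characteristic function of `T`. -/
theorem relComputableFrom_of_isSigmaOne {R T : ℕ → ℕ → Prop} {χ : ℕ → ℕ}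
    (hχ : relChar T = fun n => Part.some (χ n)) {A B : List ℕ × ℕ → Prop}
    (hA : IsSigmaOne A) (hB : IsSigmaOne B)
    (hRA : ∀ n : ℕ, R n.unpair.1 n.unpair.2 ↔ ∃ N, A (initialSegment χ N, n))
    (hRB : ∀ n : ℕ, ¬ R n.unpair.1 n.unpair.2 ↔ ∃ N, B (initialSegment χ N, n)) :
    RelComputableFrom R T := by
  classical
  obtain ⟨a, ha, hA⟩ := hA
  obtain ⟨b, hb, hB⟩ := hB
  set O : Set (ℕ →. ℕ) := {relChar T} with hO
  have hχr : TotalRecursiveIn O χ := by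
    have : Nat.RecursiveIn O (relChar T) := .oracle _ rfl
    rwa [hχ] at this
  have hseg := hχr.encode_initialSegment
  let dec : ℕ → List ℕ := fun n => (Encodable.decode (α := List ℕ) n).getD []
  have hdec : Primrec dec := Primrec.option_getD.comp Primrec.decode (Primrec.const [])
  have hfst : Primrec fun n : ℕ => n.unpair.1 := Primrec.fst.comp Primrec.unpair
  have hsnd : Primrec fun n : ℕ => n.unpair.2 := Primrec.snd.comp Primrec.unpair
  -- inputs are of the form `⟨segment, ⟨n, ⟨N, w⟩⟩⟩`
  have hinp : Primrec fun m : ℕ => ((dec m.unpair.1, m.unpair.2.unpair.1) : List ℕ × ℕ) :=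
    Primrec.pair (hdec.comp hfst) (hfst.comp hsnd)
  have hw : Primrec fun m : ℕ => m.unpair.2.unpair.2.unpair.2 := hsnd.comp (hsnd.comp hsnd)
  -- The search operator looks for a zero, so an accepted certificate must give the value `0`.
  have htest : Primrec fun m : ℕ =>
      bif a (dec m.unpair.1, m.unpair.2.unpair.1) m.unpair.2.unpair.2.unpair.2 ||
          b (dec m.unpair.1, m.unpair.2.unpair.1) m.unpair.2.unpair.2.unpair.2 then 0 else 1 :=
    Primrec.cond (Primrec.or.comp (ha.comp hinp hw) (hb.comp hinp hw)) (Primrec.const 0)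
      (Primrec.const 1)
  have hout : Primrec fun m : ℕ =>
      bif a (dec m.unpair.1, m.unpair.2.unpair.1) m.unpair.2.unpair.2.unpair.2 then 1 else 0 :=
    Primrec.cond (ha.comp hinp hw) (Primrec.const 1) (Primrec.const 0)
  have hprep : TotalRecursiveIn O fun m =>
      Nat.pair (Encodable.encode (initialSegment χ m.unpair.2.unpair.1)) m :=
    .pair (hseg.comp (f := fun N => Encodable.encode (initialSegment χ N))
      (.of_primrec (hfst.comp hsnd))) (.of_primrec Primrec.id)
  have htest' := (TotalRecursiveIn.of_primrec (O := O) htest).comp hprep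
  have hout' := (TotalRecursiveIn.of_primrec (O := O) hout).comp hprep
  simp only [Nat.unpair_pair, dec, Encodable.encodek, Option.getD_some] at htest' hout'
  have hfind := Nat.RecursiveIn.rfind htest'
  have hid : TotalRecursiveIn O fun n => n := .of_primrec Primrec.id
  have hpair := Nat.RecursiveIn.pair hid hfind
  have hfin := Nat.RecursiveIn.comp hout' hpair
  refine RecursiveIn.iff_nat.mpr (hfin.of_eq fun n => ?_)
  -- The search runs over pairs `k = ⟨N, w⟩` and terminates because either the relation or its
  -- complement has a certificate.
  have hdom : ∃ k : ℕ, (a (initialSegment χ k.unpair.1, n) k.unpair.2 ||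
      b (initialSegment χ k.unpair.1, n) k.unpair.2) = true := by
    by_cases hR : R n.unpair.1 n.unpair.2
    · obtain ⟨N, hN⟩ := (hRA n).mp hR
      obtain ⟨w, hw⟩ := (hA _).mp hN
      exact ⟨Nat.pair N w, by simp [hw]⟩
    · obtain ⟨N, hN⟩ := (hRB n).mp hR
      obtain ⟨w, hw⟩ := (hB _).mp hN
      exact ⟨Nat.pair N w, by simp [hw]⟩
  have hk := Nat.find_spec hdom
  have hmin := fun m => Nat.find_min hdom (m := m)
  set k := Nat.find hdom with hkdef
  have hrf : (Nat.rfind fun m => (fun m => decide (m = 0)) <$> Part.some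
      (bif a (initialSegment χ (Nat.pair n m).unpair.2.unpair.1, (Nat.pair n m).unpair.1)
          (Nat.pair n m).unpair.2.unpair.2 ||
        b (initialSegment χ (Nat.pair n m).unpair.2.unpair.1, (Nat.pair n m).unpair.1)
          (Nat.pair n m).unpair.2.unpair.2 then 0 else 1)) = Part.some k := by
    refine Part.eq_some_iff.mpr (Nat.mem_rfind.mpr ⟨?_, ?_⟩)
    · simp only [Nat.unpair_pair, hk]; simp
    · intro m hm
      have := hmin m hm
      simp only [Nat.unpair_pair, Bool.not_eq_true] at this ⊢
      simp [this]
  rw [hrf]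
  simp only [Part.map_eq_map, Part.map_some, Seq.seq, Part.bind_eq_bind, Part.bind_some,
    Nat.unpair_pair, relChar]
  -- The certificate that is found decides the question, since `A` and `B` are never both certified
  -- for the same `n`.
  by_cases hR : R n.unpair.1 n.unpair.2
  · have : a (initialSegment χ k.unpair.1, n) k.unpair.2 = true := by
      rcases Bool.or_eq_true _ _ ▸ hk with h | h
      · exact h
      · exact absurd hR ((hRB n).mpr ⟨_, (hB _).mpr ⟨_, h⟩⟩)
    simp [this, hR]
  · have : a (initialSegment χ k.unpair.1, n) k.unpair.2 = false := by
      by_contra h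
      exact hR ((hRA n).mpr ⟨_, (hA _).mpr ⟨_, by simpa using h⟩⟩)
    simp [this, hR]

/-- The facts derivable by a system of rules `R x premises conclusion` with a parameter `x`. -/
inductive Derivable (R : π → List α → α → Prop) (x : π) : α → Prop
  | intro (l : List α) (a : α) (h : R x l a) (hl : ∀ b ∈ l, Derivable R x b) : Derivable R x a

/-- Whether a list of steps, each consisting of premises, conclusion and a witness for the rule,
is a derivation. The last step comes first. -/
def checkDerivation (c : π × List α × α → ℕ → Bool) [DecidableEq α] (x : π) :
    List ((List α × α) × ℕ) → Bool
  | [] => true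
  | s :: D => checkDerivation c x D && (c (x, s.1) s.2 &&
      decide (∀ b ∈ s.1.1, ∃ d ∈ D, d.1.2 = b))

theorem primrec_checkDerivation {c : π × List α × α → ℕ → Bool} (hc : Primrec₂ c)
    [DecidableEq α] : Primrec₂ (checkDerivation c) := by
  have hrel : PrimrecRel fun (D : List ((List α × α) × ℕ)) (b : α) => ∃ d ∈ D, d.1.2 = b :=
    PrimrecRel.exists_mem_list (R := fun (d : (List α × α) × ℕ) b => d.1.2 = b)
      (Primrec.eq.comp (Primrec.snd.comp (Primrec.fst.comp Primrec.fst)) Primrec.snd)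
  have hall : PrimrecRel fun (l : List α) (D : List ((List α × α) × ℕ)) =>
      ∀ b ∈ l, ∃ d ∈ D, d.1.2 = b :=
    PrimrecRel.forall_mem_list (R := fun b (D : List ((List α × α) × ℕ)) => ∃ d ∈ D, d.1.2 = b)
      hrel.swap
  have hh : Primrec₂ fun (z : π × List ((List α × α) × ℕ))
      (t : ((List α × α) × ℕ) × List ((List α × α) × ℕ) × Bool) =>
      t.2.2 && (c (z.1, t.1.1) t.1.2 && decide (∀ b ∈ t.1.1.1, ∃ d ∈ t.2.1, d.1.2 = b)) := by
    have ht : Primrec fun q : (π × List ((List α × α) × ℕ)) ×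
        (((List α × α) × ℕ) × List ((List α × α) × ℕ) × Bool) => q.2 := Primrec.snd
    have hs := Primrec.fst.comp ht
    have hD := Primrec.fst.comp (Primrec.snd.comp ht)
    refine Primrec.and.comp (Primrec.snd.comp (Primrec.snd.comp ht)) (Primrec.and.comp
      (hc.comp (Primrec.pair (Primrec.fst.comp Primrec.fst) (Primrec.fst.comp hs))
        (Primrec.snd.comp hs)) ?_)
    exact PrimrecPred.decide (hall.comp (Primrec.fst.comp (Primrec.fst.comp hs)) hD)
  refine (Primrec.list_rec (Primrec.snd (α := π)) (Primrec.const true) hh).of_eq fun z => ?_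
  obtain ⟨x, D⟩ := z
  induction D with
  | nil => rfl
  | cons s D ih => simp only [checkDerivation, ← ih]

-- A derivation tree is flattened into a list in which every step uses only conclusions further down
-- the list. Each step carries a witness for its rule, so the list can be checked primitive
-- recursively.
omit [Primcodable α] [Primcodable π] in
theorem Derivable.iff_checkDerivation {R : π → List α → α → Prop} {c : π × List α × α → ℕ → Bool}
    (h : ∀ z : π × List α × α, R z.1 z.2.1 z.2.2 ↔ ∃ w, c z w = true) [DecidableEq α] (x : π)
    (a : α) : Derivable R x a ↔
      ∃ D : List ((List α × α) × ℕ), checkDerivation c x D = true ∧ ∃ d ∈ D, d.1.2 = a := by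
  constructor
  -- Correct lists can be concatenated: what a step may use only grows.
  · have happ : ∀ D E : List ((List α × α) × ℕ), checkDerivation c x D = true →
        checkDerivation c x E = true → checkDerivation c x (D ++ E) = true := by
      intro D E hD hE
      induction D with
      | nil => exact hE
      | cons s D ih =>
        simp only [checkDerivation, List.cons_append, Bool.and_eq_true,
          decide_eq_true_eq] at hD ⊢
        refine ⟨ih hD.1, hD.2.1, fun b hb => ?_⟩
        obtain ⟨d, hd, hdb⟩ := hD.2.2 b hb
        exact ⟨d, List.mem_append_left _ hd, hdb⟩
    intro H
    induction H with
    | intro l a hR hl ih =>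
      have : ∃ D : List ((List α × α) × ℕ), checkDerivation c x D = true ∧
          ∀ b ∈ l, ∃ d ∈ D, d.1.2 = b := by
        clear hR
        induction l with
        | nil => exact ⟨[], rfl, by simp⟩
        | cons b l ihl =>
          obtain ⟨D, hD, hDl⟩ := ihl (fun b hb => hl b (List.mem_cons_of_mem _ hb))
            (fun b hb => ih b (List.mem_cons_of_mem _ hb))
          obtain ⟨E, hE, e, he, heb⟩ := ih b List.mem_cons_self
          refine ⟨D ++ E, happ D E hD hE, fun b' hb' => ?_⟩
          rcases List.mem_cons.mp hb' with rfl | hb'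
          · exact ⟨e, List.mem_append_right _ he, heb⟩
          · obtain ⟨d, hd, hdb⟩ := hDl b' hb'
            exact ⟨d, List.mem_append_left _ hd, hdb⟩
      obtain ⟨D, hD, hDl⟩ := this
      obtain ⟨w, hw⟩ := (h (x, l, a)).mp hR
      refine ⟨((l, a), w) :: D, ?_, _, List.mem_cons_self, rfl⟩
      simp only [checkDerivation, Bool.and_eq_true, decide_eq_true_eq]
      exact ⟨hD, hw, hDl⟩
  · rintro ⟨D, hD, hd⟩
    induction D generalizing a with
    | nil => simp at hd
    | cons s D ih =>
      simp only [checkDerivation, Bool.and_eq_true, decide_eq_true_eq] at hD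
      obtain ⟨d, hd, rfl⟩ := hd
      rcases List.mem_cons.mp hd with rfl | hd
      · exact .intro _ _ ((h (x, d.1)).mpr ⟨_, hD.2.1⟩) fun b hb => ih b hD.1 (hD.2.2 b hb)
      · exact ih _ hD.1 ⟨d, hd, rfl⟩

/-- The facts derivable by a `Σ₁` system of rules form a `Σ₁` set. -/
theorem IsSigmaOne.derivable {R : π → List α → α → Prop}
    (hR : IsSigmaOne fun z : π × List α × α => R z.1 z.2.1 z.2.2) :
    IsSigmaOne fun z : π × α => Derivable R z.1 z.2 := by
  classical
  obtain ⟨c, hc, h⟩ := hR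
  have hmem : PrimrecRel fun (D : List ((List α × α) × ℕ)) (b : α) => ∃ d ∈ D, d.1.2 = b :=
    PrimrecRel.exists_mem_list (R := fun (d : (List α × α) × ℕ) b => d.1.2 = b)
      (Primrec.eq.comp (Primrec.snd.comp (Primrec.fst.comp Primrec.fst)) Primrec.snd)
  refine IsSigmaOne.of_exists (β := List ((List α × α) × ℕ))
    (R := fun z D => checkDerivation c z.1 D = true ∧ ∃ d ∈ D, d.1.2 = z.2)
    (PrimrecPred.and ?_ ?_) fun z => Derivable.iff_checkDerivation h z.1 z.2
  · exact Primrec.eq.comp ((primrec_checkDerivation hc).comp (Primrec.fst.comp Primrec.fst)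
      Primrec.snd) (Primrec.const true)
  · exact hmem.comp Primrec.snd (Primrec.snd.comp Primrec.fst)

end Oracle

/-! ### Algebraically independent computable real numbers -/

section Independent

open Filter Topology
open scoped Nat

/-- The `l`-th term of the lacunary series for the `j`-th number. -/
noncomputable def gapTerm (j l : ℕ) : ℝ :=
  if l.unpair.1 = j then (1 / 2) ^ (l + 4)! else 0

/-- Partial sums of the lacunary series. -/
noncomputable def gapSum (k j : ℕ) : ℝ := ∑ l ∈ Finset.range k, gapTerm j l

/-- A family of real numbers given by lacunary series with disjoint supports. -/
noncomputable def gapNum (j : ℕ) : ℝ := ∑' l, gapTerm j l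

theorem gapTerm_nonneg (j l : ℕ) : 0 ≤ gapTerm j l := by
  unfold gapTerm; split_ifs <;> positivity

/-- Since `(l + k + 4)! ≥ (k + 4)! + l`, tails are dominated by a geometric series. -/
theorem gapTerm_le (j l k : ℕ) : gapTerm j (l + k) ≤ (1 / 2) ^ (k + 4)! * (1 / 2) ^ l := by
  unfold gapTerm
  split_ifs
  · rw [← pow_add]
    refine pow_le_pow_of_le_one (by norm_num) (by norm_num) ?_
    clear * -
    induction l with
    | zero => simp
    | succ l ih =>
      have h1 : (l + 1 + k + 4)! = (l + k + 5) * (l + k + 4)! := by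
        rw [show l + 1 + k + 4 = (l + k + 4) + 1 by ring, Nat.factorial_succ]
      have h2 := Nat.factorial_pos (l + k + 4)
      rw [h1]; nlinarith [Nat.zero_le (l + k)]
  · positivity

theorem summable_gapTerm (j : ℕ) : Summable (gapTerm j) := by
  refine Summable.of_nonneg_of_le (gapTerm_nonneg j)
    (fun l => by simpa using gapTerm_le j l 0)
    (summable_geometric_two.mul_left ((1 / 2 : ℝ) ^ 4!))

theorem gapNum_sub_gapSum (k j : ℕ) : gapNum j - gapSum k j = ∑' l, gapTerm j (l + k) := by
  rw [gapNum, gapSum, ← (summable_gapTerm j).sum_add_tsum_nat_add k]; ring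

theorem gapNum_sub_gapSum_le (k j : ℕ) : gapNum j - gapSum k j ≤ 2 * (1 / 2) ^ (k + 4)! := by
  rw [gapNum_sub_gapSum]
  refine (((summable_nat_add_iff k).mpr (summable_gapTerm j)).tsum_le_tsum
    (fun l => gapTerm_le j l k) (summable_geometric_two.mul_left _)).trans_eq ?_
  rw [tsum_mul_left, tsum_geometric_two]; ring

theorem frequently_unpair_fst (j : ℕ) : ∃ᶠ k : ℕ in atTop, k.unpair.1 = j :=
  frequently_atTop.mpr fun k => ⟨Nat.pair j k, Nat.right_le_pair j k, by simp⟩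

/-- Strict, because every `j` is the first component of infinitely many indices, so each tail has a
nonzero term. -/
theorem gapSum_lt_gapNum (k j : ℕ) : gapSum k j < gapNum j := by
  obtain ⟨l, hl, hj⟩ := frequently_atTop.mp (frequently_unpair_fst j) k
  rw [← sub_pos, gapNum_sub_gapSum]
  refine ((summable_nat_add_iff k).mpr (summable_gapTerm j)).tsum_pos
    (fun l => gapTerm_nonneg _ _) (l - k) ?_
  rw [Nat.sub_add_cancel hl, gapTerm, if_pos hj]
  positivity

theorem gapNum_pos (j : ℕ) : 0 < gapNum j := by simpa [gapSum] using gapSum_lt_gapNum 0 j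

theorem gapNum_lt (j : ℕ) : gapNum j < 1 / 1000 := by
  have := gapNum_sub_gapSum_le 0 j
  simp only [gapSum, Finset.range_zero, Finset.sum_empty, sub_zero] at this
  refine this.trans_lt ?_
  norm_num [Nat.factorial]

theorem tendsto_gap : Tendsto (fun k : ℕ => 2 * (1 / 2 : ℝ) ^ (k + 4)!) atTop (𝓝 0) := by
  have h1 : Tendsto (fun k : ℕ => (k + 4)!) atTop atTop :=
    factorial_tendsto_atTop.comp (tendsto_add_atTop_nat 4)
  simpa using ((tendsto_pow_atTop_nhds_zero_of_lt_one (r := (1 / 2 : ℝ)) (by norm_num)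
    (by norm_num)).comp h1).const_mul 2

/-- The terms with index below `k` have exponents at most `(k + 3)!`. -/
theorem gapSum_mul (k j : ℕ) : ∃ z : ℤ, gapSum k j * 2 ^ (k + 3)! = z := by
  induction k with
  | zero => exact ⟨0, by simp [gapSum]⟩
  | succ k ih =>
    obtain ⟨z, hz⟩ := ih
    have hle : (k + 3)! ≤ (k + 4)! := Nat.factorial_le (by omega)
    obtain ⟨d, hd⟩ := Nat.exists_eq_add_of_le hle
    have h2 : gapTerm j k * 2 ^ (k + 4)! = if k.unpair.1 = j then 1 else 0 := by
      unfold gapTerm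
      split_ifs
      · rw [← mul_pow]; norm_num
      · simp
    refine ⟨z * 2 ^ d + if k.unpair.1 = j then 1 else 0, ?_⟩
    have h3 : gapSum (k + 1) j = gapSum k j + gapTerm j k := Finset.sum_range_succ _ _
    rw [h3, add_mul, show k + 1 + 3 = k + 4 by ring, h2, hd, pow_add, ← mul_assoc, hz]
    push_cast
    rfl

variable {σ : Type*}

/-- The number `d` acts as a degree bound. What matters is that the exponent of the denominator is
`d (k + 3)!` with `d` and `D` independent of `k`. -/
theorem exists_denominator (e : σ → ℕ) (P : MvPolynomial σ ℚ) :
    ∃ D : ℕ, 0 < D ∧ ∃ d : ℕ, ∀ k, ∃ z : ℤ,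
      MvPolynomial.aeval (fun i => gapSum k (e i)) P * (D * 2 ^ (d * (k + 3)!)) = z := by
  induction P using MvPolynomial.induction_on with
  | C q =>
    refine ⟨q.den, q.den_pos, 0, fun k => ⟨q.num, ?_⟩⟩
    have := Rat.mul_den_eq_num q
    simp only [MvPolynomial.aeval_C, eq_ratCast, zero_mul, pow_zero, mul_one]
    exact_mod_cast this
  | add P Q hP hQ =>
    obtain ⟨D, hD, d, h⟩ := hP
    obtain ⟨D', hD', d', h'⟩ := hQ
    refine ⟨D * D', Nat.mul_pos hD hD', d + d', fun k => ?_⟩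
    obtain ⟨z, hz⟩ := h k
    obtain ⟨z', hz'⟩ := h' k
    refine ⟨z * (D' * 2 ^ (d' * (k + 3)!)) + z' * (D * 2 ^ (d * (k + 3)!)), ?_⟩
    push_cast
    rw [← hz, ← hz', map_add, add_mul (d : ℕ) d', pow_add]
    ring
  | mul_X P i hP =>
    obtain ⟨D, hD, d, h⟩ := hP
    refine ⟨D, hD, d + 1, fun k => ?_⟩
    obtain ⟨z, hz⟩ := h k
    obtain ⟨z', hz'⟩ := gapSum_mul k (e i)
    refine ⟨z * z', ?_⟩
    push_cast
    rw [← hz, ← hz', map_mul, MvPolynomial.aeval_X, add_mul, pow_add]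
    ring

variable [Fintype σ]

/-- Strict differentiability is needed because it will be applied to differences between two moving
points. -/
theorem hasStrictFDerivAt_aeval (P : MvPolynomial σ ℚ) (b : σ → ℝ) :
    HasStrictFDerivAt (fun x : σ → ℝ => MvPolynomial.aeval x P)
      (∑ i, MvPolynomial.aeval b (MvPolynomial.pderiv i P) •
        (ContinuousLinearMap.proj i : (σ → ℝ) →L[ℝ] ℝ)) b := by
  classical
  induction P using MvPolynomial.induction_on with
  | C q => simpa using hasStrictFDerivAt_const (𝕜 := ℝ) (q : ℝ) b
  | add P Q hP hQ =>
    simp only [map_add, add_smul, Finset.sum_add_distrib]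
    exact hP.add hQ
  | mul_X P i hP =>
    have h := hP.mul (ContinuousLinearMap.proj i : (σ → ℝ) →L[ℝ] ℝ).hasStrictFDerivAt (x := b)
    simp only [map_mul, MvPolynomial.aeval_X]
    refine h.congr_fderiv (ContinuousLinearMap.ext fun x => ?_)
    have hs : MvPolynomial.aeval b P * x i =
        ∑ j, if i = j then MvPolynomial.aeval b P * x j else 0 := by simp
    simp only [MvPolynomial.pderiv_mul, MvPolynomial.pderiv_X, map_add, map_mul,
      MvPolynomial.aeval_X, Pi.single_apply, add_apply, sum_apply, smul_apply,
      ContinuousLinearMap.proj_apply, smul_eq_mul, Finset.mul_sum]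
    rw [hs, ← Finset.sum_add_distrib]
    refine Finset.sum_congr rfl fun j _ => ?_
    split_ifs <;> simp <;> ring

variable {e : σ → ℕ}

theorem norm_gapSum_sub_le (k : ℕ) :
    ‖(fun i => gapSum k (e i)) - fun i => gapNum (e i)‖ ≤ 2 * (1 / 2) ^ (k + 4)! := by
  refine (pi_norm_le_iff_of_nonneg (by positivity)).mpr fun i => ?_
  rw [Pi.sub_apply, Real.norm_eq_abs, abs_sub_comm, abs_of_pos (sub_pos.mpr (gapSum_lt_gapNum _ _))]
  exact gapNum_sub_gapSum_le _ _

theorem tendsto_gapSum :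
    Tendsto (fun k i => gapSum k (e i)) atTop (𝓝 fun i => gapNum (e i)) :=
  tendsto_iff_norm_sub_tendsto_zero.mpr
    (squeeze_zero (fun _ => norm_nonneg _) norm_gapSum_sub_le tendsto_gap)

/-- Liouville's argument. The value at the `k`-th partial sums is `O(2 ^ (-(k + 4)!))`, while its
denominator divides `D * 2 ^ (d (k + 3)!)`. As `(k + 4)! ≥ (d + 1) (k + 3)!` for `k ≥ d`, clearing
the denominator leaves an integer of absolute value less than `1`. -/
theorem eventually_aeval_gapSum_eq_zero {P : MvPolynomial σ ℚ}
    (hP : MvPolynomial.aeval (fun i => gapNum (e i)) P = 0) :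
    ∀ᶠ k in atTop, MvPolynomial.aeval (fun i => gapSum k (e i)) P = 0 := by
  obtain ⟨D, hD, d, hden⟩ := exists_denominator e P
  have hO := ((hasStrictFDerivAt_aeval P fun i => gapNum (e i)).hasFDerivAt.isBigO_sub.comp_tendsto
    (tendsto_gapSum (e := e)))
  obtain ⟨C, hC, hO⟩ := hO.exists_pos
  have hbig : ∀ᶠ k : ℕ in atTop, C * 2 * D < 2 ^ (k + 3)! := by
    have h1 : Tendsto (fun k : ℕ => (2 : ℝ) ^ (k + 3)!) atTop atTop :=
      (tendsto_pow_atTop_atTop_of_one_lt (by norm_num)).comp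
        (factorial_tendsto_atTop.comp (tendsto_add_atTop_nat 3))
    exact h1.eventually_gt_atTop _
  filter_upwards [hO.bound, hbig, eventually_ge_atTop d] with k hk hbig hdk
  obtain ⟨z, hz⟩ := hden k
  simp only [Function.comp_apply, hP, sub_zero] at hk
  set V := MvPolynomial.aeval (fun i => gapSum k (e i)) P
  have hV : |V| ≤ C * (2 * (1 / 2) ^ (k + 4)!) :=
    hk.trans (mul_le_mul_of_nonneg_left (norm_gapSum_sub_le k) hC.le)
  have hz1 : |(z : ℝ)| < 1 := by
    have hpos : (0 : ℝ) < D * 2 ^ (d * (k + 3)!) := by positivity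
    rw [← hz, abs_mul, abs_of_pos hpos]
    have hle : (d + 1) * (k + 3)! ≤ (k + 4)! := by
      rw [show k + 4 = (k + 3) + 1 by ring, Nat.factorial_succ]
      exact Nat.mul_le_mul_right _ (by omega)
    have h2 : (1 / 2 : ℝ) ^ (k + 4)! * 2 ^ ((d + 1) * (k + 3)!) ≤ 1 := by
      rw [one_div, inv_pow, inv_mul_le_one₀ (by positivity)]
      exact pow_le_pow_right₀ (by norm_num) hle
    rw [add_mul, pow_add, one_mul] at h2
    have hX : (0 : ℝ) < 2 ^ (k + 3)! := by positivity
    calc |V| * (D * 2 ^ (d * (k + 3)!))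
        ≤ C * (2 * (1 / 2) ^ (k + 4)!) * (D * 2 ^ (d * (k + 3)!)) :=
          mul_le_mul_of_nonneg_right hV hpos.le
      _ = C * 2 * D * ((1 / 2) ^ (k + 4)! * 2 ^ (d * (k + 3)!)) := by ring
      _ < 2 ^ (k + 3)! * ((1 / 2) ^ (k + 4)! * 2 ^ (d * (k + 3)!)) :=
          mul_lt_mul_of_pos_right hbig (by positivity)
      _ ≤ 1 := by linarith
  have hz0 : z = 0 := by
    have : |z| < 1 := by exact_mod_cast hz1
    exact Int.abs_lt_one_iff.mp this
  rw [hz0, Int.cast_zero, mul_eq_zero] at hz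
  exact hz.resolve_right (by positivity)

/-- For infinitely many `k` the `k`-th and `(k + 1)`-st partial sums differ in the `i`-th coordinate
alone, by disjointness of supports and injectivity of `e`. Eventually `P` vanishes at both points,
so the derivative in this direction is smaller than any `c > 0`. -/
theorem aeval_pderiv_eq_zero (he : Function.Injective e) {P : MvPolynomial σ ℚ}
    (hP : MvPolynomial.aeval (fun i => gapNum (e i)) P = 0) (i : σ) :
    MvPolynomial.aeval (fun i => gapNum (e i)) (MvPolynomial.pderiv i P) = 0 := by
  classical
  set b : σ → ℝ := fun i => gapNum (e i)
  have hd := hasStrictFDerivAt_aeval P b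
  set L := ∑ i, MvPolynomial.aeval b (MvPolynomial.pderiv i P) •
        (ContinuousLinearMap.proj i : (σ → ℝ) →L[ℝ] ℝ) with hL
  have hLi : L (Pi.single i 1) = MvPolynomial.aeval b (MvPolynomial.pderiv i P) := by
    simp [hL, Pi.single_apply]
  rw [← hLi]
  have hT : Tendsto (fun k : ℕ => ((fun i => gapSum (k + 1) (e i)), fun i => gapSum k (e i)))
      atTop (𝓝 (b, b)) :=
    ((tendsto_gapSum (e := e)).comp (tendsto_add_atTop_nat 1)).prodMk_nhds
      (tendsto_gapSum (e := e))
  have ho := hd.isLittleO.comp_tendsto hT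
  have hz := eventually_aeval_gapSum_eq_zero (e := e) hP
  have hz' := (tendsto_add_atTop_nat 1).eventually hz
  refine norm_le_zero_iff.mp (le_of_forall_pos_le_add fun c hc => ?_)
  obtain ⟨k, hk, h0, h1, h2⟩ := ((frequently_unpair_fst (e i)).and_eventually
    (hz.and (hz'.and (ho.bound hc)))).exists
  have hdiff : ((fun i => gapSum (k + 1) (e i)) - fun i => gapSum k (e i)) =
      ((1 / 2 : ℝ) ^ (k + 4)!) • (Pi.single i 1 : σ → ℝ) := by
    ext j
    have : gapSum (k + 1) (e j) = gapSum k (e j) + gapTerm (e j) k := Finset.sum_range_succ _ _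
    simp only [Pi.sub_apply, this, add_sub_cancel_left, gapTerm, hk, Pi.smul_apply,
      Pi.single_apply, smul_eq_mul, he.eq_iff]
    by_cases hij : i = j <;> simp [hij, eq_comm]
  simp only [Function.comp_apply, h0, h1, sub_zero, hdiff, map_smul, zero_sub, norm_neg,
    norm_smul] at h2
  have hn : ‖(Pi.single i 1 : σ → ℝ)‖ = 1 := by
    rw [Pi.norm_single, norm_one]
  rw [hn] at h2
  have hpos : 0 < ‖(1 / 2 : ℝ) ^ (k + 4)!‖ := norm_pos_iff.mpr (by positivity)
  have : ‖(1 / 2 : ℝ) ^ (k + 4)!‖ * ‖L (Pi.single i 1)‖ ≤ ‖(1 / 2 : ℝ) ^ (k + 4)!‖ * c := by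
    linarith
  simpa using le_of_mul_le_mul_left this hpos

/-- Induction on the total degree: all partial derivatives of a relation are relations of smaller
degree, hence zero polynomials. In characteristic zero the relation is then constant. -/
theorem algebraicIndependent_gapNum_comp (he : Function.Injective e) :
    AlgebraicIndependent ℚ fun i => gapNum (e i) := by
  classical
  refine (injective_iff_map_eq_zero _).mpr ?_
  suffices H : ∀ n, ∀ P : MvPolynomial σ ℚ, P.totalDegree ≤ n →
      MvPolynomial.aeval (fun i => gapNum (e i)) P = 0 → P = 0 from fun P => H _ P le_rfl
  intro n
  induction n with
  | zero =>
    intro P hn hP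
    rw [MvPolynomial.totalDegree_eq_zero_iff_eq_C.mp (Nat.le_zero.mp hn)] at hP ⊢
    have : ((MvPolynomial.coeff 0 P : ℚ) : ℝ) = 0 := by simpa using hP
    rw [Rat.cast_eq_zero.mp this, map_zero]
  | succ n ih =>
    intro P hn hP
    have hder : ∀ i, MvPolynomial.pderiv i P = 0 := fun i => by
      refine ih _ (Finset.sup_le fun m hm => ?_)
        (aeval_pderiv_eq_zero he hP i)
      rw [MvPolynomial.mem_support_iff, MvPolynomial.coeff_pderiv] at hm
      have h1 := MvPolynomial.le_totalDegree
        (MvPolynomial.mem_support_iff.mpr (left_ne_zero_of_mul hm))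
      rw [Finsupp.sum_add_index' (by simp) (by simp)] at h1
      simp only [Finsupp.sum_single_index] at h1
      omega
    have hC : P = MvPolynomial.C (MvPolynomial.coeff 0 P) := by
      ext m
      rw [MvPolynomial.coeff_C]
      split_ifs with h0
      · rw [h0]
      · obtain ⟨i, hi⟩ := Finsupp.ne_iff.mp (Ne.symm h0)
        have hm : m = (m - Finsupp.single i 1) + Finsupp.single i 1 := by
          ext j
          by_cases hj : i = j
          · subst hj
            have : 0 < m i := Nat.pos_of_ne_zero hi
            simp; omega
          · simp [hj]
        have h1 := congrArg (MvPolynomial.coeff (m - Finsupp.single i 1)) (hder i)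
        rw [MvPolynomial.coeff_pderiv, ← hm, MvPolynomial.coeff_zero] at h1
        refine (mul_eq_zero.mp h1).resolve_right ?_
        positivity
    refine ih P ?_ hP
    rw [hC, MvPolynomial.totalDegree_C]
    exact Nat.zero_le _

end Independent

theorem algebraicIndependent_gapNum : AlgebraicIndependent ℚ gapNum :=
  algebraicIndependent_of_finite_type fun t ht => by
    have := ht.fintype
    exact algebraicIndependent_gapNum_comp Subtype.val_injective

/-! ### Irreducibility of the quartics -/

section Quartic

open Polynomial

/-- The hypotheses are coefficients in the equation for a root `y = a x + b`. Those of `x ^ 3` and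
`x ^ 2` give `4 a + 3 s = 0` and `6 a + 3 s = 0`, so `a = 0`, against the coefficient of `x ^ 4`. -/
theorem quartic_no_linear {s m n a b : ℝ} (hm : 0 < m) (hn : n ≠ 0)
    (h4 : a ^ 4 + s * a ^ 3 + m = 0) (h3 : 4 * a ^ 3 * b + 3 * s * a ^ 2 * b = 0)
    (h2 : 6 * a ^ 2 * b ^ 2 + 3 * s * a * b ^ 2 = 0) (h0 : b ^ 4 + s * b + m * n = 0) : False := by
  have ha : a ≠ 0 := by rintro rfl; simp at h4; exact hm.ne' h4
  have hb : b ≠ 0 := by rintro rfl; simp at h0; exact h0.elim hm.ne' hn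
  have e3 : 4 * a + 3 * s = 0 := by
    have : a ^ 2 * b * (4 * a + 3 * s) = 0 := by linear_combination h3
    simpa [ha, hb] using this
  have e2 : 6 * a + 3 * s = 0 := by
    have : a * b ^ 2 * (6 * a + 3 * s) = 0 := by linear_combination h2
    simpa [ha, hb] using this
  exact ha (by linarith)

/-- The hypotheses are coefficients in a factorization into `y ^ 2 + (a x + b) y + (c x ^ 2 + d x +
e)` and its primed analogue. With `l = c' / c > 0` one gets `a' = -l a` and `d' = -l d`. If `d = 0`,
then `e' = -l e`, which forces `l = 1` and `s = a + a' = 0`. Otherwise `e' = l e` and `c = m n e`,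
so `l c ^ 2 = m` and `l e ^ 2 = m n` yield `m ^ 2 n ^ 3 = 1`, the excluded case. -/
theorem quartic_no_quadratic {s m n a a' b b' c c' d d' e e' : ℝ} (hs : s ≠ 0) (hm : 0 < m)
    (hmn : m ^ 2 * n ^ 3 ≠ 1) (h1 : a + a' = s) (h2 : b + b' = 0)
    (h3 : c + c' + a * a' = 0) (h5 : e + e' + b * b' = 0)
    (h6 : a * c' + a' * c = 0) (h7 : a * d' + a' * d + (b * c' + b' * c) = 0)
    (h9 : b * e' + b' * e = s) (h10 : c * c' = m) (h11 : c * d' + c' * d = 0)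
    (h12 : c * e' + c' * e + d * d' = 0) (h13 : d * e' + d' * e = 0) (h14 : e * e' = m * n) :
    False := by
  have hc : c ≠ 0 := by rintro rfl; simp at h10; exact hm.ne h10
  obtain ⟨l, rfl⟩ : ∃ l, c' = l * c := ⟨c' / c, by field_simp⟩
  have hl : 0 < l := by
    by_contra h
    have : l * c ^ 2 ≤ 0 := mul_nonpos_of_nonpos_of_nonneg (not_lt.mp h) (sq_nonneg c)
    nlinarith
  obtain rfl : b' = -b := by linarith
  have ha' : a' = -l * a := by
    have : c * (a' + l * a) = 0 := by linear_combination h6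
    have := (mul_eq_zero.mp this).resolve_left hc
    linarith
  have hd' : d' = -l * d := by
    have : c * (d' + l * d) = 0 := by linear_combination h11
    have := (mul_eq_zero.mp this).resolve_left hc
    linarith
  subst ha' hd'
  have hb : b ≠ 0 := by rintro rfl; simp at h9; exact hs h9.symm
  have ha : a ≠ 0 := by rintro rfl; simp at h1; exact hs h1.symm
  by_cases hd : d = 0
  · subst hd
    have he' : e' = -l * e := by
      have : c * (e' + l * e) = 0 := by linear_combination h12
      have := (mul_eq_zero.mp this).resolve_left hc
      linarith
    subst he'
    have h15 : l = 1 := by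
      have : b * c * (l - 1) = 0 := by linear_combination h7
      have := (mul_eq_zero.mp this).resolve_left (mul_ne_zero hb hc)
      linarith
    subst h15
    exact hs (by linarith)
  · have he' : e' = l * e := by
      have : d * (e' - l * e) = 0 := by linear_combination h13
      have := (mul_eq_zero.mp this).resolve_left hd
      linarith
    subst he'
    have h16 : a = -(b * e) := by
      have h17 : (1 - l) * (a + b * e) = 0 := by linear_combination h1 - h9
      rcases mul_eq_zero.mp h17 with h | h
      · exact absurd (show s = 0 by rw [← h1]; linear_combination a * h) hs
      · linarith
    have h18 : (1 + l) * e = b ^ 2 := by linear_combination h5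
    have h19 : (1 + l) * c = l * a ^ 2 := by linear_combination h3
    have h20 : c = m * n * e := by
      -- `(1 + l) c = l a ^ 2 = l e ^ 2 b ^ 2 = l e ^ 2 (1 + l) e`, and `l e ^ 2 = m n`.
      have : (1 + l) * (c - m * n * e) = 0 := by
        linear_combination h19 - l * (a - b * e) * (-h16) - l * e ^ 2 * h18 + (1 + l) * e * h14
      have := (mul_eq_zero.mp this).resolve_left (by positivity)
      linarith
    have he : e ≠ 0 := by rintro rfl; simp at h20; exact hc h20
    apply hmn
    have h21 : m * (m ^ 2 * n ^ 3 - 1) = 0 := by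
      rw [h20] at h10
      linear_combination (m ^ 2 * n ^ 2) * (-h14) + h10
    have := (mul_eq_zero.mp h21).resolve_left hm.ne'
    linarith

theorem quartic_coeffs_eq_zero {a b c d e : ℝ}
    (h : ∀ x : ℝ, a * x ^ 4 + b * x ^ 3 + c * x ^ 2 + d * x + e = 0) :
    a = 0 ∧ b = 0 ∧ c = 0 ∧ d = 0 ∧ e = 0 := by
  have h0 := h 0
  have h1 := h 1
  have h2 := h (-1)
  have h3 := h 2
  have h4 := h (-2)
  norm_num at h0 h1 h2 h3 h4
  refine ⟨?_, ?_, ?_, ?_, ?_⟩ <;> linarith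

variable {R : Type*} [CommRing R]

/-- The quartic `y ^ 4 + s x y ^ 3 + s y + m (x ^ 4 + n)`. -/
noncomputable def quartic (s m n : R) : R[X][X] :=
  X ^ 4 + (C (C s * X) * X ^ 3 + C (C s) * X + C (C m * (X ^ 4 + C n)))

theorem quartic_tail_degree_le (s m n : R) :
    (C (C s * X) * X ^ 3 + C (C s) * X + C (C m * (X ^ 4 + C n)) : R[X][X]).degree ≤ 3 := by
  compute_degree

theorem quartic_monic (s m n : R) : (quartic s m n).Monic :=
  monic_X_pow_add ((quartic_tail_degree_le s m n).trans_lt (by norm_num))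

theorem quartic_natDegree [Nontrivial R] (s m n : R) : (quartic s m n).natDegree = 4 := by
  unfold quartic
  rw [natDegree_add_eq_left_of_degree_lt]
  · simp
  · refine (quartic_tail_degree_le s m n).trans_lt ?_
    rw [degree_X_pow]; norm_num

theorem quartic_map {S : Type*} [CommRing S] (f : R →+* S) (s m n : R) :
    (quartic s m n).map (mapRingHom f) = quartic (f s) (f m) (f n) := by
  simp [quartic]

/-- For degree at least two, the degree of `h ^ 4` exceeds that of all other terms, which is at most
`3 deg h + 1`. -/
theorem natDegree_le_one_of_quartic_eq {s m n : ℝ} {h : ℝ[X]}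
    (H : h ^ 4 + C s * X * h ^ 3 + C s * h + C m * (X ^ 4 + C n) = 0) : h.natDegree ≤ 1 := by
  by_contra! hlt
  have h1 : h ^ 4 = -(C s * X * h ^ 3 + C s * h + C m * (X ^ 4 + C n)) := by
    linear_combination H
  have h2 : (h ^ 4).natDegree ≤ 3 * h.natDegree + 1 := by
    rw [h1, natDegree_neg]
    refine natDegree_add_le_of_degree_le (natDegree_add_le_of_degree_le ?_ ?_) ?_
    · refine natDegree_mul_le.trans ?_
      have : (C s * X : ℝ[X]).natDegree ≤ 1 := by simpa using natDegree_C_mul_X_pow_le s 1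
      rw [natDegree_pow]
      omega
    · exact (natDegree_C_mul_le _ _).trans (by omega)
    · refine (natDegree_C_mul_le _ _).trans ((natDegree_add_C (p := (X ^ 4 : ℝ[X]))).trans_le ?_)
      rw [natDegree_X_pow]
      omega
  rw [natDegree_pow] at h2
  omega

theorem exists_eval_eq_of_natDegree_le_two {p : ℝ[X]} (hp : p.natDegree ≤ 2) :
    ∃ c d e : ℝ, ∀ x, p.eval x = c * x ^ 2 + d * x + e := by
  refine ⟨p.coeff 2, p.coeff 1, p.coeff 0, fun x => ?_⟩
  rw [eval_eq_sum_range' (Nat.lt_succ_of_le hp)]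
  simp [Finset.sum_range_succ]
  ring

theorem exists_eval_eq_of_natDegree_le_one {p : ℝ[X]} (hp : p.natDegree ≤ 1) :
    ∃ a b : ℝ, ∀ x, p.eval x = a * x + b := by
  obtain ⟨a, b, rfl⟩ := exists_eq_X_add_C_of_natDegree_le_one hp
  exact ⟨a, b, fun x => by simp⟩

theorem quartic_no_root {s m n : ℝ} (hm : 0 < m) (hn : n ≠ 0) (h : ℝ[X]) :
    h ^ 4 + C s * X * h ^ 3 + C s * h + C m * (X ^ 4 + C n) ≠ 0 := by
  intro H
  obtain ⟨a, b, hab⟩ := exists_eval_eq_of_natDegree_le_one (natDegree_le_one_of_quartic_eq H)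
  have key : ∀ x : ℝ, (a ^ 4 + s * a ^ 3 + m) * x ^ 4 + (4 * a ^ 3 * b + 3 * s * a ^ 2 * b) * x ^ 3
      + (6 * a ^ 2 * b ^ 2 + 3 * s * a * b ^ 2) * x ^ 2 + (4 * a * b ^ 3 + s * b ^ 3 + s * a) * x
      + (b ^ 4 + s * b + m * n) = 0 := fun x => by
    have := congrArg (eval x) H
    simp only [eval_add, eval_mul, eval_pow, eval_C, eval_X, eval_zero, hab] at this
    linear_combination this
  obtain ⟨h4, h3, h2, -, h0⟩ := quartic_coeffs_eq_zero key
  exact quartic_no_linear hm hn h4 h3 h2 h0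

/-- The extremal case left by the degree count below: `α' β` would have degree `6`, but equals a
polynomial of degree at most `2`. -/
theorem natDegree_ne_four_of_eq {s : ℝ} {α β α' β' : ℝ[X]} (hα : α.natDegree = 2)
    (hα' : α'.natDegree = 2) (hβ : β.natDegree = 4) (hβ' : β'.natDegree = 0)
    (E1 : α * β' + α' * β = C s) : False := by
  have h1 : (α' * β).natDegree = 6 := by
    rw [natDegree_mul (by rintro rfl; simp at hα') (by rintro rfl; simp at hβ), hα', hβ]
  have h2 : (α' * β).natDegree ≤ 2 := by
    rw [show α' * β = C s - α * β' by linear_combination E1]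
    exact (natDegree_sub_le _ _).trans (max_le (by rw [natDegree_C]; omega)
      (natDegree_mul_le.trans (by omega)))
  omega

/-- If `deg α ≥ 2`, then `α'` has the same degree and `α α' = -(β + β')` has degree at least `4`. So
one of `β`, `β'` has degree `4` and the other is constant. -/
theorem natDegree_le_one_of_quartic_factor {s : ℝ} {α β α' β' : ℝ[X]}
    (E3 : α + α' = C s * X) (E2 : β + β' + α * α' = 0) (E1 : α * β' + α' * β = C s)
    (hdeg : β.natDegree + β'.natDegree = 4) :
    α.natDegree ≤ 1 := by
  by_contra! hlt
  have hsX : (C s * X : ℝ[X]).natDegree ≤ 1 := by simpa using natDegree_C_mul_X_pow_le s 1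
  have hα' : α'.natDegree = α.natDegree := by
    rw [show α' = C s * X - α by linear_combination E3]
    exact natDegree_sub_eq_right_of_natDegree_lt (by omega)
  have h1 : (α * α').natDegree = 2 * α.natDegree := by
    rw [natDegree_mul (by rintro rfl; simp at hlt)
      (by rintro rfl; rw [natDegree_zero] at hα'; omega)]
    omega
  have h2 : 2 * α.natDegree ≤ max β.natDegree β'.natDegree := by
    rw [← h1, show α * α' = -(β + β') by linear_combination E2, natDegree_neg]
    exact natDegree_add_le _ _
  rcases le_total β.natDegree β'.natDegree with h | h
  · rw [max_eq_right h] at h2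
    exact natDegree_ne_four_of_eq (α := α') (α' := α) (β := β') (β' := β) (by omega) (by omega)
      (by omega) (by omega) (by linear_combination E1)
  · rw [max_eq_left h] at h2
    exact natDegree_ne_four_of_eq (α := α) (α' := α') (β := β) (β' := β') (by omega) (by omega)
      (by omega) (by omega) E1

/-- `E3`, `E2`, `E1`, `E0` are the coefficients of the powers of `y` in `(y ^ 2 + α y + β) (y ^ 2 +
α' y + β')`. Degree bounds reduce the problem to finitely many real coefficients. -/
theorem quartic_no_quadratic_factor {s m n : ℝ} (hs : s ≠ 0) (hm : 0 < m)
    (hmn : m ^ 2 * n ^ 3 ≠ 1) {α β α' β' : ℝ[X]}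
    (E3 : α + α' = C s * X) (E2 : β + β' + α * α' = 0) (E1 : α * β' + α' * β = C s)
    (E0 : β * β' = C m * (X ^ 4 + C n)) : False := by
  have hd0 : (C m * (X ^ 4 + C n) : ℝ[X]).natDegree = 4 := by
    rw [natDegree_C_mul hm.ne', natDegree_X_pow_add_C]
  have hne : β * β' ≠ 0 := by rw [E0]; intro h; simp [h] at hd0
  have hdeg : β.natDegree + β'.natDegree = 4 := by
    rw [← natDegree_mul (left_ne_zero_of_mul hne) (right_ne_zero_of_mul hne), E0, hd0]
  have hα := natDegree_le_one_of_quartic_factor E3 E2 E1 hdeg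
  have hα' := natDegree_le_one_of_quartic_factor (α := α') (α' := α) (β := β') (β' := β)
    (s := s) (by rw [← E3]; ring) (by rw [← E2]; ring) (by rw [← E1]; ring) (by omega)
  have hsum : (β + β').natDegree ≤ 2 := by
    rw [show β + β' = -(α * α') by linear_combination E2, natDegree_neg]
    exact natDegree_mul_le.trans (by omega)
  -- Degree three or four for `β` leaves degree at most one for `β'`, so nothing could cancel in `β
  -- + β'`.
  have hβ : β.natDegree ≤ 2 := by
    by_contra! h
    rw [natDegree_add_eq_left_of_natDegree_lt (by omega)] at hsum
    omega
  have hβ' : β'.natDegree ≤ 2 := by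
    by_contra! h
    rw [natDegree_add_eq_right_of_natDegree_lt (by omega)] at hsum
    omega
  obtain ⟨a, b, hα⟩ := exists_eval_eq_of_natDegree_le_one hα
  obtain ⟨a', b', hα'⟩ := exists_eval_eq_of_natDegree_le_one hα'
  obtain ⟨c, d, e, hβ⟩ := exists_eval_eq_of_natDegree_le_two hβ
  obtain ⟨c', d', e', hβ'⟩ := exists_eval_eq_of_natDegree_le_two hβ'
  have F3 : ∀ x : ℝ, 0 * x ^ 4 + 0 * x ^ 3 + 0 * x ^ 2 + (a + a' - s) * x + (b + b') = 0 :=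
    fun x => by
      have := congrArg (eval x) E3
      simp only [eval_add, eval_mul, eval_C, eval_X, hα, hα'] at this
      linear_combination this
  have F2 : ∀ x : ℝ, 0 * x ^ 4 + 0 * x ^ 3 + (c + c' + a * a') * x ^ 2 +
      (d + d' + (a * b' + a' * b)) * x + (e + e' + b * b') = 0 := fun x => by
    have := congrArg (eval x) E2
    simp only [eval_add, eval_mul, eval_zero, hα, hα', hβ, hβ'] at this
    linear_combination this
  have F1 : ∀ x : ℝ, 0 * x ^ 4 + (a * c' + a' * c) * x ^ 3 +
      (a * d' + a' * d + (b * c' + b' * c)) * x ^ 2 +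
      (a * e' + a' * e + (b * d' + b' * d)) * x + (b * e' + b' * e - s) = 0 := fun x => by
    have := congrArg (eval x) E1
    simp only [eval_add, eval_mul, eval_C, hα, hα', hβ, hβ'] at this
    linear_combination this
  have F0 : ∀ x : ℝ, (c * c' - m) * x ^ 4 + (c * d' + c' * d) * x ^ 3 +
      (c * e' + c' * e + d * d') * x ^ 2 + (d * e' + d' * e) * x + (e * e' - m * n) = 0 :=
    fun x => by
      have := congrArg (eval x) E0
      simp only [eval_add, eval_mul, eval_pow, eval_C, eval_X, hβ, hβ'] at this
      linear_combination this
  obtain ⟨-, -, -, h1, h2⟩ := quartic_coeffs_eq_zero F3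
  obtain ⟨-, -, h3, -, h5⟩ := quartic_coeffs_eq_zero F2
  obtain ⟨-, h6, h7, -, h9⟩ := quartic_coeffs_eq_zero F1
  obtain ⟨h10, h11, h12, h13, h14⟩ := quartic_coeffs_eq_zero F0
  exact quartic_no_quadratic hs hm hmn (sub_eq_zero.mp h1) h2 h3 h5 h6 h7 (sub_eq_zero.mp h9)
    (sub_eq_zero.mp h10) h11 h12 h13 (sub_eq_zero.mp h14)

theorem quartic_not_factor {s m n : ℝ} (hs : s ≠ 0) (hm : 0 < m) (hn : n ≠ 0)
    (hmn : m ^ 2 * n ^ 3 ≠ 1) {f g : ℝ[X][X]} (hf : f.Monic) (hg : g.Monic)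
    (hfg : f * g = quartic s m n) (hdeg : g.natDegree ∈ Finset.Ioc 0 2) : False := by
  have hd : f.natDegree + g.natDegree = 4 := by
    rw [← hf.natDegree_mul hg, hfg, quartic_natDegree]
  rw [Finset.mem_Ioc] at hdeg
  have hg' := hg.as_sum
  have hf' := hf.as_sum
  obtain h1 | h2 : g.natDegree = 1 ∨ g.natDegree = 2 := by omega
  · rw [h1] at hg'
    refine quartic_no_root (s := s) hm hn (-g.coeff 0) ?_
    have := congrArg (eval (-g.coeff 0)) hfg
    rw [eval_mul, hg'] at this
    simp only [quartic, Finset.sum_range_one, pow_one, pow_zero, mul_one, eval_add, eval_X, eval_C,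
      coeff_add, coeff_X_zero, coeff_C_zero, zero_add, neg_add_cancel, mul_zero, eval_mul,
      eval_pow] at this
    rw [this]
    ring
  · rw [h2] at hg'
    rw [show f.natDegree = 2 by omega] at hf'
    simp only [Finset.sum_range_succ, Finset.sum_range_zero, pow_one, pow_zero, mul_one,
      zero_add] at hf' hg'
    generalize f.coeff 0 = β at hf'
    generalize f.coeff 1 = α at hf'
    generalize g.coeff 0 = β' at hg'
    generalize g.coeff 1 = α' at hg'
    -- For fixed `x` this is a polynomial identity in `y`, whose coefficients can be separated.
    have key : ∀ x y : ℝ, 0 * y ^ 4 + (α.eval x + α'.eval x - s * x) * y ^ 3 +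
        (β.eval x + β'.eval x + α.eval x * α'.eval x) * y ^ 2 +
        (α.eval x * β'.eval x + α'.eval x * β.eval x - s) * y +
        (β.eval x * β'.eval x - m * (x ^ 4 + n)) = 0 := fun x y => by
      have := congrArg (fun p => eval x (eval (C y) p)) hfg
      simp only [hf', hg', quartic, eval_add, eval_mul, eval_pow, eval_C, eval_X] at this
      linear_combination this
    refine quartic_no_quadratic_factor hs hm hmn (α := α) (α' := α') (β := β) (β' := β') (n := n)
      ?_ ?_ ?_ ?_
    all_goals refine Polynomial.funext fun x => ?_
    all_goals
      obtain ⟨-, k3, k2, k1, k0⟩ := quartic_coeffs_eq_zero (key x)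
      simp only [eval_add, eval_mul, eval_pow, eval_C, eval_X, eval_zero]
      linarith

/-- A monic factorization over `k` is one over `ℝ`, so only real factorizations have to be excluded.
-/
theorem quartic_irreducible {k : Subfield ℝ} {s m n : k} (hs : s ≠ 0) (hm : (0 : ℝ) < m)
    (hn : n ≠ 0) (hmn : m ^ 2 * n ^ 3 ≠ 1) : Irreducible (quartic s m n) := by
  refine (quartic_monic s m n).irreducible_iff_natDegree'.mpr ⟨fun h => ?_, ?_⟩
  · have := quartic_natDegree s m n
    simp [h] at this
  · intro f g hf hg hfg hdeg
    rw [quartic_natDegree] at hdeg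
    refine quartic_not_factor (s := (s : ℝ)) (m := (m : ℝ)) (n := (n : ℝ)) (by simpa using hs) hm
      (by simpa using hn) (by exact_mod_cast hmn) (hf.map (mapRingHom k.subtype))
      (hg.map (mapRingHom k.subtype)) ?_ ?_
    · rw [← Polynomial.map_mul, hfg, quartic_map]; rfl
    · rwa [natDegree_map_eq_of_injective (map_injective _ k.subtype_injective)]

/-- `k(x, y)` is an extension of `k(x)` of degree four with basis `1, y, y ^ 2, y ^ 3`, and `x` is
transcendental over `k`. -/
structure IsQuarticExtension (k : Subfield ℝ) (x y : ℝ) : Prop where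
  indep : ∀ P : Fin 4 → k[X], ∑ j, aeval x (P j) * y ^ (j : ℕ) = 0 → ∀ j, P j = 0
  rel : ∃ a : Fin 4 → k[X], y ^ 4 = ∑ j, aeval x (a j) * y ^ (j : ℕ)

/-- Gauss's lemma makes the quartic irreducible over the fraction field of `k[X]`. A nonzero
polynomial in `y` of degree less than four is coprime to it there, so they cannot both vanish at the
real number `y`. -/
theorem isQuarticExtension_of_quartic {k : Subfield ℝ} {x y : ℝ} (hx : Transcendental k x)
    {s m n : ℝ} (hsk : s ∈ k) (hmk : m ∈ k) (hnk : n ∈ k) (hs : s ≠ 0) (hm : 0 < m) (hn : n ≠ 0)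
    (hmn : m ^ 2 * n ^ 3 ≠ 1) (h : y ^ 4 + s * x * y ^ 3 + s * y + m * (x ^ 4 + n) = 0) :
    IsQuarticExtension k x y := by
  lift s to k using hsk
  lift m to k using hmk
  lift n to k using hnk
  constructor
  · have hirr : Irreducible (quartic s m n) :=
      quartic_irreducible (by simpa using hs) hm (by simpa using hn) (by exact_mod_cast hmn)
    rw [(quartic_monic s m n).irreducible_iff_irreducible_map_fraction_map
      (K := FractionRing k[X])] at hirr
    set F := (quartic s m n).map (algebraMap k[X] (FractionRing k[X])) with hF
    have hinj : Function.Injective (aeval x : k[X] →ₐ[k] ℝ).toRingHom :=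
      transcendental_iff_injective.mp hx
    -- Evaluation of rational functions at `x`, defined because `x` is transcendental.
    set ψ : FractionRing k[X] →+* ℝ := IsFractionRing.lift hinj
    have hψ : ψ.comp (algebraMap k[X] (FractionRing k[X])) =
        (aeval x : k[X] →ₐ[k] ℝ).toRingHom :=
      RingHom.ext fun p => IsFractionRing.lift_algebraMap hinj p
    intro P hP
    set G : k[X][X] := ∑ j : Fin 4, C (P j) * X ^ (j : ℕ) with hG
    have hGdeg : G.degree < 4 := by
      refine (degree_sum_le _ _).trans_lt ((Finset.sup_lt_iff (by decide)).mpr fun j _ => ?_)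
      refine (degree_C_mul_X_pow_le _ _).trans_lt ?_
      exact_mod_cast j.2
    have hG0 : G = 0 := by
      by_contra hne
      set G' := G.map (algebraMap k[X] (FractionRing k[X])) with hG'
      have hne' : G' ≠ 0 := (Polynomial.map_ne_zero_iff (IsFractionRing.injective _ _)).mpr hne
      have hnd : ¬ F ∣ G' := fun hdvd => by
        have h1 := degree_le_of_dvd hdvd hne'
        rw [hF, (quartic_monic s m n).degree_map, degree_eq_natDegree (quartic_monic s m n).ne_zero,
          quartic_natDegree] at h1
        exact absurd (h1.trans (degree_map_le)) (not_le.mpr (by exact_mod_cast hGdeg))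
      obtain ⟨A, B, hAB⟩ := (hirr.coprime_iff_not_dvd).mpr hnd
      have h1 := congrArg (eval₂ ψ y) hAB
      have hFy : eval₂ ψ y F = 0 := by
        rw [hF, eval₂_map, hψ, ← h]
        have hc : ∀ z : k, algebraMap k ℝ z = z := fun _ => rfl
        simp [quartic, eval₂_add, eval₂_mul, eval₂_pow, hc]
        ring
      have hGy : eval₂ ψ y G' = 0 := by
        rw [hG', eval₂_map, hψ, ← hP, hG]
        simp [eval₂_finsetSum, eval₂_mul]
      simp [eval₂_add, eval₂_mul, hFy, hGy] at h1
    intro j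
    have := congrArg (fun p => coeff p (j : ℕ)) hG0
    simpa [hG, finsetSum_coeff, coeff_C_mul, coeff_X_pow, Fin.val_inj] using this
  · refine ⟨![-(C m * (X ^ 4 + C n)), -C s, 0, -(C s * X)], ?_⟩
    simp only [Fin.sum_univ_four, Matrix.cons_val, map_neg, map_mul, map_add, map_pow, aeval_C,
      aeval_X, map_zero]
    have : ∀ z : k, algebraMap k ℝ z = z := fun _ => rfl
    simp only [this]
    simp
    linear_combination h

end Quartic

/-! ### Homomorphisms that are injective on towers of quartic extensions -/

section Tower

open Polynomial

variable {A : Type*} [CommRing A]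

/-- The `B`-span `M` of `1, η, η ^ 2, η ^ 3` is stable under multiplication by `B` and by `η`. So
the ring `S` of multipliers of `M` contains the generated ring, and `1 ∈ M`. -/
theorem exists_sum_of_mem_closure {B : Subring A} {η : A}
    (h : ∃ a : Fin 4 → A, (∀ j, a j ∈ B) ∧ η ^ 4 = ∑ j, a j * η ^ (j : ℕ)) {z : A}
    (hz : z ∈ Subring.closure (B ∪ {η})) :
    ∃ c : Fin 4 → A, (∀ j, c j ∈ B) ∧ z = ∑ j, c j * η ^ (j : ℕ) := by
  obtain ⟨a, ha, hη⟩ := h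
  let M : AddSubgroup A :=
    { carrier := {z | ∃ c : Fin 4 → A, (∀ j, c j ∈ B) ∧ z = ∑ j, c j * η ^ (j : ℕ)}
      zero_mem' := ⟨0, fun _ => B.zero_mem, by simp⟩
      add_mem' := by
        rintro _ _ ⟨c, hc, rfl⟩ ⟨d, hd, rfl⟩
        exact ⟨c + d, fun j => B.add_mem (hc j) (hd j), by
          simp [add_mul, Finset.sum_add_distrib]⟩
      neg_mem' := by
        rintro _ ⟨c, hc, rfl⟩
        exact ⟨-c, fun j => B.neg_mem (hc j), by simp⟩ }
  let S : Subring A :=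
    { carrier := {w | ∀ z ∈ M, w * z ∈ M}
      zero_mem' := fun z _ => by rw [zero_mul]; exact M.zero_mem
      one_mem' := fun z hz => by rwa [one_mul]
      add_mem' := fun hv hw z hz => by rw [add_mul]; exact M.add_mem (hv z hz) (hw z hz)
      neg_mem' := fun hw z hz => by rw [neg_mul]; exact M.neg_mem (hw z hz)
      mul_mem' := fun hv hw z hz => by rw [mul_assoc]; exact hv _ (hw z hz) }
  have hle : Subring.closure (B ∪ {η}) ≤ S := by
    rw [Subring.closure_le]
    rintro w (hw | rfl)
    · rintro _ ⟨c, hc, rfl⟩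
      exact ⟨fun j => w * c j, fun j => B.mul_mem hw (hc j), by
        rw [Finset.mul_sum]; exact Finset.sum_congr rfl fun j _ => by ring⟩
    · rintro _ ⟨c, hc, rfl⟩
      -- Multiplication by `η` shifts the coefficients; `c 3 * η ^ 4` is rewritten by the given
      -- relation.
      refine ⟨![c 3 * a 0, c 0 + c 3 * a 1, c 1 + c 3 * a 2, c 2 + c 3 * a 3], ?_, ?_⟩
      · have h1 : ∀ i j, c i + c 3 * a j ∈ B := fun i j =>
          B.add_mem (hc i) (B.mul_mem (hc 3) (ha j))
        intro j
        fin_cases j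
        · exact B.mul_mem (hc 3) (ha 0)
        · exact h1 0 1
        · exact h1 1 2
        · exact h1 2 3
      · simp only [Fin.sum_univ_four, Fin.val_zero, Fin.val_one, Fin.val_two, Matrix.cons_val,
          show ((3 : Fin 4) : ℕ) = 3 from rfl] at hη ⊢
        linear_combination c 3 * hη
  have h1 : (1 : A) ∈ M := ⟨![1, 0, 0, 0], fun j => by
    fin_cases j
    · exact B.one_mem
    all_goals exact B.zero_mem, by simp [Fin.sum_univ_four]⟩
  have := hle hz 1 h1
  rwa [mul_one] at this

theorem mem_closure_singleton_iff {B : Subring A} {ξ z : A} :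
    z ∈ Subring.closure (B ∪ {ξ}) ↔ ∃ p : B[X], eval₂ B.subtype ξ p = z := by
  constructor
  · intro hz
    have : Subring.closure (B ∪ {ξ}) ≤ (eval₂RingHom B.subtype ξ).range := by
      rw [Subring.closure_le]
      rintro w (hw | rfl)
      · exact ⟨C ⟨w, hw⟩, by simp⟩
      · exact ⟨X, by simp⟩
    exact this hz
  · rintro ⟨p, rfl⟩
    rw [eval₂_eq_sum_range]
    refine Subring.sum_mem _ fun i _ => Subring.mul_mem _ ?_ (Subring.pow_mem _ ?_ _)
    · exact Subring.subset_closure (Or.inl (p.coeff i).2)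
    · exact Subring.subset_closure (Or.inr rfl)

/-- Write `z` as a combination of `1, η, η ^ 2, η ^ 3` with coefficients polynomial in `ξ` over `B`.
Its image is a relation over `k`, so every polynomial becomes zero over `k`, hence is zero as `φ` is
injective on `B`. The ring `A` need not be a domain, so this also applies to the ring of terms. -/
theorem eq_zero_of_mem_closure_pair (φ : A →+* ℝ) {B : Subring A}
    (hinj : ∀ z ∈ B, φ z = 0 → z = 0) {ξ η : A} {k : Subfield ℝ} (hk : ∀ z ∈ B, φ z ∈ k)
    (hQ : IsQuarticExtension k (φ ξ) (φ η))
    (hrel : ∃ a : Fin 4 → A, (∀ j, a j ∈ Subring.closure (B ∪ {ξ})) ∧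
      η ^ 4 = ∑ j, a j * η ^ (j : ℕ)) {z : A} (hz : z ∈ Subring.closure (B ∪ {ξ, η}))
    (h0 : φ z = 0) : z = 0 := by
  have hz' : z ∈ Subring.closure ((Subring.closure (B ∪ {ξ}) : Subring A) ∪ {η}) := by
    refine Subring.closure_le.mpr ?_ hz
    rintro w (hw | rfl | rfl)
    · exact Subring.subset_closure (Or.inl (Subring.subset_closure (Or.inl hw)))
    · exact Subring.subset_closure (Or.inl (Subring.subset_closure (Or.inr rfl)))
    · exact Subring.subset_closure (Or.inr rfl)
  obtain ⟨c, hc, rfl⟩ := exists_sum_of_mem_closure hrel hz'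
  choose p hp using fun j => mem_closure_singleton_iff.mp (hc j)
  let f : B →+* k := (φ.comp B.subtype).codRestrict k fun b => hk b b.2
  have hf : Function.Injective f := by
    refine (injective_iff_map_eq_zero f).mpr fun b hb => ?_
    exact Subtype.ext (hinj b b.2 (congrArg Subtype.val hb))
  have hφ : ∀ j, φ (c j) = aeval (φ ξ) ((p j).map f) := fun j => by
    rw [← hp j, hom_eval₂, aeval_def, eval₂_map]
    rfl
  have := hQ.indep (fun j => (p j).map f) (by
    rw [← h0, map_sum]
    exact Finset.sum_congr rfl fun j _ => by rw [map_mul, map_pow, hφ])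
  refine Finset.sum_eq_zero fun j _ => ?_
  rw [← hp j, (Polynomial.map_eq_zero_iff hf).mp (this j)]
  simp

/-- The subrings generated by `B` and the first `n` terms of two sequences. -/
def adjoinPairs (B : Subring A) (ξ η : ℕ → A) : ℕ → Subring A
  | 0 => B
  | n + 1 => Subring.closure (adjoinPairs B ξ η n ∪ {ξ n, η n})

theorem adjoinPairs_mono (B : Subring A) (ξ η : ℕ → A) : Monotone (adjoinPairs B ξ η) :=
  monotone_nat_of_le_succ fun _ _ hz => Subring.subset_closure (Or.inl hz)

theorem exists_mem_adjoinPairs {B : Subring A} {ξ η : ℕ → A} {z : A}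
    (hz : z ∈ Subring.closure (B ∪ (Set.range ξ ∪ Set.range η))) :
    ∃ n, z ∈ adjoinPairs B ξ η n := by
  have hle : Subring.closure (B ∪ (Set.range ξ ∪ Set.range η)) ≤ ⨆ n, adjoinPairs B ξ η n := by
    rw [Subring.closure_le]
    have h1 : ∀ n, adjoinPairs B ξ η n ≤ ⨆ n, adjoinPairs B ξ η n := le_iSup _
    rintro w (hw | ⟨n, rfl⟩ | ⟨n, rfl⟩)
    · exact h1 0 hw
    · exact h1 (n + 1) (Subring.subset_closure (Or.inr (Or.inl rfl)))
    · exact h1 (n + 1) (Subring.subset_closure (Or.inr (Or.inr rfl)))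
  exact (Subring.mem_iSup_of_directed (adjoinPairs_mono B ξ η).directed_le).mp (hle hz)

theorem eq_zero_of_mem_closure_range (φ : A →+* ℝ) {B : Subring A}
    (hinj : ∀ z ∈ B, φ z = 0 → z = 0) {ξ η : ℕ → A} {k : ℕ → Subfield ℝ}
    (hk0 : ∀ z ∈ B, φ z ∈ k 0) (hk : Monotone k) (hξ : ∀ n, φ (ξ n) ∈ k (n + 1))
    (hη : ∀ n, φ (η n) ∈ k (n + 1)) (hQ : ∀ n, IsQuarticExtension (k n) (φ (ξ n)) (φ (η n)))
    (hrel : ∀ n, ∃ a : Fin 4 → A, (∀ j, a j ∈ Subring.closure (B ∪ {ξ n})) ∧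
      η n ^ 4 = ∑ j, a j * η n ^ (j : ℕ)) {z : A}
    (hz : z ∈ Subring.closure (B ∪ (Set.range ξ ∪ Set.range η))) (h0 : φ z = 0) : z = 0 := by
  -- Injectivity at the next stage needs the image of the present stage to lie in `k n`, hence the
  -- joint induction.
  have key : ∀ n, (∀ z ∈ adjoinPairs B ξ η n, φ z ∈ k n) ∧
      ∀ z ∈ adjoinPairs B ξ η n, φ z = 0 → z = 0 := by
    intro n
    induction n with
    | zero => exact ⟨hk0, hinj⟩
    | succ n ih =>
      refine ⟨fun z hz => ?_, fun z hz h0 => ?_⟩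
      · have : Subring.closure (adjoinPairs B ξ η n ∪ {ξ n, η n}) ≤
            (k (n + 1)).toSubring.comap φ := by
          rw [Subring.closure_le]
          rintro w (hw | rfl | rfl)
          · exact hk n.le_succ (ih.1 w hw)
          · exact hξ n
          · exact hη n
        exact this hz
      · obtain ⟨a, ha, hη⟩ := hrel n
        refine eq_zero_of_mem_closure_pair φ ih.2 ih.1 (hQ n) ⟨a, fun j => ?_, hη⟩ hz h0
        refine Subring.closure_mono ?_ (ha j)
        exact Set.union_subset_union_left _ (adjoinPairs_mono B ξ η n.zero_le)
  obtain ⟨n, hn⟩ := exists_mem_adjoinPairs hz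
  exact (key n).2 z hn h0

end Tower

/-! ### Real algebraic closures of subfields generated by the independent numbers -/

section AlgSubfield

/-- The real numbers algebraic over the field generated by some of the numbers `gapNum j`. -/
noncomputable def algSubfield (s : Set ℕ) : Subfield ℝ :=
  (algebraicClosure (IntermediateField.adjoin ℚ (gapNum '' s)) ℝ).toSubfield

theorem gapNum_mem_algSubfield {s : Set ℕ} {j : ℕ} (hj : j ∈ s) : gapNum j ∈ algSubfield s :=
  isAlgebraic_algebraMap (⟨gapNum j, IntermediateField.subset_adjoin _ _ ⟨j, hj, rfl⟩⟩ :
    IntermediateField.adjoin ℚ (gapNum '' s)) |>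
    (mem_algebraicClosure_iff (F := IntermediateField.adjoin ℚ (gapNum '' s)) (E := ℝ)).mpr

theorem mem_algSubfield_of_isAlgebraic {s : Set ℕ} {x : ℝ} (hx : IsAlgebraic (algSubfield s) x) :
    x ∈ algSubfield s := by
  have hx' : IsAlgebraic (algebraicClosure (IntermediateField.adjoin ℚ (gapNum '' s)) ℝ) x := hx
  exact (mem_algebraicClosure_iff (F := IntermediateField.adjoin ℚ (gapNum '' s))
    (E := ℝ)).mpr (hx'.restrictScalars _)

theorem mem_algSubfield_of_quartic {s : Set ℕ} {a b c y : ℝ} (ha : a ∈ algSubfield s)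
    (hb : b ∈ algSubfield s) (hc : c ∈ algSubfield s) (h : y ^ 4 + a * y ^ 3 + b * y + c = 0) :
    y ∈ algSubfield s := by
  open Polynomial in
  lift a to algSubfield s using ha
  lift b to algSubfield s using hb
  lift c to algSubfield s using hc
  refine mem_algSubfield_of_isAlgebraic ⟨X ^ 4 + (C a * X ^ 3 + C b * X + C c), ?_, ?_⟩
  · refine (monic_X_pow_add (lt_of_le_of_lt (b := 3) ?_ (by norm_num))).ne_zero
    compute_degree
  · have hA : ∀ z : algSubfield s, algebraMap (algSubfield s) ℝ z = z := fun _ => rfl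
    simp only [map_add, map_mul, map_pow, aeval_X, aeval_C, hA]
    linear_combination h

theorem IsAlgebraic.of_subfield_le {k l : Subfield ℝ} (hkl : k ≤ l) {x : ℝ}
    (hx : IsAlgebraic k x) : IsAlgebraic l x := by
  obtain ⟨p, hp, h⟩ := hx
  refine ⟨p.map (Subfield.inclusion hkl), ?_, ?_⟩
  · exact (Polynomial.map_ne_zero_iff (Subfield.inclusion hkl).injective).mpr hp
  · rw [Polynomial.aeval_def, Polynomial.eval₂_map, ← h, Polynomial.aeval_def]
    rfl

/-- Otherwise `gapNum j` would be algebraic over the field generated by the `gapNum` with indices in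
`s`. -/
theorem transcendental_natCast_add_gapNum {k : Subfield ℝ} {s : Set ℕ} (hk : k ≤ algSubfield s)
    {j : ℕ} (hj : j ∉ s) (m : ℕ) : Transcendental k (m + gapNum j) := by
  intro h
  have h1 : gapNum j ∈ algSubfield s := by
    have h2 := mem_algSubfield_of_isAlgebraic (h.of_subfield_le hk)
    simpa using (algSubfield s).sub_mem h2 (natCast_mem _ m)
  have h2 := (mem_algebraicClosure_iff (F := IntermediateField.adjoin ℚ (gapNum '' s))
    (E := ℝ)).mp h1
  rw [IntermediateField.isAlgebraic_adjoin_iff] at h2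
  exact algebraicIndependent_gapNum.transcendental_adjoin hj h2

end AlgSubfield

/-! ### Real points on the curves -/

section RealPoints

/-- The difference quotient is positive: `16 u (v ^ 2 + v w + w ^ 2) ≥ 32 (v ^ 2 + v w + w ^ 2)`
outweighs `10 (v + w) (v ^ 2 + w ^ 2) ≥ -20 (v ^ 2 + w ^ 2)`. By monotonicity the sign of `p(u, a)`
tells on which side of the root `a` lies. -/
theorem curveP_lt_curveP {u v w : ℝ} (hu : 2 < u) (hv : -1 < v) (hvw : v < w) (hw : w < 0) :
    curveP u v < curveP u w := by
  have hv0 : v < 0 := hvw.trans hw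
  have h2 : 0 < v * w := mul_pos_of_neg_of_neg hv0 hw
  have h1 : 0 < 16 * u * (v ^ 2 + v * w + w ^ 2) + 10 * ((v + w) * (v ^ 2 + w ^ 2)) + 16 := by
    have h3 : 32 * (v ^ 2 + v * w + w ^ 2) ≤ 16 * u * (v ^ 2 + v * w + w ^ 2) :=
      mul_le_mul_of_nonneg_right (by linarith) (by positivity)
    have h4 : -2 * (v ^ 2 + w ^ 2) ≤ (v + w) * (v ^ 2 + w ^ 2) :=
      mul_le_mul_of_nonneg_right (by linarith) (by positivity)
    nlinarith [sq_nonneg v, sq_nonneg w]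
  rw [← sub_pos]
  have : curveP u w - curveP u v =
      (w - v) * (16 * u * (v ^ 2 + v * w + w ^ 2) + 10 * ((v + w) * (v ^ 2 + w ^ 2)) + 16) := by
    unfold curveP; ring
  rw [this]
  exact mul_pos (sub_pos.mpr hvw) h1

/-- The same estimate, with `t x > 4` and `y + z > -4`. -/
theorem curveQ_lt_curveQ {t x y z : ℝ} (ht : 4 < t) (hx : 1 < x) (hy : -2 < y) (hyz : y < z)
    (hz : z < 0) : curveQ t x y < curveQ t x z := by
  have hy0 : y < 0 := hyz.trans hz
  have h2 : 0 < y * z := mul_pos_of_neg_of_neg hy0 hz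
  have htx : 4 < t * x := by nlinarith
  have h1 : 0 < (y + z) * (y ^ 2 + z ^ 2) + t * x * (y ^ 2 + y * z + z ^ 2) + t := by
    have h3 : 4 * (y ^ 2 + y * z + z ^ 2) ≤ t * x * (y ^ 2 + y * z + z ^ 2) :=
      mul_le_mul_of_nonneg_right htx.le (by positivity)
    have h4 : -4 * (y ^ 2 + z ^ 2) ≤ (y + z) * (y ^ 2 + z ^ 2) :=
      mul_le_mul_of_nonneg_right (by linarith) (by positivity)
    linarith
  rw [← sub_pos]
  have : curveQ t x z - curveQ t x y =
      (z - y) * ((y + z) * (y ^ 2 + z ^ 2) + t * x * (y ^ 2 + y * z + z ^ 2) + t) := by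
    unfold curveQ; ring
  rw [this]
  exact mul_pos (sub_pos.mpr hyz) h1

/-- `p(u, -1) = u ^ 4 - 16 u - 10 < 0` and `p(u, 0) = u ^ 4 - 4 > 0`. -/
theorem exists_curveP_eq_zero {u : ℝ} (hu : 2 < u) (hu' : u < 5 / 2) :
    ∃ v ∈ Set.Ioo (-1 : ℝ) 0, curveP u v = 0 := by
  have hc : ContinuousOn (fun v => curveP u v) (Set.Icc (-1) 0) := by
    unfold curveP; fun_prop
  refine intermediate_value_Ioo (by norm_num) hc ⟨?_, ?_⟩
  · unfold curveP
    nlinarith [mul_pos (sub_pos.mpr hu) (sub_pos.mpr hu'), sq_nonneg (u ^ 2),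
      mul_pos (mul_pos (sub_pos.mpr hu) (sub_pos.mpr hu'))
        (mul_pos (sub_pos.mpr hu) (sub_pos.mpr hu'))]
  · unfold curveP
    have : 2 ^ 4 < u ^ 4 := pow_lt_pow_left₀ hu (by norm_num) (by norm_num)
    norm_num at this ⊢
    linarith

/-- `q(t, x, -2) = x ^ 4 + 17 + t (x ^ 4 - 8 x - 1)`, where the last bracket is below `-7`; at `y =
0` all terms are nonnegative and one of them is `1`. -/
theorem exists_curveQ_eq_zero {t x : ℝ} (ht : 4 < t) (hx : 1 < x) (hx' : x < 11 / 10) :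
    ∃ y ∈ Set.Ioo (-2 : ℝ) 0, curveQ t x y = 0 := by
  have hc : ContinuousOn (fun y => curveQ t x y) (Set.Icc (-2) 0) := by
    unfold curveQ; fun_prop
  have h4 : x ^ 4 < (11 / 10) ^ 4 := pow_lt_pow_left₀ hx' (by linarith) (by norm_num)
  norm_num at h4
  refine intermediate_value_Ioo (by norm_num) hc ⟨?_, ?_⟩
  · unfold curveQ
    nlinarith
  · unfold curveQ
    have : 0 ≤ x ^ 4 := by positivity
    nlinarith

/-- The real number used for `u_i`. -/
noncomputable def uR (i : ℕ) : ℝ := (2 : ℕ) + gapNum (2 * i)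

/-- The real number used for the `k`-th of the `x_{ij}`. -/
noncomputable def xR (k : ℕ) : ℝ := (1 : ℕ) + gapNum (2 * k + 1)

theorem two_lt_uR (i : ℕ) : 2 < uR i := by
  have := gapNum_pos (2 * i)
  simp only [uR, Nat.cast_ofNat]; linarith

theorem uR_lt (i : ℕ) : uR i < 5 / 2 := by
  have := gapNum_lt (2 * i)
  simp only [uR, Nat.cast_ofNat]; linarith

theorem one_lt_xR (k : ℕ) : 1 < xR k := by
  have := gapNum_pos (2 * k + 1)
  simp only [xR, Nat.cast_one]; linarith

theorem xR_lt (k : ℕ) : xR k < 11 / 10 := by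
  have := gapNum_lt (2 * k + 1)
  simp only [xR, Nat.cast_one]; linarith

/-- The real number used for `v_i`. -/
noncomputable def vR (i : ℕ) : ℝ := (exists_curveP_eq_zero (two_lt_uR i) (uR_lt i)).choose

theorem vR_mem (i : ℕ) : vR i ∈ Set.Ioo (-1 : ℝ) 0 :=
  (exists_curveP_eq_zero (two_lt_uR i) (uR_lt i)).choose_spec.1

theorem curveP_uR_vR (i : ℕ) : curveP (uR i) (vR i) = 0 :=
  (exists_curveP_eq_zero (two_lt_uR i) (uR_lt i)).choose_spec.2

variable (G : SimpleGraph ℕ)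

open Classical in
/-- The real number used for the parameter of the `k`-th of the curves `Z_{ij}`. -/
noncomputable def tR (k : ℕ) : ℝ :=
  if G.Adj (pairAt k).1.1 (pairAt k).1.2 then uR (pairAt k).1.1 * uR (pairAt k).1.2
  else uR (pairAt k).1.1 + uR (pairAt k).1.2

/-- Sums and products of two numbers above `2` exceed `4`, so the real point can be chosen in the
same way for edges and non-edges. -/
theorem four_lt_tR (k : ℕ) : 4 < tR G k := by
  have h1 := two_lt_uR (pairAt k).1.1
  have h2 := two_lt_uR (pairAt k).1.2
  unfold tR
  split_ifs <;> nlinarith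

/-- The real number used for the `k`-th of the `y_{ij}`. -/
noncomputable def yR (k : ℕ) : ℝ :=
  (exists_curveQ_eq_zero (four_lt_tR G k) (one_lt_xR k) (xR_lt k)).choose

theorem yR_mem (k : ℕ) : yR G k ∈ Set.Ioo (-2 : ℝ) 0 :=
  (exists_curveQ_eq_zero (four_lt_tR G k) (one_lt_xR k) (xR_lt k)).choose_spec.1

theorem curveQ_tR_xR_yR (k : ℕ) : curveQ (tR G k) (xR k) (yR G k) = 0 :=
  (exists_curveQ_eq_zero (four_lt_tR G k) (one_lt_xR k) (xR_lt k)).choose_spec.2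

/-- The real field generated by `u_0, v_0, …, u_{i-1}, v_{i-1}`. -/
noncomputable def realK : ℕ → Subfield ℝ
  | 0 => ⊥
  | i + 1 => Subfield.closure (realK i ∪ {uR i, vR i})

theorem realK_mono : Monotone realK :=
  monotone_nat_of_le_succ fun _ _ hz => Subfield.subset_closure (Or.inl hz)

/-- The real field generated by all `u_i, v_i` and the first `k` pairs `x_{ij}, y_{ij}`. -/
noncomputable def realF : ℕ → Subfield ℝ
  | 0 => ⨆ i, realK i
  | k + 1 => Subfield.closure (realF k ∪ {xR k, yR G k})

theorem realF_mono : Monotone (realF G) :=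
  monotone_nat_of_le_succ fun _ _ hz => Subfield.subset_closure (Or.inl hz)

theorem uR_mem_realK (i : ℕ) : uR i ∈ realK (i + 1) := Subfield.subset_closure (by simp)

theorem vR_mem_realK (i : ℕ) : vR i ∈ realK (i + 1) := Subfield.subset_closure (by simp)

theorem xR_mem_realF (k : ℕ) : xR k ∈ realF G (k + 1) := Subfield.subset_closure (by simp)

theorem yR_mem_realF (k : ℕ) : yR G k ∈ realF G (k + 1) := Subfield.subset_closure (by simp)

theorem realK_le_realF (i k : ℕ) : realK i ≤ realF G k :=
  (le_iSup realK i).trans (realF_mono G k.zero_le)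

theorem tR_mem_realF (k l : ℕ) : tR G k ∈ realF G l := by
  have h : ∀ i, uR i ∈ realF G l := fun i => realK_le_realF G _ _ (uR_mem_realK i)
  unfold tR
  split_ifs
  · exact mul_mem (h _) (h _)
  · exact add_mem (h _) (h _)

/-- Division by `10` gives the normal form with `s = 8 / 5`, `m = 1 / 10`, `n = -4`, for which `m ^
2 n ^ 3 < 0`. -/
theorem curveP_eq_zero_iff {u v : ℝ} : curveP u v = 0 ↔
    v ^ 4 + 8 / 5 * u * v ^ 3 + 8 / 5 * v + 1 / 10 * (u ^ 4 + -4) = 0 := by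
  unfold curveP
  constructor <;> intro h <;> linarith

/-- The normal form with `s = t`, `m = 1 + t`, `n = 1`, for which `m ^ 2 n ^ 3 > 1`. -/
theorem curveQ_eq_zero_iff {t x y : ℝ} : curveQ t x y = 0 ↔
    y ^ 4 + t * x * y ^ 3 + t * y + (1 + t) * (x ^ 4 + 1) = 0 := by
  unfold curveQ
  constructor <;> intro h <;> linarith

/-- Keeps account of the `gapNum` used so far, so that the next one is still transcendental. -/
theorem realK_le_algSubfield {s : Set ℕ} {i : ℕ} (hs : ∀ j < i, 2 * j ∈ s) :
    realK i ≤ algSubfield s := by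
  induction i with
  | zero => exact bot_le
  | succ i ih =>
    have hu : uR i ∈ algSubfield s :=
      add_mem (natCast_mem _ 2) (gapNum_mem_algSubfield (hs i i.lt_succ_self))
    refine Subfield.closure_le.mpr ?_
    rintro z (hz | rfl | rfl)
    · exact ih (fun j hj => hs j (hj.trans i.lt_succ_self)) hz
    · exact hu
    · have h := curveP_eq_zero_iff.mp (curveP_uR_vR i)
      have hq := SubfieldClass.ratCast_mem (algSubfield s)
      refine mem_algSubfield_of_quartic (a := 8 / 5 * uR i) (b := 8 / 5)
        (c := 1 / 10 * (uR i ^ 4 + -4)) ?_ ?_ ?_ (by linear_combination h)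
      · exact mul_mem (by simpa using hq (8 / 5)) hu
      · simpa using hq (8 / 5)
      · exact mul_mem (by simp) (add_mem (pow_mem hu 4) (by simp))

theorem realF_le_algSubfield {s : Set ℕ} {k : ℕ} (hs : ∀ j, 2 * j ∈ s)
    (hs' : ∀ j < k, 2 * j + 1 ∈ s) : realF G k ≤ algSubfield s := by
  induction k with
  | zero => exact iSup_le fun i => realK_le_algSubfield fun j _ => hs j
  | succ k ih =>
    have ih := ih fun j hj => hs' j (hj.trans k.lt_succ_self)
    have hx : xR k ∈ algSubfield s :=
      add_mem (natCast_mem _ 1) (gapNum_mem_algSubfield (hs' k k.lt_succ_self))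
    have ht := ih (tR_mem_realF G k k)
    refine Subfield.closure_le.mpr ?_
    rintro z (hz | rfl | rfl)
    · exact ih hz
    · exact hx
    · have h := curveQ_eq_zero_iff.mp (curveQ_tR_xR_yR G k)
      refine mem_algSubfield_of_quartic (a := tR G k * xR k) (b := tR G k)
        (c := (1 + tR G k) * (xR k ^ 4 + 1)) (mul_mem ht hx) ht ?_ (by linear_combination h)
      exact mul_mem (add_mem (one_mem _) ht) (add_mem (pow_mem hx 4) (one_mem _))

theorem isQuarticExtension_realK (i : ℕ) : IsQuarticExtension (realK i) (uR i) (vR i) := by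
  have hq := SubfieldClass.ratCast_mem (realK i)
  refine isQuarticExtension_of_quartic (transcendental_natCast_add_gapNum
    (realK_le_algSubfield (s := {j | j < 2 * i}) fun j hj => ?_) ?_ 2) (s := 8 / 5) (m := 1 / 10)
    (n := -4) (by simpa using hq (8 / 5)) (by simp) (by simp)
    (by norm_num) (by norm_num) (by norm_num) (by norm_num)
    (curveP_eq_zero_iff.mp (curveP_uR_vR i))
  · show 2 * j < 2 * i
    omega
  · simp

/-- All of `K` is adjoined before the first `x`, so every even index is used, but `2 k + 1` is still
free. -/
theorem isQuarticExtension_realF (k : ℕ) :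
    IsQuarticExtension (realF G k) (xR k) (yR G k) := by
  have ht := four_lt_tR G k
  have htk := tR_mem_realF G k k
  refine isQuarticExtension_of_quartic (transcendental_natCast_add_gapNum
    (realF_le_algSubfield (s := {j | Even j ∨ j < 2 * k}) G (fun j => Or.inl (even_two_mul j))
      fun j hj => Or.inr (by omega)) ?_ 1) htk
    (add_mem (one_mem _) htk) (one_mem _) (by linarith) (by linarith) one_ne_zero ?_
    (curveQ_eq_zero_iff.mp (curveQ_tR_xR_yR G k))
  · rintro (h | h)
    · exact absurd h (by simp)
    · omega
  · nlinarith

end RealPoints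

/-! ### The enumeration of pairs -/

theorem pairAt_succ_of_lt {k : ℕ} (h : (pairAt k).1.2 + 1 < (pairAt k).1.1) :
    (pairAt (k + 1)).1 = ((pairAt k).1.1, (pairAt k).1.2 + 1) := by
  rw [pairAt, dif_pos h]

theorem pairAt_succ_of_not_lt {k : ℕ} (h : ¬ (pairAt k).1.2 + 1 < (pairAt k).1.1) :
    (pairAt (k + 1)).1 = ((pairAt k).1.1 + 1, 0) := by
  rw [pairAt, dif_neg h]

theorem pairAt_surjective : Function.Surjective pairAt := by
  suffices H : ∀ i j, j < i → ∃ k, (pairAt k).1 = (i, j) by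
    rintro ⟨⟨i, j⟩, h⟩
    obtain ⟨k, hk⟩ := H i j h
    exact ⟨k, Subtype.ext hk⟩
  have hstep : ∀ i, (∃ k, (pairAt k).1 = (i, 0)) → ∀ j < i, ∃ k, (pairAt k).1 = (i, j) := by
    intro i h0 j
    induction j with
    | zero => exact fun _ => h0
    | succ j ih =>
      intro hj
      obtain ⟨k, hk⟩ := ih (by omega)
      exact ⟨k + 1, by rw [pairAt_succ_of_lt (by rw [hk]; exact hj), hk]⟩
  have hrow : ∀ i, ∃ k, (pairAt k).1 = (i + 1, 0) := by
    intro i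
    induction i with
    | zero => exact ⟨0, rfl⟩
    | succ i ih =>
      obtain ⟨k, hk⟩ := hstep _ ih i i.lt_succ_self
      exact ⟨k + 1, by rw [pairAt_succ_of_not_lt (by rw [hk]; simp), hk]⟩
  intro i j hj
  obtain ⟨i, rfl⟩ := Nat.exists_eq_succ_of_ne_zero (Nat.ne_zero_of_lt hj)
  exact hstep _ (hrow i) j hj

theorem pairAt_injective : Function.Injective pairAt := by
  have hlt : StrictMono fun k => toLex (pairAt k).1 := strictMono_nat_of_lt_succ fun k => by
    rw [Prod.Lex.toLex_lt_toLex]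
    by_cases h : (pairAt k).1.2 + 1 < (pairAt k).1.1
    · rw [pairAt_succ_of_lt h]; simp
    · rw [pairAt_succ_of_not_lt h]; simp
  exact fun a b hab => hlt.injective (by simp [hab])

theorem twoSubsetAt_bijective : Function.Bijective twoSubsetAt := by
  constructor
  · intro a b hab
    have h := congrArg Subtype.val hab
    simp only [twoSubsetAt, Sym2.eq_iff] at h
    have ha := (pairAt a).2
    have hb := (pairAt b).2
    refine pairAt_injective (Subtype.ext (Prod.ext ?_ ?_)) <;> omega
  · rintro ⟨e, he⟩
    induction e using Sym2.inductionOn with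
    | _ i j =>
      have hij : i ≠ j := fun h => he (Sym2.mk_isDiag_iff.mpr h)
      rcases lt_or_gt_of_ne hij with h | h
      · obtain ⟨k, hk⟩ := pairAt_surjective ⟨(j, i), h⟩
        exact ⟨k, Subtype.ext (by simp only [twoSubsetAt, hk]; exact Sym2.eq_swap)⟩
      · obtain ⟨k, hk⟩ := pairAt_surjective ⟨(i, j), h⟩
        exact ⟨k, Subtype.ext (by simp only [twoSubsetAt, hk])⟩

/-! ### The embedding of `F(G)` into the real numbers -/

section Relations

variable {A : Type*} [CommRing A]

/-- The leading coefficient `10` of `v ^ 4` has to be inverted, hence the rational numbers in `B`.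
-/
theorem exists_relation_of_curveP [Algebra ℚ A] {B : Subring A}
    (hB : ∀ q : ℚ, algebraMap ℚ A q ∈ B) {ξ η : A} (h : curveP ξ η = 0) :
    ∃ a : Fin 4 → A, (∀ j, a j ∈ Subring.closure (B ∪ {ξ})) ∧ η ^ 4 = ∑ j, a j * η ^ (j : ℕ) := by
  have hB' : ∀ q : ℚ, algebraMap ℚ A q ∈ Subring.closure (B ∪ {ξ}) := fun q =>
    Subring.subset_closure (Or.inl (hB q))
  have hξ : ξ ∈ Subring.closure (B ∪ {ξ}) := Subring.subset_closure (Or.inr rfl)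
  refine ⟨![algebraMap ℚ A (-1 / 10) * (ξ ^ 4 - algebraMap ℚ A 4), algebraMap ℚ A (-8 / 5), 0,
    algebraMap ℚ A (-8 / 5) * ξ], fun j => ?_, ?_⟩
  · fin_cases j
    · exact mul_mem (hB' _) (sub_mem (pow_mem hξ 4) (hB' _))
    · exact hB' _
    · exact zero_mem _
    · exact mul_mem (hB' _) hξ
  · have h1 : algebraMap ℚ A (-1 / 10) * 10 = -1 := by
      rw [← map_ofNat (algebraMap ℚ A) 10, ← map_mul, ← map_one (algebraMap ℚ A), ← map_neg]
      norm_num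
    have h2 : algebraMap ℚ A (-8 / 5) = 16 * algebraMap ℚ A (-1 / 10) := by
      rw [← map_ofNat (algebraMap ℚ A) 16, ← map_mul]
      norm_num
    have h4 : algebraMap ℚ A 4 = 4 := map_ofNat _ 4
    simp only [Fin.sum_univ_four, Fin.val_zero, Fin.val_one, Fin.val_two, Matrix.cons_val,
      show ((3 : Fin 4) : ℕ) = 3 from rfl, h2, h4]
    unfold curveP at h
    linear_combination (-algebraMap ℚ A (-1 / 10)) * h - η ^ 4 * (-h1)

theorem exists_relation_of_curveQ {B : Subring A} {t ξ η : A} (ht : t ∈ B)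
    (h : curveQ t ξ η = 0) :
    ∃ a : Fin 4 → A, (∀ j, a j ∈ Subring.closure (B ∪ {ξ})) ∧ η ^ 4 = ∑ j, a j * η ^ (j : ℕ) := by
  have ht' : t ∈ Subring.closure (B ∪ {ξ}) := Subring.subset_closure (Or.inl ht)
  have hξ : ξ ∈ Subring.closure (B ∪ {ξ}) := Subring.subset_closure (Or.inr rfl)
  refine ⟨![-((1 + t) * (ξ ^ 4 + 1)), -t, 0, -(t * ξ)], fun j => ?_, ?_⟩
  · fin_cases j
    · exact neg_mem (mul_mem (add_mem (one_mem _) ht') (add_mem (pow_mem hξ 4) (one_mem _)))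
    · exact neg_mem ht'
    · exact zero_mem _
    · exact neg_mem (mul_mem ht' hξ)
  · simp only [Fin.sum_univ_four, Fin.val_zero, Fin.val_one, Fin.val_two, Matrix.cons_val,
      show ((3 : Fin 4) : ℕ) = 3 from rfl]
    unfold curveQ at h
    linear_combination h

theorem map_curveP {S : Type*} [CommRing S] (f : A →+* S) (u v : A) :
    f (curveP u v) = curveP (f u) (f v) := by
  simp [curveP, show f 16 = 16 from map_ofNat f 16, show f 10 = 10 from map_ofNat f 10,
    show f 4 = 4 from map_ofNat f 4]

theorem map_curveQ {S : Type*} [CommRing S] (f : A →+* S) (t x y : A) :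
    f (curveQ t x y) = curveQ (f t) (f x) (f y) := by simp [curveQ]

/-- An injective homomorphism to the real numbers extends to the ring of fractions. -/
theorem exists_lift_of_injective {K : Type*} [CommRing K] [Algebra A K] [IsFractionRing A K]
    {g : A →+* ℝ} (hg : Function.Injective g) {k : Subfield ℝ} (hk : ∀ a, g a ∈ k) :
    ∃ f : K →+* ℝ, (∀ a, f (algebraMap A K a) = g a) ∧ Function.Injective f ∧
      (∀ z, f z ∈ k) ∧ ∀ z : K, z ≠ 0 → IsUnit z := by
  -- Since `A` embeds in `ℝ` it is a domain, and its non-zero-divisors have nonzero images.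
  have hu : ∀ a : nonZeroDivisors A, IsUnit (g a) := fun a => by
    have : Nontrivial A := ⟨0, 1, fun h => by
      have := congrArg g h
      simp at this⟩
    exact isUnit_iff_ne_zero.mpr fun h =>
      nonZeroDivisors.ne_zero a.2 (hg (h.trans (map_zero g).symm))
  have hdom : IsDomain A := hg.isDomain g
  let f : K →+* ℝ := IsLocalization.lift (M := nonZeroDivisors A) hu
  have hf : ∀ a, f (algebraMap A K a) = g a := fun a => IsLocalization.lift_eq hu a
  have hsurj : ∀ z : K, ∃ a b : A, b ≠ 0 ∧ z * algebraMap A K b = algebraMap A K a := fun z => by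
    obtain ⟨⟨a, b⟩, h⟩ := IsLocalization.surj (nonZeroDivisors A) z
    exact ⟨a, b, nonZeroDivisors.ne_zero b.2, h⟩
  have hunit : ∀ b : A, b ≠ 0 → IsUnit (algebraMap A K b) := fun b hb =>
    IsLocalization.map_units K (⟨b, mem_nonZeroDivisors_of_ne_zero hb⟩ : nonZeroDivisors A)
  have hg0 : ∀ b : A, b ≠ 0 → g b ≠ 0 := fun b hb h => hb (hg (h.trans (map_zero g).symm))
  refine ⟨f, hf, (injective_iff_map_eq_zero f).mpr fun z hz => ?_, fun z => ?_, fun z hz => ?_⟩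
  · obtain ⟨a, b, hb, h⟩ := hsurj z
    have h1 := congrArg f h
    rw [map_mul, hz, zero_mul, hf] at h1
    rw [hg (h1.symm.trans (map_zero g).symm), map_zero] at h
    exact (hunit b hb).mul_left_eq_zero.mp h
  · obtain ⟨a, b, hb, h⟩ := hsurj z
    have h1 := congrArg f h
    rw [map_mul, hf, hf] at h1
    rw [eq_div_of_mul_eq (hg0 b hb) h1]
    exact div_mem (hk a) (hk b)
  · obtain ⟨a, b, hb, h⟩ := hsurj z
    have ha : a ≠ 0 := by
      rintro rfl
      rw [map_zero] at h
      exact hz ((hunit b hb).mul_left_eq_zero.mp h)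
    exact isUnit_of_mul_isUnit_left (h ▸ hunit a ha)

end Relations

section Embedding

/-- The evaluation of a polynomial in the coordinates of `∏ X` at the real points. -/
noncomputable def evalX : MvPolynomial (ℕ × Fin 2) ℚ →+* ℝ :=
  MvPolynomial.eval₂Hom (algebraMap ℚ ℝ) fun p => ![uR p.1, vR p.1] p.2

/-- The homomorphism from the coordinate ring of `∏ X` to the real numbers. -/
noncomputable def coordXReal : CoordX ℕ →+* ℝ :=
  Ideal.Quotient.lift (idealX ℕ) evalX fun P hP => by
    have : idealX ℕ ≤ RingHom.ker evalX := by
      refine Ideal.span_le.mpr ?_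
      rintro _ ⟨i, rfl⟩
      rw [SetLike.mem_coe, RingHom.mem_ker, map_curveP]
      simpa [evalX] using curveP_uR_vR i
    exact this hP

theorem mem_closure_coordX (z : CoordX ℕ) :
    z ∈ Subring.closure ((algebraMap ℚ (CoordX ℕ)).range ∪
      (Set.range (fun i => Ideal.Quotient.mk (idealX ℕ) (MvPolynomial.X (i, 0))) ∪
        Set.range (fun i => Ideal.Quotient.mk (idealX ℕ) (MvPolynomial.X (i, 1))))) := by
  obtain ⟨P, rfl⟩ := Ideal.Quotient.mk_surjective z
  induction P using MvPolynomial.induction_on with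
  | C q => exact Subring.subset_closure (Or.inl ⟨q, rfl⟩)
  | add P Q hP hQ => rw [map_add]; exact add_mem hP hQ
  | mul_X P p hP =>
    rw [map_mul]
    refine mul_mem hP (Subring.subset_closure (Or.inr ?_))
    obtain ⟨i, j⟩ := p
    fin_cases j
    · exact Or.inl ⟨i, rfl⟩
    · exact Or.inr ⟨i, rfl⟩

theorem coordXReal_u (i : ℕ) :
    coordXReal (Ideal.Quotient.mk (idealX ℕ) (MvPolynomial.X (i, 0))) = uR i := by
  simp [coordXReal, evalX]

theorem coordXReal_v (i : ℕ) :
    coordXReal (Ideal.Quotient.mk (idealX ℕ) (MvPolynomial.X (i, 1))) = vR i := by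
  simp [coordXReal, evalX]

/-- The tower argument over `ℚ`. Primality of `idealX` is a consequence and is not needed
beforehand. -/
theorem coordXReal_injective : Function.Injective coordXReal := by
  refine (injective_iff_map_eq_zero _).mpr fun z hz => ?_
  have hrat : ∀ q : ℚ, coordXReal (algebraMap ℚ (CoordX ℕ) q) = q := fun q =>
    eq_ratCast (coordXReal.comp (algebraMap ℚ (CoordX ℕ))) q
  refine eq_zero_of_mem_closure_range coordXReal ?_ (k := realK) ?_ realK_mono
    (fun n => ?_) (fun n => ?_) (fun n => ?_) (fun n => ?_) (mem_closure_coordX z) hz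
  · rintro _ ⟨q, rfl⟩ h
    rw [hrat, Rat.cast_eq_zero] at h
    rw [h, map_zero]
  · rintro _ ⟨q, rfl⟩
    rw [hrat]
    exact SubfieldClass.ratCast_mem _ q
  · rw [coordXReal_u]; exact uR_mem_realK n
  · rw [coordXReal_v]; exact vR_mem_realK n
  · rw [coordXReal_u, coordXReal_v]; exact isQuarticExtension_realK n
  · refine exists_relation_of_curveP (B := (algebraMap ℚ (CoordX ℕ)).range) (fun q => ⟨q, rfl⟩) ?_
    rw [← map_curveP]
    exact Ideal.Quotient.eq_zero_iff_mem.mpr (Ideal.subset_span ⟨n, rfl⟩)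

variable (G : SimpleGraph ℕ)

theorem coordXReal_mem (z : CoordX ℕ) : coordXReal z ∈ realF G 0 := by
  obtain ⟨P, rfl⟩ := Ideal.Quotient.mk_surjective z
  induction P using MvPolynomial.induction_on with
  | C q => simp [coordXReal, evalX]
  | add P Q hP hQ => rw [map_add, map_add]; exact add_mem hP hQ
  | mul_X P p hP =>
    rw [map_mul, map_mul]
    refine mul_mem hP ?_
    obtain ⟨i, j⟩ := p
    fin_cases j
    · exact (coordXReal_u i).symm ▸ realK_le_realF G _ _ (uR_mem_realK i)
    · exact (coordXReal_v i).symm ▸ realK_le_realF G _ _ (vR_mem_realK i)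

theorem exists_embedding_fieldK : ∃ f : FieldK ℕ →+* ℝ,
    (∀ i, f (uK i) = uR i) ∧ (∀ i, f (vK i) = vR i) ∧ Function.Injective f ∧
      ∀ z, f z ∈ realF G 0 := by
  obtain ⟨f, hf, hinj, hmem, -⟩ := exists_lift_of_injective (K := FieldK ℕ) coordXReal_injective
    (coordXReal_mem G)
  exact ⟨f, fun i => (hf _).trans (coordXReal_u i), fun i => (hf _).trans (coordXReal_v i), hinj,
    hmem⟩

theorem map_curveParam {f : FieldK ℕ →+* ℝ} (hu : ∀ i, f (uK i) = uR i) (k : ℕ) :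
    f (curveParam G (twoSubsetAt k)) = tR G k := by
  classical
  unfold curveParam tR
  have h : (twoSubsetAt k).1 ∈ G.edgeSet ↔ G.Adj (pairAt k).1.1 (pairAt k).1.2 := Iff.rfl
  rw [apply_ite f]
  refine ite_congr (propext h) (fun _ => ?_) fun _ => ?_
  · simp [twoSubsetAt, hu]
  · simp [twoSubsetAt, hu]

/-- The tower argument over the image of `K`, with the curves in the order of `twoSubsetAt`. That
nonzero elements are units has to be recorded, because `FieldF` is only given as a commutative ring.
-/
theorem exists_embedding_fieldF : ∃ φ : FieldF G →+* ℝ,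
    (∀ i, φ (uF G i) = uR i) ∧ (∀ i, φ (vF G i) = vR i) ∧
    (∀ k, φ (xF G (twoSubsetAt k)) = xR k) ∧ (∀ k, φ (yF G (twoSubsetAt k)) = yR G k) ∧
    Function.Injective φ ∧ (∀ z, φ z ∈ ⨆ k, realF G k) ∧ ∀ z : FieldF G, z ≠ 0 → IsUnit z := by
  obtain ⟨f, hu, hv, hinj, hmem⟩ := exists_embedding_fieldK G
  let e : ℕ ≃ TwoSubset ℕ := Equiv.ofBijective twoSubsetAt twoSubsetAt_bijective
  have he : ∀ k, e.symm (twoSubsetAt k) = k := fun k => e.symm_apply_apply k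
  let ev : MvPolynomial (TwoSubset ℕ × Fin 2) (FieldK ℕ) →+* ℝ :=
    MvPolynomial.eval₂Hom f fun p => ![xR (e.symm p.1), yR G (e.symm p.1)] p.2
  have hker : ∀ P ∈ idealZ G, ev P = 0 := fun P hP => by
    have : idealZ G ≤ RingHom.ker ev := by
      refine Ideal.span_le.mpr ?_
      rintro _ ⟨s, rfl⟩
      obtain ⟨k, rfl⟩ := twoSubsetAt_bijective.2 s
      rw [SetLike.mem_coe, RingHom.mem_ker, map_curveQ]
      simpa [ev, he, map_curveParam G hu] using curveQ_tR_xR_yR G k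
    exact this hP
  let ψ : CoordZ G →+* ℝ := Ideal.Quotient.lift (idealZ G) ev hker
  have hψ : ∀ P, ψ (Ideal.Quotient.mk (idealZ G) P) = ev P := fun P => Ideal.Quotient.lift_mk _ _ _
  let ι : FieldK ℕ →+* CoordZ G := (Ideal.Quotient.mk (idealZ G)).comp MvPolynomial.C
  let ξ : ℕ → CoordZ G := fun k => Ideal.Quotient.mk (idealZ G) (MvPolynomial.X (twoSubsetAt k, 0))
  let η : ℕ → CoordZ G := fun k => Ideal.Quotient.mk (idealZ G) (MvPolynomial.X (twoSubsetAt k, 1))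
  have hι : ∀ a, ψ (ι a) = f a := fun a => by simp [ι, hψ, ev]
  have hξ : ∀ k, ψ (ξ k) = xR k := fun k => by simp [ξ, hψ, ev, he]
  have hη : ∀ k, ψ (η k) = yR G k := fun k => by simp [η, hψ, ev, he]
  have hcl : ∀ z, z ∈ Subring.closure (ι.range ∪ (Set.range ξ ∪ Set.range η)) := fun z => by
    obtain ⟨P, rfl⟩ := Ideal.Quotient.mk_surjective z
    induction P using MvPolynomial.induction_on with
    | C q => exact Subring.subset_closure (Or.inl ⟨q, rfl⟩)
    | add P Q hP hQ => rw [map_add]; exact add_mem hP hQ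
    | mul_X P p hP =>
      rw [map_mul]
      refine mul_mem hP (Subring.subset_closure (Or.inr ?_))
      obtain ⟨s, j⟩ := p
      obtain ⟨k, rfl⟩ := twoSubsetAt_bijective.2 s
      fin_cases j
      · exact Or.inl ⟨k, rfl⟩
      · exact Or.inr ⟨k, rfl⟩
  have hψinj : Function.Injective ψ := by
    refine (injective_iff_map_eq_zero _).mpr fun z hz => ?_
    refine eq_zero_of_mem_closure_range ψ (B := ι.range) ?_ (k := realF G) ?_ (realF_mono G)
      (fun n => ?_) (fun n => ?_) (fun n => ?_) (fun n => ?_) (hcl z) hz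
    · rintro _ ⟨a, rfl⟩ h
      rw [hι] at h
      rw [hinj (h.trans (map_zero f).symm), map_zero]
    · rintro _ ⟨a, rfl⟩
      rw [hι]
      exact hmem a
    · rw [hξ]; exact xR_mem_realF G n
    · rw [hη]; exact yR_mem_realF G n
    · rw [hξ, hη]; exact isQuarticExtension_realF G n
    · refine exists_relation_of_curveQ (t := ι (curveParam G (twoSubsetAt n))) ⟨_, rfl⟩ ?_
      show curveQ (Ideal.Quotient.mk (idealZ G) _) (Ideal.Quotient.mk (idealZ G) _)
        (Ideal.Quotient.mk (idealZ G) _) = 0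
      rw [← map_curveQ]
      exact Ideal.Quotient.eq_zero_iff_mem.mpr (Ideal.subset_span ⟨twoSubsetAt n, rfl⟩)
  have hle := le_iSup (realF G)
  have hψmem : ∀ z, ψ z ∈ ⨆ k, realF G k := fun z => by
    have : Subring.closure (ι.range ∪ (Set.range ξ ∪ Set.range η)) ≤
        (⨆ k, realF G k).toSubring.comap ψ := by
      refine Subring.closure_le.mpr ?_
      rintro _ (⟨a, rfl⟩ | ⟨k, rfl⟩ | ⟨k, rfl⟩)
      · show ψ (ι a) ∈ ⨆ k, realF G k
        exact (hι a).symm ▸ hle 0 (hmem a)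
      · show ψ (ξ k) ∈ ⨆ k, realF G k
        exact (hξ k).symm ▸ hle _ (xR_mem_realF G k)
      · show ψ (η k) ∈ ⨆ k, realF G k
        exact (hη k).symm ▸ hle _ (yR_mem_realF G k)
    exact this (hcl z)
  obtain ⟨φ, hφ, hφinj, hφmem, hφu⟩ := exists_lift_of_injective (K := FieldF G) hψinj hψmem
  exact ⟨φ, fun i => (hφ _).trans ((hι _).trans (hu i)),
    fun i => (hφ _).trans ((hι _).trans (hv i)),
    fun k => (hφ _).trans (hξ k), fun k => (hφ _).trans (hη k), hφinj, hφmem, hφu⟩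

end Embedding

/-! ### Presentations of subfields of the real numbers -/

section Enumeration

variable {R : Type*} {D : Set R} {w : ℕ → R}

/-- The first occurrences of elements outside `D` in the sequence `w`. -/
def IsNew (D : Set R) (w : ℕ → R) (c : ℕ) : Prop := w c ∉ D ∧ ∀ c' < c, w c' ≠ w c

theorem exists_isNew {z : R} (hz : z ∈ Set.range w) (hD : z ∉ D) : ∃ c, IsNew D w c ∧ w c = z := by
  classical
  have h : ∃ c, w c = z := hz
  refine ⟨Nat.find h, ⟨by rwa [Nat.find_spec h], fun c' hc' hw => ?_⟩, Nat.find_spec h⟩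
  exact Nat.find_min h hc' (hw.trans (Nat.find_spec h))

theorem isNew_injOn {a b : ℕ} (ha : IsNew D w a) (hb : IsNew D w b) (h : w a = w b) : a = b := by
  rcases lt_trichotomy a b with hab | hab | hab
  · exact absurd h (hb.2 a hab)
  · exact hab
  · exact absurd h.symm (ha.2 b hab)

theorem infinite_isNew (h : (Set.range w \ D).Infinite) : {c | IsNew D w c}.Infinite := by
  refine Set.Infinite.of_image w (h.mono ?_)
  rintro z ⟨hz, hD⟩
  obtain ⟨c, hc, rfl⟩ := exists_isNew hz hD
  exact ⟨c, hc, rfl⟩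

theorem enumNew_eq (m : ℕ) : enumNew D w m = w (Nat.nth (IsNew D w) m) := rfl

/-- Infinitely many new elements are required because `Nat.nth` has the default value `0` beyond the
end of a finite set. -/
theorem enumNew_injective (h : (Set.range w \ D).Infinite) : Function.Injective (enumNew D w) := by
  intro a b hab
  exact Nat.nth_injective (infinite_isNew h) (isNew_injOn
    (Nat.nth_mem_of_infinite (infinite_isNew h) a) (Nat.nth_mem_of_infinite (infinite_isNew h) b)
    hab)

theorem range_enumNew (h : (Set.range w \ D).Infinite) :
    Set.range (enumNew D w) = Set.range w \ D := by
  ext z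
  constructor
  · rintro ⟨m, rfl⟩
    exact ⟨⟨_, rfl⟩, (Nat.nth_mem_of_infinite (infinite_isNew h) m).1⟩
  · rintro ⟨hz, hD⟩
    obtain ⟨c, hc, rfl⟩ := exists_isNew hz hD
    have : c ∈ Set.range (Nat.nth (IsNew D w)) := by
      rw [Nat.range_nth_of_infinite (infinite_isNew h)]; exact hc
    obtain ⟨m, rfl⟩ := this
    exact ⟨m, rfl⟩

/-- The selection of first occurrences depends only on equalities and membership, which injective
maps respect. -/
theorem map_enumNew {S : Type*} {f : R → S} (hf : Function.Injective f) (m : ℕ) :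
    f (enumNew D w m) = enumNew (f '' D) (f ∘ w) m := by
  have : IsNew (f '' D) (f ∘ w) = IsNew D w := by
    ext c
    simp [IsNew, hf.eq_iff, hf.mem_set_image]
  rw [enumNew_eq, enumNew_eq, this]
  rfl

end Enumeration

/-! ### Quartic extensions of presented subfields -/

section Presentation

open Polynomial

namespace IsQuarticExtension

variable {k : Subfield ℝ} {x y : ℝ}

theorem aeval_eq_zero_iff (h : IsQuarticExtension k x y) {p : k[X]} : aeval x p = 0 ↔ p = 0 := by
  constructor
  · intro hp
    simpa using h.indep ![p, 0, 0, 0] (by simpa [Fin.sum_univ_four] using hp) 0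
  · rintro rfl
    exact map_zero _

/-- As `a / 0 = 0`, fractions with zero denominator are replaced by `0 / 1` before denominators are
cleared. -/
theorem div_indep (h : IsQuarticExtension k x y) {P Q : Fin 4 → k[X]}
    (hPQ : ∑ j, aeval x (P j) / aeval x (Q j) * y ^ (j : ℕ) = 0) (j : Fin 4) :
    P j = 0 ∨ Q j = 0 := by
  classical
  let P' : Fin 4 → k[X] := fun j => if Q j = 0 then 0 else P j
  let Q' : Fin 4 → k[X] := fun j => if Q j = 0 then 1 else Q j
  have hQ' : ∀ j, Q' j ≠ 0 := fun j => by
    by_cases hj : Q j = 0 <;> simp [Q', hj]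
  have hdiv : ∀ j, aeval x (P j) / aeval x (Q j) = aeval x (P' j) / aeval x (Q' j) := fun j => by
    by_cases hj : Q j = 0 <;> simp [P', Q', hj]
  have hQx : ∀ j, aeval x (Q' j) ≠ 0 := fun j hj => hQ' j (h.aeval_eq_zero_iff.mp hj)
  have h1 : ∑ j, aeval x (P' j * ∏ i ∈ Finset.univ.erase j, Q' i) * y ^ (j : ℕ) = 0 := by
    have h2 : ∀ j, aeval x (P' j * ∏ i ∈ Finset.univ.erase j, Q' i) =
        (aeval x (P j) / aeval x (Q j)) * aeval x (∏ i, Q' i) := fun j => by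
      rw [hdiv, ← Finset.mul_prod_erase _ _ (Finset.mem_univ j), map_mul, map_mul]
      have := hQx j
      field_simp
    calc _ = (∑ j, aeval x (P j) / aeval x (Q j) * y ^ (j : ℕ)) * aeval x (∏ i, Q' i) := by
          rw [Finset.sum_mul]
          exact Finset.sum_congr rfl fun j _ => by rw [h2]; ring
      _ = 0 := by rw [hPQ, zero_mul]
  have h3 := h.indep _ h1 j
  have h4 : P' j = 0 := (mul_eq_zero.mp h3).resolve_right
    (Finset.prod_ne_zero_iff.mpr fun i _ => hQ' i)
  by_cases hj : Q j = 0
  · exact Or.inr hj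
  · left; simpa [P', hj] using h4

/-- By independence, the components at `y, y ^ 2, y ^ 3` must vanish and the first one must be a
constant. The latter means that `P 0` and `Q 0` are proportional or `Q 0 = 0`, that is, all `2 × 2`
minors of their coefficients vanish. In this form a failure is witnessed by finitely many nonzero
elements of `k`. -/
theorem div_mem_iff (h : IsQuarticExtension k x y) (P Q : Fin 4 → k[X]) :
    ∑ j, aeval x (P j) / aeval x (Q j) * y ^ (j : ℕ) ∈ k ↔
      (∀ j, j ≠ 0 → P j = 0 ∨ Q j = 0) ∧
        ∀ i i', (P 0).coeff i * (Q 0).coeff i' = (P 0).coeff i' * (Q 0).coeff i := by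
  constructor
  · intro hk
    obtain ⟨c, hc⟩ : ∃ c : k, (c : ℝ) = ∑ j, aeval x (P j) / aeval x (Q j) * y ^ (j : ℕ) :=
      ⟨⟨_, hk⟩, rfl⟩
    have hA : aeval x (C c : k[X]) = (c : ℝ) := by rw [aeval_C]; rfl
    by_cases hQ : Q 0 = 0
    · have := h.div_indep (P := Function.update P 0 (-C c)) (Q := Function.update Q 0 1) (by
        rw [Fin.sum_univ_four] at hc ⊢
        simp only [Fin.isValue, Function.update_self, ne_eq, one_ne_zero, not_false_eq_true,
          Function.update_of_ne, map_neg, hA, map_one, hc, hQ, map_zero,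
          show (2 : Fin 4) ≠ 0 by decide, show (3 : Fin 4) ≠ 0 by decide]
        simp
        ring)
      exact ⟨fun j hj => by simpa [hj] using this j, fun i i' => by simp [hQ]⟩
    · have hQx : aeval x (Q 0) ≠ 0 := fun hj => hQ (h.aeval_eq_zero_iff.mp hj)
      have := h.div_indep (P := Function.update P 0 (P 0 - C c * Q 0)) (Q := Q) (by
        rw [Fin.sum_univ_four] at hc ⊢
        simp only [Fin.isValue, Function.update_self, ne_eq, one_ne_zero, not_false_eq_true,
          Function.update_of_ne, map_sub, map_mul, hA, hc,
          show (2 : Fin 4) ≠ 0 by decide, show (3 : Fin 4) ≠ 0 by decide]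
        simp only [Fin.val_zero, pow_zero, mul_one]
        field_simp
        ring)
      refine ⟨fun j hj => by simpa [hj] using this j, fun i i' => ?_⟩
      have h0 : P 0 = C c * Q 0 := by
        have := (this 0).resolve_right hQ
        simpa [sub_eq_zero] using this
      rw [h0, coeff_C_mul, coeff_C_mul]
      ring
  · rintro ⟨h1, h2⟩
    have h3 : ∀ j, j ≠ 0 → aeval x (P j) / aeval x (Q j) = 0 := fun j hj => by
      rcases h1 j hj with h | h <;> simp [h]
    rw [Fin.sum_univ_four, h3 1 (by decide), h3 2 (by decide), h3 3 (by decide)]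
    by_cases hQ : Q 0 = 0
    · simp [hQ]
    · obtain ⟨i, hi⟩ : ∃ i, (Q 0).coeff i ≠ 0 := by
        by_contra! hall
        exact hQ (Polynomial.ext hall)
      have hP : P 0 = C ((P 0).coeff i / (Q 0).coeff i) * Q 0 := by
        ext i'
        rw [coeff_C_mul]
        congr 1
        field_simp
        exact h2 i' i
      have hQx : aeval x (Q 0) ≠ 0 := fun hj => hQ (h.aeval_eq_zero_iff.mp hj)
      rw [hP, map_mul, aeval_C]
      simp only [Fin.val_zero, pow_zero, mul_one, zero_mul, add_zero]
      rw [mul_div_cancel_right₀ _ hQx]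
      exact ((P 0).coeff i / (Q 0).coeff i).2

/-- Since `y` is integral over `L = k(x)`, the field `L(y)` equals `L[y]`, which is spanned by `1,
y, y ^ 2, y ^ 3`. -/
theorem exists_div_of_mem_closure (h : IsQuarticExtension k x y) {z : ℝ}
    (hz : z ∈ Subfield.closure (k ∪ {x, y})) :
    ∃ P Q : Fin 4 → k[X], z = ∑ j, aeval x (P j) / aeval x (Q j) * y ^ (j : ℕ) := by
  let L := Subfield.closure ((k : Set ℝ) ∪ {x})
  have hkL : ∀ {c : ℝ}, c ∈ k → c ∈ L := fun hc => Subfield.subset_closure (Or.inl hc)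
  have hxL : x ∈ L := Subfield.subset_closure (Or.inr rfl)
  have hpoly : ∀ p : k[X], aeval x p ∈ L := fun p => by
    rw [aeval_eq_sum_range]
    refine sum_mem fun i _ => ?_
    rw [Algebra.smul_def]
    exact mul_mem (hkL (p.coeff i).2) (pow_mem hxL _)
  have hL : ∀ c ∈ L, ∃ p q : k[X], c = aeval x p / aeval x q := fun c hc => by
    obtain ⟨a, ha, b, hb, rfl⟩ :=
      (Subfield.mem_closure_iff (s := (k : Set ℝ) ∪ {x})).mp hc
    obtain ⟨p, rfl⟩ := (mem_closure_singleton_iff (B := k.toSubring)).mp ha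
    obtain ⟨q, rfl⟩ := (mem_closure_singleton_iff (B := k.toSubring)).mp hb
    exact ⟨p, q, rfl⟩
  obtain ⟨a, ha⟩ := h.rel
  have hint : IsIntegral L y := by
    refine ⟨X ^ 4 - ∑ j : Fin 4, C ⟨aeval x (a j), hpoly _⟩ * X ^ (j : ℕ),
      monic_X_pow_sub ?_, ?_⟩
    · exact (degree_sum_le _ _).trans_lt ((Finset.sup_lt_iff (by decide)).mpr fun j _ =>
        (degree_C_mul_X_pow_le _ _).trans_lt (by exact_mod_cast j.2))
    · simp only [eval₂_sub, eval₂_pow, eval₂_X, eval₂_finsetSum, eval₂_mul, eval₂_C]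
      rw [ha, sub_eq_zero]
      rfl
  have hz1 : z ∈ IntermediateField.adjoin L {y} := by
    refine (Subfield.closure_le (t := (IntermediateField.adjoin L {y}).toSubfield)).mpr ?_ hz
    rintro w (hw | rfl | rfl)
    · exact (IntermediateField.adjoin L {y}).algebraMap_mem
        ⟨w, Subfield.subset_closure (Or.inl hw)⟩
    · exact (IntermediateField.adjoin L {y}).algebraMap_mem
        ⟨w, Subfield.subset_closure (Or.inr rfl)⟩
    · exact IntermediateField.mem_adjoin_simple_self L w
  rw [← IntermediateField.mem_toSubalgebra,
    IntermediateField.adjoin_simple_toSubalgebra_of_isAlgebraic hint.isAlgebraic,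
    Algebra.mem_adjoin_iff] at hz1
  have hz2 : z ∈ Subring.closure ((L.toSubring : Set ℝ) ∪ {y}) := by
    refine Subring.closure_mono (Set.union_subset_union_left _ ?_) hz1
    rintro _ ⟨c, rfl⟩
    exact c.2
  obtain ⟨c, hc, rfl⟩ := exists_sum_of_mem_closure
    ⟨fun j => aeval x (a j), fun j => hpoly _, ha⟩ hz2
  choose P Q hPQ using fun j => hL (c j) (hc j)
  exact ⟨P, Q, Finset.sum_congr rfl fun j _ => by rw [hPQ]⟩

end IsQuarticExtension

/-- `s` names the elements of the subfield `k` by the natural numbers in the columns in `C`. -/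
structure IsPresentation (s : ℕ → ℝ) (C : Set ℕ) (k : Subfield ℝ) : Prop where
  eq_zero : ∀ a : ℕ, a.unpair.1 ∉ C → s a = 0
  inj : ∀ a b : ℕ, a.unpair.1 ∈ C → b.unpair.1 ∈ C → s a = s b → a = b
  mem_iff : ∀ z, z ∈ k ↔ ∃ a : ℕ, a.unpair.1 ∈ C ∧ s a = z

/-- The rational function over the presented field in the list of names `l`, at index `i`. -/
noncomputable def listCoeff (s : ℕ → ℝ) (l : List ℕ) (i : ℕ) : ℝ := (l.map s).getD i 0

/-- The numerator and denominator of the components of a code of an element of `k(x, y)`. -/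
def codeAt (c : ℕ) (j : Fin 4) : List ℕ × List ℕ :=
  let r := Denumerable.ofNat ((List ℕ × List ℕ) × (List ℕ × List ℕ) ×
      (List ℕ × List ℕ) × (List ℕ × List ℕ)) c
  ![r.1, r.2.1, r.2.2.1, r.2.2.2] j

theorem exists_codeAt (r : Fin 4 → List ℕ × List ℕ) : ∃ c, codeAt c = r := by
  refine ⟨Encodable.encode ((r 0, r 1, r 2, r 3) : (List ℕ × List ℕ) × (List ℕ × List ℕ) ×
      (List ℕ × List ℕ) × (List ℕ × List ℕ)), funext fun j => ?_⟩
  simp only [codeAt, Denumerable.ofNat_encode]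
  fin_cases j <;> rfl

theorem extensionSeq_add_two (s : ℕ → ℝ) (x y : ℝ) (c : ℕ) : extensionSeq s x y (c + 2) =
    ∑ j, evalPoly s x (codeAt c j).1 / evalPoly s x (codeAt c j).2 * y ^ (j : ℕ) := by
  rw [Fin.sum_univ_four]
  simp [extensionSeq, codeAt, evalFrac, div_eq_mul_inv]

namespace IsPresentation

variable {s : ℕ → ℝ} {C : Set ℕ} {k : Subfield ℝ} {x y : ℝ}

theorem range_eq (hs : IsPresentation s C k) : Set.range s = k := by
  ext z
  constructor
  · rintro ⟨a, rfl⟩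
    by_cases ha : a.unpair.1 ∈ C
    · exact (hs.mem_iff _).mpr ⟨a, ha, rfl⟩
    · rw [hs.eq_zero a ha]; exact k.zero_mem
  · intro hz
    obtain ⟨a, -, rfl⟩ := (hs.mem_iff z).mp hz
    exact ⟨a, rfl⟩

theorem exists_poly (hs : IsPresentation s C k) (x : ℝ) (l : List ℕ) :
    ∃ p : k[X], aeval x p = evalPoly s x l ∧ ∀ i, (p.coeff i : ℝ) = listCoeff s l i := by
  induction l with
  | nil => exact ⟨0, by simp [evalPoly], fun i => by simp [listCoeff]⟩
  | cons a l ih =>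
    obtain ⟨p, hp, hc⟩ := ih
    have ha : s a ∈ k := by rw [← SetLike.mem_coe, ← hs.range_eq]; exact ⟨a, rfl⟩
    refine ⟨Polynomial.C ⟨s a, ha⟩ + X * p, ?_, fun i => ?_⟩
    · rw [map_add, map_mul, aeval_C, aeval_X, hp]
      rfl
    · cases i with
      | zero => simp [listCoeff]
      | succ i => simpa [listCoeff, coeff_C_succ] using hc i

theorem exists_list (hs : IsPresentation s C k) (x : ℝ) (p : k[X]) :
    ∃ l : List ℕ, evalPoly s x l = aeval x p := by
  suffices H : ∀ n, ∀ p : k[X], p.natDegree < n → ∃ l : List ℕ, evalPoly s x l = aeval x p from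
    H _ p (Nat.lt_succ_self _)
  intro n
  induction n with
  | zero => intro p hp; omega
  | succ n ih =>
    intro p hp
    obtain ⟨l, hl⟩ : ∃ l : List ℕ, evalPoly s x l = aeval x p.divX := by
      rcases Nat.eq_zero_or_pos p.natDegree with h0 | h0
      · exact ⟨[], by rw [eq_C_of_natDegree_eq_zero h0]; simp [evalPoly]⟩
      · exact ih _ (by rw [natDegree_divX_eq_natDegree_tsub_one]; omega)
    obtain ⟨a, -, ha⟩ := (hs.mem_iff (p.coeff 0)).mp (p.coeff 0).2
    refine ⟨a :: l, ?_⟩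
    conv_rhs => rw [← X_mul_divX_add p, map_add, map_mul, aeval_X, aeval_C]
    rw [← hl, add_comm]
    simp only [evalPoly, List.foldr_cons, ha]
    rfl

theorem extensionSeq_mem (hs : IsPresentation s C k) (x y : ℝ) (c : ℕ) :
    extensionSeq s x y c ∈ Subfield.closure ((k : Set ℝ) ∪ {x, y}) := by
  have hx : x ∈ Subfield.closure ((k : Set ℝ) ∪ {x, y}) := Subfield.subset_closure (by simp)
  have hy : y ∈ Subfield.closure ((k : Set ℝ) ∪ {x, y}) := Subfield.subset_closure (by simp)
  have hp : ∀ l, evalPoly s x l ∈ Subfield.closure ((k : Set ℝ) ∪ {x, y}) := fun l => by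
    induction l with
    | nil => exact zero_mem _
    | cons a l ih =>
      refine add_mem (Subfield.subset_closure (Or.inl ?_)) (mul_mem hx ih)
      rw [← hs.range_eq]
      exact ⟨a, rfl⟩
  match c with
  | 0 => exact hx
  | 1 => exact hy
  | c + 2 =>
    rw [extensionSeq_add_two]
    exact sum_mem fun j _ => mul_mem (div_mem (hp _) (hp _)) (pow_mem hy _)

theorem range_extensionSeq (hs : IsPresentation s C k) (h : IsQuarticExtension k x y) :
    Set.range (extensionSeq s x y) = Subfield.closure ((k : Set ℝ) ∪ {x, y}) := by
  ext z
  constructor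
  · rintro ⟨c, rfl⟩
    exact hs.extensionSeq_mem x y c
  · intro hz
    obtain ⟨P, Q, rfl⟩ := h.exists_div_of_mem_closure hz
    choose p hp using fun j => hs.exists_list x (P j)
    choose q hq using fun j => hs.exists_list x (Q j)
    obtain ⟨c, hc⟩ := exists_codeAt fun j => (p j, q j)
    exact ⟨c + 2, by rw [extensionSeq_add_two, hc]; simp only [hp, hq]⟩

theorem x_pow_notMem (h : IsQuarticExtension k x y) (n : ℕ) : x ^ (n + 1) ∉ k := by
  intro hn
  have h1 : aeval x (X ^ (n + 1) - Polynomial.C (⟨x ^ (n + 1), hn⟩ : k)) = 0 := by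
    simp only [map_sub, map_pow, aeval_X, aeval_C]
    exact sub_self _
  exact X_pow_sub_C_ne_zero n.succ_pos _ (h.aeval_eq_zero_iff.mp h1)

/-- The powers of `x` are distinct and lie outside `k`, so the new column is filled. -/
theorem infinite_new (hs : IsPresentation s C k) (h : IsQuarticExtension k x y) :
    (Set.range (extensionSeq s x y) \ Set.range s).Infinite := by
  rw [hs.range_extensionSeq h, hs.range_eq]
  refine Set.infinite_of_injective_forall_mem (f := fun n : ℕ => x ^ (n + 1)) ?_ fun n =>
    ⟨pow_mem (Subfield.subset_closure (by simp)) _, x_pow_notMem h n⟩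
  intro a b hab
  by_contra hne
  have h1 : aeval x (X ^ (a + 1) - X ^ (b + 1) : k[X]) = 0 := by
    simp only [map_sub, map_pow, aeval_X]
    exact sub_eq_zero.mpr hab
  have h2 := congrArg natDegree (sub_eq_zero.mp (h.aeval_eq_zero_iff.mp h1))
  rw [natDegree_X_pow, natDegree_X_pow] at h2
  omega

theorem extendBy (hs : IsPresentation s C k) (h : IsQuarticExtension k x y) {n : ℕ} (hn : n ∉ C) :
    IsPresentation (extendBy s n x y) (insert n C) (Subfield.closure ((k : Set ℝ) ∪ {x, y})) := by
  have hinf := hs.infinite_new h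
  have hne : ∀ a : ℕ, a.unpair.1 ∈ C → a.unpair.1 ≠ n := fun a ha h => hn (h ▸ ha)
  have hr := range_enumNew hinf
  have hnot : ∀ m (a : ℕ), enumNew (Set.range s) (extensionSeq s x y) m ≠ s a := fun m a hma => by
    have : enumNew (Set.range s) (extensionSeq s x y) m ∈
        Set.range (extensionSeq s x y) \ Set.range s := hr ▸ ⟨m, rfl⟩
    exact this.2 ⟨a, hma.symm⟩
  refine ⟨fun a ha => ?_, fun a b ha hb hab => ?_, fun z => ⟨fun hz => ?_, ?_⟩⟩
  · rw [Set.mem_insert_iff, not_or] at ha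
    rw [_root_.extendBy, if_neg ha.1, hs.eq_zero a ha.2]
  · rcases ha with ha | ha <;> rcases hb with hb | hb
    · rw [_root_.extendBy, _root_.extendBy, if_pos ha, if_pos hb] at hab
      have := enumNew_injective hinf hab
      rw [← Nat.pair_unpair a, ← Nat.pair_unpair b, ha, hb, this]
    · rw [_root_.extendBy, _root_.extendBy, if_pos ha, if_neg (hne b hb)] at hab
      exact absurd hab (hnot _ _)
    · rw [_root_.extendBy, _root_.extendBy, if_pos hb, if_neg (hne a ha)] at hab
      exact absurd hab.symm (hnot _ _)
    · rw [_root_.extendBy, _root_.extendBy, if_neg (hne a ha), if_neg (hne b hb)] at hab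
      exact hs.inj a b ha hb hab
  · by_cases hzk : z ∈ k
    · obtain ⟨a, ha, rfl⟩ := (hs.mem_iff z).mp hzk
      exact ⟨a, Or.inr ha, by rw [_root_.extendBy, if_neg (hne a ha)]⟩
    · have : z ∈ Set.range (enumNew (Set.range s) (extensionSeq s x y)) := by
        rw [hr, hs.range_extensionSeq h, hs.range_eq]
        exact ⟨hz, hzk⟩
      obtain ⟨m, rfl⟩ := this
      exact ⟨Nat.pair n m, by simp, by simp [_root_.extendBy]⟩
  · rintro ⟨a, ha, rfl⟩
    rw [_root_.extendBy]
    split_ifs with h1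
    · exact hs.extensionSeq_mem x y _
    · refine Subfield.subset_closure (Or.inl ?_)
      rw [← hs.range_eq]
      exact ⟨a, rfl⟩

end IsPresentation

end Presentation

/-! ### The standard presentation in the real numbers -/

section Naming

theorem map_evalPoly {R S : Type*} [CommRing R] [CommRing S] (φ : R →+* S) (s : ℕ → R) (x : R)
    (l : List ℕ) : φ (evalPoly s x l) = evalPoly (φ ∘ s) (φ x) l := by
  induction l with
  | nil => exact map_zero φ
  | cons a l ih =>
    simp only [evalPoly, List.foldr_cons, map_add, map_mul] at ih ⊢
    rw [ih]
    rfl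

/-- `Ring.inverse` sends non-units to `0`, so it commutes with `φ` only because `0` is the only
non-unit of `R`. -/
theorem map_ringInverse {R S : Type*} [CommRing R] [CommRing S] (φ : R →+* S)
    (hR : ∀ z : R, z ≠ 0 → IsUnit z) (z : R) : φ (Ring.inverse z) = Ring.inverse (φ z) := by
  by_cases hz : z = 0
  · rw [hz, Ring.inverse_zero, map_zero, Ring.inverse_zero]
  · obtain ⟨u, rfl⟩ := hR z hz
    rw [Ring.inverse_unit]
    exact (Ring.inverse_unit (Units.map φ.toMonoidHom u)).symm

theorem map_extensionSeq {R S : Type*} [CommRing R] [CommRing S] (φ : R →+* S)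
    (hR : ∀ z : R, z ≠ 0 → IsUnit z) (s : ℕ → R) (x y : R) (c : ℕ) :
    φ (extensionSeq s x y c) = extensionSeq (φ ∘ s) (φ x) (φ y) c := by
  match c with
  | 0 => rfl
  | 1 => rfl
  | c + 2 =>
    simp only [extensionSeq, evalFrac, map_add, map_mul, map_pow, map_evalPoly,
      map_ringInverse φ hR]

theorem map_extendBy {R S : Type*} [CommRing R] [CommRing S] {φ : R →+* S}
    (hφ : Function.Injective φ) (hR : ∀ z : R, z ≠ 0 → IsUnit z) (s : ℕ → R) (n : ℕ) (x y : R) :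
    φ ∘ extendBy s n x y = extendBy (φ ∘ s) n (φ x) (φ y) := by
  funext a
  simp only [Function.comp_apply, extendBy]
  split_ifs with h
  · rw [map_enumNew hφ, Set.range_comp]
    congr 1
    exact funext (map_extensionSeq φ hR s x y)
  · rfl

/-- The standard sequence through the rational numbers. -/
noncomputable def ratSeqR (c : ℕ) : ℝ :=
  ((c.unpair.1.unpair.1 : ℝ) - c.unpair.1.unpair.2) * ((c.unpair.2 : ℝ) + 1)⁻¹

/-- The images of the presentations `stageK` in the real numbers. -/
noncomputable def realStageK : ℕ → ℕ → ℝ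
  | 0 => fun a => if a.unpair.1 = 0 then enumNew ∅ ratSeqR a.unpair.2 else 0
  | i + 1 => extendBy (realStageK i) (2 * i + 2) (uR i) (vR i)

/-- The images of the presentations `stageF` in the real numbers. -/
noncomputable def realStageF (G : SimpleGraph ℕ) : ℕ → ℕ → ℝ
  | 0 => fun a => realStageK a.unpair.1 a
  | k + 1 => extendBy (realStageF G k) (2 * k + 1) (xR k) (yR G k)

/-- The image in the real numbers of the element named by `a`. -/
noncomputable def realElement (G : SimpleGraph ℕ) (a : ℕ) : ℝ := realStageF G a.unpair.1 a

/-- Every ingredient of the naming commutes with an embedding, so all questions about it become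
questions about real numbers. -/
theorem map_element {G : SimpleGraph ℕ} {φ : FieldF G →+* ℝ} (hu : ∀ i, φ (uF G i) = uR i)
    (hv : ∀ i, φ (vF G i) = vR i) (hx : ∀ k, φ (xF G (twoSubsetAt k)) = xR k)
    (hy : ∀ k, φ (yF G (twoSubsetAt k)) = yR G k) (hφ : Function.Injective φ)
    (hR : ∀ z : FieldF G, z ≠ 0 → IsUnit z) (a : ℕ) : φ (element G a) = realElement G a := by
  have hK : ∀ i, φ ∘ stageK G i = realStageK i := fun i => by
    induction i with
    | zero =>
      funext a
      simp only [Function.comp_apply, stageK, realStageK]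
      split_ifs
      · rw [map_enumNew hφ, Set.image_empty]
        congr 1
        funext c
        simp only [Function.comp_apply, ratSeq, ratSeqR, map_mul, map_sub, map_natCast,
          map_ringInverse φ hR, map_add, map_one, Ring.inverse_eq_inv']
      · exact map_zero φ
    | succ i ih => rw [stageK, map_extendBy hφ hR, ih, hu, hv, realStageK]
  have hF : ∀ k, φ ∘ stageF G k = realStageF G k := fun k => by
    induction k with
    | zero => exact funext fun a => congrFun (hK _) a
    | succ k ih => rw [stageF, map_extendBy hφ hR, ih, hx, hy, realStageF]
  exact congrFun (hF _) a

theorem mem_bot_iff_ratSeqR (z : ℝ) : z ∈ (⊥ : Subfield ℝ) ↔ z ∈ Set.range ratSeqR := by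
  constructor
  · intro hz
    obtain ⟨q, rfl⟩ : ∃ q : ℚ, (q : ℝ) = z := by
      have : (⊥ : Subfield ℝ) ≤ (algebraMap ℚ ℝ).fieldRange := bot_le
      exact this hz
    refine ⟨Nat.pair (Nat.pair q.num.toNat (-q.num).toNat) (q.den - 1), ?_⟩
    have h1 : ((q.num.toNat : ℝ) - ((-q.num).toNat : ℝ)) = (q.num : ℝ) := by
      have : ((q.num.toNat : ℤ) - ((-q.num).toNat : ℤ)) = q.num := by omega
      exact_mod_cast this
    have h2 : ((q.den - 1 : ℕ) : ℝ) + 1 = q.den := by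
      have := q.den_pos
      have h : q.den - 1 + 1 = q.den := by omega
      exact_mod_cast h
    simp only [ratSeqR, Nat.unpair_pair, h1, h2]
    rw [← div_eq_mul_inv]
    exact (Rat.cast_def q).symm
  · rintro ⟨c, rfl⟩
    exact mul_mem (sub_mem (natCast_mem _ _) (natCast_mem _ _))
      (inv_mem (add_mem (natCast_mem _ _) (one_mem _)))

theorem infinite_range_ratSeqR : (Set.range ratSeqR \ ∅).Infinite := by
  rw [Set.sdiff_empty]
  refine Set.infinite_of_injective_forall_mem (f := fun n : ℕ => (n : ℝ)) Nat.cast_injective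
    fun n => (mem_bot_iff_ratSeqR _).mp (natCast_mem _ n)

theorem isPresentation_realStageK (i : ℕ) :
    IsPresentation (realStageK i) {c | Even c ∧ c ≤ 2 * i} (realK i) := by
  induction i with
  | zero =>
    have h0 : {c | Even c ∧ c ≤ 2 * 0} = ({0} : Set ℕ) := by
      ext c
      simp only [mul_zero, nonpos_iff_eq_zero, Set.mem_ofPred_eq, Set.mem_singleton_iff]
      exact ⟨fun h => h.2, fun h => ⟨h ▸ Even.zero, h⟩⟩
    rw [h0]
    refine ⟨fun a ha => if_neg ha, fun a b ha hb hab => ?_, fun z => ?_⟩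
    · rw [Set.mem_singleton_iff] at ha hb
      simp only [realStageK, ha, hb, if_true] at hab
      rw [← Nat.pair_unpair a, ← Nat.pair_unpair b, ha, hb,
        enumNew_injective infinite_range_ratSeqR hab]
    · rw [realK, mem_bot_iff_ratSeqR, ← Set.sdiff_empty (s := Set.range ratSeqR),
        ← range_enumNew infinite_range_ratSeqR]
      constructor
      · rintro ⟨m, rfl⟩
        exact ⟨Nat.pair 0 m, by simp, by simp [realStageK]⟩
      · rintro ⟨a, ha, rfl⟩
        exact ⟨a.unpair.2, (if_pos (Set.mem_singleton_iff.mp ha)).symm⟩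
  | succ i ih =>
    have h1 : {c | Even c ∧ c ≤ 2 * (i + 1)} = insert (2 * i + 2) {c | Even c ∧ c ≤ 2 * i} := by
      ext c
      simp only [Set.mem_ofPred_eq, Set.mem_insert_iff, Nat.even_iff]
      omega
    rw [h1]
    exact ih.extendBy (isQuarticExtension_realK i) (by simp)

theorem realStageK_of_le {i j a : ℕ} (hij : i ≤ j) (ha : a.unpair.1 ≤ 2 * i) :
    realStageK j a = realStageK i a := by
  induction j, hij using Nat.le_induction with
  | base => rfl
  | succ j hj ih => rw [realStageK, extendBy, if_neg (by omega), ih]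

/-- Stage `a.unpair.1` is later than necessary for the name `a`, but names do not change once given.
-/
theorem realStageK_eq {i a : ℕ} (ha : a.unpair.1 ≤ 2 * i) :
    realStageK i a = realStageK a.unpair.1 a := by
  rcases le_total i a.unpair.1 with h | h
  · exact (realStageK_of_le h ha).symm
  · exact realStageK_of_le h (by omega)

theorem isPresentation_realStageF (G : SimpleGraph ℕ) (k : ℕ) :
    IsPresentation (realStageF G k) {c | Even c ∨ c < 2 * k} (realF G k) := by
  induction k with
  | zero =>
    have h0 : {c | Even c ∨ c < 2 * 0} = {c : ℕ | Even c} := by ext c; simp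
    rw [h0]
    refine ⟨fun a ha => ?_, fun a b ha hb hab => ?_, fun z => ?_⟩
    · exact (isPresentation_realStageK _).eq_zero a fun h => ha h.1
    · let i := a.unpair.1 + b.unpair.1
      have h1 : realStageK i a = realStageK i b := by
        rw [realStageK_eq (i := i) (a := a) (by omega), realStageK_eq (i := i) (a := b) (by omega)]
        exact hab
      exact (isPresentation_realStageK i).inj a b ⟨ha, by omega⟩ ⟨hb, by omega⟩ h1
    · rw [realF, Subfield.mem_iSup_of_directed realK_mono.directed_le]
      constructor
      · rintro ⟨i, hi⟩
        obtain ⟨a, ha, rfl⟩ := ((isPresentation_realStageK i).mem_iff z).mp hi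
        exact ⟨a, ha.1, (realStageK_eq ha.2).symm⟩
      · rintro ⟨a, ha, rfl⟩
        exact ⟨a.unpair.1, ((isPresentation_realStageK _).mem_iff _).mpr
          ⟨a, ⟨ha, by omega⟩, rfl⟩⟩
  | succ k ih =>
    have h1 : {c | Even c ∨ c < 2 * (k + 1)} = insert (2 * k + 1) {c | Even c ∨ c < 2 * k} := by
      ext c
      simp only [Set.mem_ofPred_eq, Set.mem_insert_iff, Nat.even_iff]
      omega
    rw [h1]
    exact ih.extendBy (isQuarticExtension_realF G k) (by simp)

theorem realStageF_of_le (G : SimpleGraph ℕ) {k l a : ℕ} (hkl : k ≤ l)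
    (ha : Even a.unpair.1 ∨ a.unpair.1 < 2 * k) : realStageF G l a = realStageF G k a := by
  induction l, hkl using Nat.le_induction with
  | base => rfl
  | succ l hl ih =>
    rw [realStageF, extendBy, if_neg, ih]
    rw [Nat.even_iff] at ha
    omega

theorem realStageF_eq (G : SimpleGraph ℕ) {k a : ℕ} (ha : Even a.unpair.1 ∨ a.unpair.1 < 2 * k) :
    realStageF G k a = realElement G a := by
  rcases le_total k a.unpair.1 with h | h
  · exact (realStageF_of_le G h ha).symm
  · refine realStageF_of_le G h ?_
    rw [Nat.even_iff] at ha ⊢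
    omega

theorem realElement_injective (G : SimpleGraph ℕ) : Function.Injective (realElement G) := by
  intro a b hab
  let k := a.unpair.1 + b.unpair.1 + 1
  rw [← realStageF_eq G (k := k) (a := a) (Or.inr (by omega)),
    ← realStageF_eq G (k := k) (a := b) (Or.inr (by omega))] at hab
  exact (isPresentation_realStageF G k).inj a b (Or.inr (by omega)) (Or.inr (by omega)) hab

theorem mem_range_realElement (G : SimpleGraph ℕ) {z : ℝ} (hz : z ∈ ⨆ k, realF G k) :
    z ∈ Set.range (realElement G) := by
  rw [Subfield.mem_iSup_of_directed (realF_mono G).directed_le] at hz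
  obtain ⟨k, hk⟩ := hz
  obtain ⟨a, ha, rfl⟩ := ((isPresentation_realStageF G k).mem_iff z).mp hk
  exact ⟨a, (realStageF_eq G ha).symm⟩

/-- The columns that are in use when the `n`-th column gets its elements. -/
def ColumnBefore (n c : ℕ) : Prop := if Even n then Even c ∧ c < n else Even c ∨ c < n

instance (n c : ℕ) : Decidable (ColumnBefore n c) := by
  unfold ColumnBefore
  infer_instance

/-- The first of the two elements adjoined in the `n`-th column. -/
noncomputable def genX (n : ℕ) : ℝ := if Even n then uR (n / 2 - 1) else xR (n / 2)

/-- The second of the two elements adjoined in the `n`-th column. -/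
noncomputable def genY (G : SimpleGraph ℕ) (n : ℕ) : ℝ :=
  if Even n then vR (n / 2 - 1) else yR G (n / 2)

/-- The presentation that is extended in the `n`-th column. -/
noncomputable def realBefore (G : SimpleGraph ℕ) (n a : ℕ) : ℝ :=
  if ColumnBefore n a.unpair.1 then realElement G a else 0

/-- The sequence from which the elements in the `n`-th column are selected. -/
noncomputable def columnSeq (G : SimpleGraph ℕ) (n : ℕ) : ℕ → ℝ :=
  if n = 0 then ratSeqR else extensionSeq (realBefore G n) (genX n) (genY G n)

/-- The elements named before the `n`-th column gets its elements. -/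
def namedBefore (G : SimpleGraph ℕ) (n : ℕ) : Set ℝ :=
  {z | ∃ a : ℕ, ColumnBefore n a.unpair.1 ∧ realElement G a = z}

theorem realStageK_eq_realBefore (G : SimpleGraph ℕ) (i : ℕ) :
    realStageK i = realBefore G (2 * i + 2) := by
  funext a
  have hiff : ColumnBefore (2 * i + 2) a.unpair.1 ↔ Even a.unpair.1 ∧ a.unpair.1 ≤ 2 * i := by
    rw [ColumnBefore, if_pos (by simp [Nat.even_iff])]
    simp only [Nat.even_iff]
    omega
  rw [realBefore]
  split_ifs with h
  · rw [hiff] at h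
    rw [realStageK_eq h.2, ← realStageF_eq G (k := 0) (Or.inl h.1), realStageF]
  · exact (isPresentation_realStageK i).eq_zero a fun h' => h (hiff.mpr h')

theorem realStageF_eq_realBefore (G : SimpleGraph ℕ) (k : ℕ) :
    realStageF G k = realBefore G (2 * k + 1) := by
  funext a
  have hiff : ColumnBefore (2 * k + 1) a.unpair.1 ↔ Even a.unpair.1 ∨ a.unpair.1 < 2 * k := by
    rw [ColumnBefore, if_neg (by simp)]
    simp only [Nat.even_iff]
    omega
  rw [realBefore]
  split_ifs with h
  · exact realStageF_eq G (hiff.mp h)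
  · exact (isPresentation_realStageF G k).eq_zero a fun h' => h (hiff.mpr h')

theorem exists_eq_column {n : ℕ} (hn : n ≠ 0) : (∃ i, n = 2 * i + 2) ∨ ∃ k, n = 2 * k + 1 := by
  rcases Nat.even_or_odd' n with ⟨i, h | h⟩
  · exact Or.inl ⟨i - 1, by omega⟩
  · exact Or.inr ⟨i, h⟩

theorem genX_even (i : ℕ) : genX (2 * i + 2) = uR i := by
  rw [genX, if_pos (by simp [Nat.even_iff]), show (2 * i + 2) / 2 - 1 = i by omega]

theorem genX_odd (k : ℕ) : genX (2 * k + 1) = xR k := by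
  rw [genX, if_neg (by simp), show (2 * k + 1) / 2 = k by omega]

theorem genY_even (G : SimpleGraph ℕ) (i : ℕ) : genY G (2 * i + 2) = vR i := by
  rw [genY, if_pos (by simp [Nat.even_iff]), show (2 * i + 2) / 2 - 1 = i by omega]

theorem genY_odd (G : SimpleGraph ℕ) (k : ℕ) : genY G (2 * k + 1) = yR G k := by
  rw [genY, if_neg (by simp), show (2 * k + 1) / 2 = k by omega]

/-- Treats even and odd columns uniformly, so that they need not be distinguished in the calculus.
-/
theorem exists_isPresentation_realBefore (G : SimpleGraph ℕ) {n : ℕ} (hn : n ≠ 0) :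
    ∃ k : Subfield ℝ, IsPresentation (realBefore G n) {c | ColumnBefore n c} k ∧
      IsQuarticExtension k (genX n) (genY G n) := by
  rcases exists_eq_column hn with ⟨i, rfl⟩ | ⟨i, rfl⟩
  · refine ⟨realK i, ?_, by rw [genX_even, genY_even]; exact isQuarticExtension_realK i⟩
    rw [← realStageK_eq_realBefore]
    convert isPresentation_realStageK i using 1
    ext c
    simp only [ColumnBefore, Set.mem_ofPred_eq, Nat.even_iff]
    split_ifs <;> omega
  · refine ⟨realF G i, ?_, by rw [genX_odd, genY_odd]; exact isQuarticExtension_realF G i⟩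
    rw [← realStageF_eq_realBefore]
    convert isPresentation_realStageF G i using 1
    ext c
    simp only [ColumnBefore, Set.mem_ofPred_eq, Nat.even_iff]
    split_ifs <;> omega

theorem namedBefore_zero (G : SimpleGraph ℕ) : namedBefore G 0 = ∅ := by
  ext z
  simp [namedBefore, ColumnBefore]

theorem namedBefore_eq_range (G : SimpleGraph ℕ) {n : ℕ} (hn : n ≠ 0) :
    namedBefore G n = Set.range (realBefore G n) := by
  obtain ⟨k, hk, -⟩ := exists_isPresentation_realBefore G hn
  ext z
  rw [hk.range_eq, SetLike.mem_coe, hk.mem_iff]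
  refine exists_congr fun a => and_congr_right fun ha => ?_
  rw [realBefore, if_pos ha]

/-- A recursion for the names that no longer mentions stages; the rule `eqNamed` formalizes it. -/
theorem realElement_pair (G : SimpleGraph ℕ) (n m : ℕ) :
    realElement G (Nat.pair n m) = enumNew (namedBefore G n) (columnSeq G n) m := by
  by_cases hn : n = 0
  · subst hn
    rw [namedBefore_zero, columnSeq, if_pos rfl]
    simp [realElement, realStageF, realStageK]
  · rw [namedBefore_eq_range G hn, columnSeq, if_neg hn]
    rcases exists_eq_column hn with ⟨i, rfl⟩ | ⟨k, rfl⟩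
    -- Column `2 i + 2` is filled at stage `i + 1` of `realStageK` and is already present in stage
    -- `0` of `realStageF`.
    · rw [← realStageK_eq_realBefore, genX_even, genY_even,
        ← realStageF_eq G (k := 0) (Or.inl (by simp [Nat.even_iff]))]
      change realStageK _ _ = _
      rw [← realStageK_eq (i := i + 1) (by rw [Nat.unpair_pair]; omega), realStageK, extendBy]
      simp
    · rw [← realStageF_eq_realBefore, genX_odd, genY_odd,
        ← realStageF_eq G (k := k + 1) (Or.inr (by simp; omega)), realStageF, extendBy]
      simp

theorem infinite_columnSeq (G : SimpleGraph ℕ) (n : ℕ) :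
    (Set.range (columnSeq G n) \ namedBefore G n).Infinite := by
  by_cases hn : n = 0
  · subst hn
    rw [namedBefore_zero, columnSeq, if_pos rfl]
    exact infinite_range_ratSeqR
  · obtain ⟨k, hk, hq⟩ := exists_isPresentation_realBefore G hn
    rw [namedBefore_eq_range G hn, columnSeq, if_neg hn]
    exact hk.infinite_new hq

end Naming

/-! ### Terms for elements of the field -/

/-! ### Closure properties of primitive recursive functions -/

section PrimrecLemmas

attribute [fun_prop] Primrec Primrec.id Primrec.const Primrec.comp Primrec.fst Primrec.snd
  Primrec.pair Primrec.cond

variable {α β γ : Type*} [Primcodable α] [Primcodable β] [Primcodable γ]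

@[fun_prop]
theorem Primrec.apply_fst {f : α → β × γ} (hf : Primrec f) : Primrec fun a => (f a).1 :=
  Primrec.fst.comp hf

@[fun_prop]
theorem Primrec.apply_snd {f : α → β × γ} (hf : Primrec f) : Primrec fun a => (f a).2 :=
  Primrec.snd.comp hf

@[fun_prop]
theorem Primrec.apply_cons {f : α → β} {g : α → List β} (hf : Primrec f) (hg : Primrec g) :
    Primrec fun a => f a :: g a := Primrec.list_cons.comp hf hg

@[fun_prop]
theorem Primrec.apply_getElem? {f : α → List β} {g : α → ℕ} (hf : Primrec f) (hg : Primrec g) :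
    Primrec fun a => (f a)[g a]? := Primrec.list_getElem?.comp hf hg

@[fun_prop]
theorem Primrec.apply_add {f g : α → ℕ} (hf : Primrec f) (hg : Primrec g) :
    Primrec fun a => f a + g a := Primrec.nat_add.comp hf hg

@[fun_prop]
theorem Primrec.apply_sub {f g : α → ℕ} (hf : Primrec f) (hg : Primrec g) :
    Primrec fun a => f a - g a := Primrec.nat_sub.comp hf hg

@[fun_prop]
theorem Primrec.apply_mul {f g : α → ℕ} (hf : Primrec f) (hg : Primrec g) :
    Primrec fun a => f a * g a := Primrec.nat_mul.comp hf hg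

@[fun_prop]
theorem Primrec.apply_div {f g : α → ℕ} (hf : Primrec f) (hg : Primrec g) :
    Primrec fun a => f a / g a := Primrec.nat_div.comp hf hg

@[fun_prop]
theorem Primrec.apply_mod {f g : α → ℕ} (hf : Primrec f) (hg : Primrec g) :
    Primrec fun a => f a % g a := Primrec.nat_mod.comp hf hg

@[fun_prop]
theorem Primrec.apply_natPair {f g : α → ℕ} (hf : Primrec f) (hg : Primrec g) :
    Primrec fun a => Nat.pair (f a) (g a) := Primrec₂.natPair.comp hf hg

@[fun_prop]
theorem Primrec.apply_natUnpair {f : α → ℕ} (hf : Primrec f) :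
    Primrec fun a => (f a).unpair := Primrec.unpair.comp hf

@[fun_prop]
theorem Primrec.decide_eq {f g : α → ℕ} (hf : Primrec f) (hg : Primrec g) :
    Primrec fun a => decide (f a = g a) :=
  PrimrecPred.decide (Primrec.eq.comp hf hg)

@[fun_prop]
theorem Primrec.decide_lt {f g : α → ℕ} (hf : Primrec f) (hg : Primrec g) :
    Primrec fun a => decide (f a < g a) :=
  PrimrecPred.decide (Primrec.nat_lt.comp hf hg)

@[fun_prop]
theorem Primrec.apply_and {f g : α → Bool} (hf : Primrec f) (hg : Primrec g) :
    Primrec fun a => f a && g a := Primrec.and.comp hf hg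

@[fun_prop]
theorem Primrec.apply_or {f g : α → Bool} (hf : Primrec f) (hg : Primrec g) :
    Primrec fun a => f a || g a := Primrec.or.comp hf hg

@[fun_prop]
theorem Primrec.apply_two_pow {f : α → ℕ} (hf : Primrec f) : Primrec fun a => 2 ^ f a := by
  have h : Primrec fun n : ℕ => 2 ^ n := by
    refine (Primrec.nat_rec₁ (f := fun _ r => 2 * r) 1 (Primrec.nat_double.comp
      Primrec.snd)).of_eq fun n => ?_
    induction n with
    | zero => rfl
    | succ n ih => rw [pow_succ', ← ih]
  exact h.comp hf

@[fun_prop]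
theorem Primrec.apply_factorial {f : α → ℕ} (hf : Primrec f) :
    Primrec fun a => (f a).factorial := by
  have h : Primrec fun n : ℕ => n.factorial := by
    refine (Primrec.nat_rec₁ (f := fun n r => (n + 1) * r) 1 (Primrec.nat_mul.comp
      (Primrec.succ.comp Primrec.fst) Primrec.snd)).of_eq fun n => ?_
    induction n with
    | zero => rfl
    | succ n ih => rw [Nat.factorial_succ, ← ih]
  exact h.comp hf

@[fun_prop]
theorem Primrec.apply_columnBefore {f g : α → ℕ} (hf : Primrec f) (hg : Primrec g) :
    Primrec fun a => decide (ColumnBefore (f a) (g a)) := by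
  have h : Primrec fun a => bif decide (f a % 2 = 0) then
      decide (g a % 2 = 0) && decide (g a < f a) else
      decide (g a % 2 = 0) || decide (g a < f a) := by fun_prop
  refine h.of_eq fun a => ?_
  simp only [ColumnBefore, Nat.even_iff]
  by_cases h1 : f a % 2 = 0 <;> simp [h1]

end PrimrecLemmas

/-- Terms for elements of the field. The partial recursive codes are used as a data type of binary
trees. -/
abbrev FieldTerm : Type := Nat.Partrec.Code

namespace FieldTerm

open Nat.Partrec (Code)

/-- The sum of two terms. -/
def add (a b : FieldTerm) : FieldTerm := Code.pair a b

/-- The product of two terms. -/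
def mul (a b : FieldTerm) : FieldTerm := Code.comp a b

/-- The inverse of a term. -/
def inv (a : FieldTerm) : FieldTerm := Code.rfind' a

/-- The constant `0`. -/
def zero : FieldTerm := Code.zero

/-- The constant `1`. -/
def one : FieldTerm := Code.succ

/-- The negative of a term. -/
def neg (a : FieldTerm) : FieldTerm := mul Code.left a

/-- The difference of two terms. -/
def sub (a b : FieldTerm) : FieldTerm := add a (neg b)

/-- The `i`-th constant of the `k`-th kind. -/
def leaf (k i : ℕ) : FieldTerm := Code.prec (Denumerable.ofNat Code k) (Denumerable.ofNat Code i)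

/-- The term for the generator `u_i`. -/
def u (i : ℕ) : FieldTerm := leaf 0 i

/-- The term for the generator `v_i`. -/
def v (i : ℕ) : FieldTerm := leaf 1 i

/-- The term for the generator `x` of the `k`-th curve. -/
def x (k : ℕ) : FieldTerm := leaf 2 k

/-- The term for the generator `y` of the `k`-th curve. -/
def y (k : ℕ) : FieldTerm := leaf 3 k

/-- The term for the parameter of the `k`-th curve. -/
def t (k : ℕ) : FieldTerm := leaf 4 k

/-- The term for the element with the name `a`. -/
def named (a : ℕ) : FieldTerm := leaf 5 a

/-- The term for a natural number. -/
def num (n : ℕ) : FieldTerm := leaf 6 n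

/-- The term for a partial sum of the `j`-th lacunary series. -/
def gap (k j : ℕ) : FieldTerm := leaf 7 (Nat.pair k j)

/-- The term for the `k`-th power of `1/2` in the lacunary series. -/
def gapStep (k : ℕ) : FieldTerm := inv (num (2 ^ (k + 4).factorial))

/-- The `k`-th term of the `j`-th lacunary series. -/
def gapTerm (k j : ℕ) : FieldTerm := bif decide (k.unpair.1 = j) then gapStep k else zero

/-- The square of a term. -/
def sq (a : FieldTerm) : FieldTerm := mul a a

/-- The polynomial `p(u,v)`. -/
def curveP (a b : FieldTerm) : FieldTerm :=
  sub (add (add (add (sq (sq a)) (mul (mul (num 16) a) (mul b (sq b))))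
    (mul (num 10) (sq (sq b)))) (mul (num 16) b)) (num 4)

/-- The polynomial `q(T,x,y)`. -/
def curveQ (c a b : FieldTerm) : FieldTerm :=
  add (add (add (sq (sq a)) (sq (sq b))) one)
    (mul c (add (add (add (sq (sq a)) (mul a (mul b (sq b)))) b) one))

/-- The term for the element with the name `a` if it is named before column `n`. -/
def before (n a : ℕ) : FieldTerm := bif decide (ColumnBefore n a.unpair.1) then named a else zero

/-- The first generator for column `n`. -/
def genX (n : ℕ) : FieldTerm := bif decide (n % 2 = 0) then u (n / 2 - 1) else x (n / 2)

/-- The second generator for column `n`. -/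
def genY (n : ℕ) : FieldTerm := bif decide (n % 2 = 0) then v (n / 2 - 1) else y (n / 2)

/-- The value at the first generator of the polynomial with the given names of coefficients. -/
def poly (n : ℕ) (l : List ℕ) : FieldTerm :=
  l.foldr (fun a r => add (before n a) (mul (genX n) r)) zero

/-- The `i`-th coefficient of the polynomial with the given names of coefficients. -/
def coeff (n : ℕ) (l : List ℕ) (i : ℕ) : FieldTerm := (l[i]?.map fun a => before n a).getD zero

/-- The value at the first generator of a rational function. -/
def frac (n : ℕ) (r : List ℕ × List ℕ) : FieldTerm := mul (poly n r.1) (inv (poly n r.2))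

/-- The terms of the standard sequence through the rational numbers. -/
def rat (c : ℕ) : FieldTerm :=
  mul (sub (num c.unpair.1.unpair.1) (num c.unpair.1.unpair.2)) (inv (num (c.unpair.2 + 1)))

/-- The terms of the sequence from which the elements in the `n`-th column are selected. -/
def columnSeq (n c : ℕ) : FieldTerm :=
  bif decide (n = 0) then rat c else bif decide (c = 0) then genX n else
    bif decide (c = 1) then genY n else
      add (add (add (frac n (codeAt (c - 2) 0)) (mul (frac n (codeAt (c - 2) 1)) (genY n)))
        (mul (frac n (codeAt (c - 2) 2)) (sq (genY n))))
        (mul (frac n (codeAt (c - 2) 3)) (mul (genY n) (sq (genY n))))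

/-! ### Primitive recursiveness of the term constructions -/

section Primrec

variable {α : Type*} [Primcodable α] {f g h : α → FieldTerm} {i j : α → ℕ}

@[fun_prop]
theorem primrec_add (hf : Primrec f) (hg : Primrec g) : Primrec fun a => add (f a) (g a) :=
  Code.primrec₂_pair.comp hf hg

@[fun_prop]
theorem primrec_mul (hf : Primrec f) (hg : Primrec g) : Primrec fun a => mul (f a) (g a) :=
  Code.primrec₂_comp.comp hf hg

@[fun_prop]
theorem primrec_inv (hf : Primrec f) : Primrec fun a => inv (f a) :=
  Code.primrec_rfind'.comp hf

@[fun_prop]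
theorem primrec_neg (hf : Primrec f) : Primrec fun a => neg (f a) := by
  unfold neg; fun_prop

@[fun_prop]
theorem primrec_sub (hf : Primrec f) (hg : Primrec g) : Primrec fun a => sub (f a) (g a) := by
  unfold sub; fun_prop

@[fun_prop]
theorem primrec_leaf (hi : Primrec i) (hj : Primrec j) : Primrec fun a => leaf (i a) (j a) :=
  Code.primrec₂_prec.comp ((Primrec.ofNat Code).comp hi) ((Primrec.ofNat Code).comp hj)

@[fun_prop]
theorem primrec_u (hi : Primrec i) : Primrec fun a => u (i a) := by unfold u; fun_prop

@[fun_prop]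
theorem primrec_v (hi : Primrec i) : Primrec fun a => v (i a) := by unfold v; fun_prop

@[fun_prop]
theorem primrec_x (hi : Primrec i) : Primrec fun a => x (i a) := by unfold x; fun_prop

@[fun_prop]
theorem primrec_y (hi : Primrec i) : Primrec fun a => y (i a) := by unfold y; fun_prop

@[fun_prop]
theorem primrec_t (hi : Primrec i) : Primrec fun a => t (i a) := by unfold t; fun_prop

@[fun_prop]
theorem primrec_named (hi : Primrec i) : Primrec fun a => named (i a) := by unfold named; fun_prop

@[fun_prop]
theorem primrec_num (hi : Primrec i) : Primrec fun a => num (i a) := by unfold num; fun_prop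

@[fun_prop]
theorem primrec_gap (hi : Primrec i) (hj : Primrec j) : Primrec fun a => gap (i a) (j a) := by
  unfold gap; fun_prop

@[fun_prop]
theorem primrec_gapStep (hi : Primrec i) : Primrec fun a => gapStep (i a) := by
  unfold gapStep; fun_prop

@[fun_prop]
theorem primrec_gapTerm (hi : Primrec i) (hj : Primrec j) :
    Primrec fun a => gapTerm (i a) (j a) := by
  have h : Primrec fun a => (i a).unpair.1 := by fun_prop
  exact Primrec.cond (Primrec.decide_eq h hj) (primrec_gapStep hi) (Primrec.const zero)

@[fun_prop]
theorem primrec_sq (hf : Primrec f) : Primrec fun a => sq (f a) := by unfold sq; fun_prop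

@[fun_prop]
theorem primrec_curveP (hf : Primrec f) (hg : Primrec g) :
    Primrec fun a => curveP (f a) (g a) := by
  unfold curveP; fun_prop

@[fun_prop]
theorem primrec_curveQ (hf : Primrec f) (hg : Primrec g) (hh : Primrec h) :
    Primrec fun a => curveQ (f a) (g a) (h a) := by
  unfold curveQ; fun_prop

@[fun_prop]
theorem primrec_before (hi : Primrec i) (hj : Primrec j) :
    Primrec fun a => before (i a) (j a) := by
  unfold before; fun_prop

@[fun_prop]
theorem primrec_genX (hi : Primrec i) : Primrec fun a => genX (i a) := by unfold genX; fun_prop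

@[fun_prop]
theorem primrec_genY (hi : Primrec i) : Primrec fun a => genY (i a) := by unfold genY; fun_prop

@[fun_prop]
theorem primrec_poly {l : α → List ℕ} (hi : Primrec i) (hl : Primrec l) :
    Primrec fun a => poly (i a) (l a) := by
  have : Primrec₂ fun (a : α) (b : ℕ × FieldTerm) =>
      add (before (i a) b.1) (mul (genX (i a)) b.2) := by
    unfold Primrec₂; fun_prop
  exact Primrec.list_foldr hl (Primrec.const zero) this

@[fun_prop]
theorem primrec_coeff {l : α → List ℕ} (hi : Primrec i) (hl : Primrec l) (hj : Primrec j) :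
    Primrec fun a => coeff (i a) (l a) (j a) := by
  refine Primrec.option_getD.comp (Primrec.option_map (by fun_prop) ?_) (Primrec.const zero)
  unfold Primrec₂; fun_prop

@[fun_prop]
theorem primrec_codeAt (hi : Primrec i) (m : Fin 4) : Primrec fun a => codeAt (i a) m := by
  have h : Primrec fun a => Denumerable.ofNat ((List ℕ × List ℕ) × (List ℕ × List ℕ) ×
      (List ℕ × List ℕ) × (List ℕ × List ℕ)) (i a) := (Primrec.ofNat _).comp hi
  fin_cases m
  · exact Primrec.fst.comp h
  · exact Primrec.fst.comp (Primrec.snd.comp h)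
  · exact Primrec.fst.comp (Primrec.snd.comp (Primrec.snd.comp h))
  · exact Primrec.snd.comp (Primrec.snd.comp (Primrec.snd.comp h))

@[fun_prop]
theorem primrec_frac {r : α → List ℕ × List ℕ} (hi : Primrec i) (hr : Primrec r) :
    Primrec fun a => frac (i a) (r a) := by
  unfold frac; fun_prop

@[fun_prop]
theorem primrec_rat (hi : Primrec i) : Primrec fun a => rat (i a) := by unfold rat; fun_prop

@[fun_prop]
theorem primrec_columnSeq (hi : Primrec i) (hj : Primrec j) :
    Primrec fun a => columnSeq (i a) (j a) := by
  unfold columnSeq; fun_prop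

end Primrec

/-! ### Values of terms -/

/-- The values of the constants. -/
noncomputable def leafValue (G : SimpleGraph ℕ) : ℕ → ℕ → ℝ
  | 0, i => uR i
  | 1, i => vR i
  | 2, k => xR k
  | 3, k => yR G k
  | 4, k => tR G k
  | 5, a => realElement G a
  | 6, n => n
  | 7, p => gapSum p.unpair.1 p.unpair.2
  | _, _ => 0

/-- The value of a term. -/
noncomputable def value (G : SimpleGraph ℕ) : FieldTerm → ℝ
  | Code.zero => 0
  | Code.succ => 1
  | Code.left => -1
  | Code.right => 0
  | Code.pair a b => value G a + value G b
  | Code.comp a b => value G a * value G b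
  | Code.prec a b => leafValue G (Encodable.encode a) (Encodable.encode b)
  | Code.rfind' a => (value G a)⁻¹

section Value

variable (G : SimpleGraph ℕ)

@[simp] theorem value_zero : value G zero = 0 := rfl

@[simp] theorem value_one : value G one = 1 := rfl

@[simp] theorem value_add (a b : FieldTerm) : value G (add a b) = value G a + value G b := rfl

@[simp] theorem value_mul (a b : FieldTerm) : value G (mul a b) = value G a * value G b := rfl

@[simp] theorem value_inv (a : FieldTerm) : value G (inv a) = (value G a)⁻¹ := rfl

@[simp] theorem value_neg (a : FieldTerm) : value G (neg a) = -value G a := neg_one_mul _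

@[simp] theorem value_sub (a b : FieldTerm) : value G (sub a b) = value G a - value G b := by
  rw [sub, value_add, value_neg, sub_eq_add_neg]

theorem value_leaf (k i : ℕ) : value G (leaf k i) = leafValue G k i := by
  simp only [leaf, value, Denumerable.encode_ofNat]

@[simp] theorem value_u (i : ℕ) : value G (u i) = uR i := value_leaf G _ _

@[simp] theorem value_v (i : ℕ) : value G (v i) = vR i := value_leaf G _ _

@[simp] theorem value_x (k : ℕ) : value G (x k) = xR k := value_leaf G _ _

@[simp] theorem value_y (k : ℕ) : value G (y k) = yR G k := value_leaf G _ _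

@[simp] theorem value_t (k : ℕ) : value G (t k) = tR G k := value_leaf G _ _

@[simp] theorem value_named (a : ℕ) : value G (named a) = realElement G a := value_leaf G _ _

@[simp] theorem value_num (n : ℕ) : value G (num n) = n := value_leaf G _ _

@[simp] theorem value_gap (k j : ℕ) : value G (gap k j) = gapSum k j := by
  rw [gap, value_leaf, leafValue, Nat.unpair_pair]

@[simp] theorem value_gapStep (k : ℕ) :
    value G (gapStep k) = (1 / 2) ^ (k + 4).factorial := by
  simp [gapStep]

@[simp] theorem value_gapTerm (k j : ℕ) : value G (gapTerm k j) = _root_.gapTerm j k := by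
  rw [gapTerm, _root_.gapTerm]
  by_cases h : k.unpair.1 = j <;> simp [h]

@[simp] theorem value_sq (a : FieldTerm) : value G (sq a) = value G a * value G a := rfl

@[simp] theorem value_curveP (a b : FieldTerm) :
    value G (curveP a b) = _root_.curveP (value G a) (value G b) := by
  simp only [curveP, value_sub, value_add, value_mul, value_sq, value_num, _root_.curveP]
  push_cast
  ring

@[simp] theorem value_curveQ (c a b : FieldTerm) :
    value G (curveQ c a b) = _root_.curveQ (value G c) (value G a) (value G b) := by
  simp only [curveQ, value_add, value_mul, value_sq, value_one, _root_.curveQ]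
  ring

@[simp] theorem value_before (n a : ℕ) : value G (before n a) = realBefore G n a := by
  rw [before, realBefore]
  by_cases h : ColumnBefore n a.unpair.1 <;> simp [h]

@[simp] theorem value_genX (n : ℕ) : value G (genX n) = _root_.genX n := by
  simp only [genX, _root_.genX, Nat.even_iff]
  by_cases h : n % 2 = 0 <;> simp [h]

@[simp] theorem value_genY (n : ℕ) : value G (genY n) = _root_.genY G n := by
  simp only [genY, _root_.genY, Nat.even_iff]
  by_cases h : n % 2 = 0 <;> simp [h]

@[simp] theorem value_poly (n : ℕ) (l : List ℕ) :
    value G (poly n l) = evalPoly (realBefore G n) (_root_.genX n) l := by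
  induction l with
  | nil => rfl
  | cons a l ih =>
    simp only [poly, evalPoly, List.foldr_cons, value_add, value_mul, value_before,
      value_genX] at ih ⊢
    rw [ih]

@[simp] theorem value_coeff (n : ℕ) (l : List ℕ) (i : ℕ) :
    value G (coeff n l i) = listCoeff (realBefore G n) l i := by
  rw [coeff, listCoeff, List.getD_eq_getElem?_getD, List.getElem?_map]
  cases l[i]? <;> simp

theorem value_columnSeq (n c : ℕ) : value G (columnSeq n c) = _root_.columnSeq G n c := by
  rw [columnSeq, _root_.columnSeq]
  by_cases hn : n = 0
  · simp [hn, rat, ratSeqR]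
  · match c with
    | 0 => simp [hn, extensionSeq]
    | 1 => simp [hn, extensionSeq]
    | c + 2 =>
      simp only [hn, decide_false, cond_false, if_false, extensionSeq_add_two, Fin.sum_univ_four,
        frac, value_add, value_mul, value_poly, value_inv, value_genY, value_sq, div_eq_mul_inv,
        show c + 2 ≠ 0 by omega, show c + 2 ≠ 1 by omega, Nat.add_sub_cancel]
      simp only [Fin.val_zero, Fin.val_one, Fin.val_two, show ((3 : Fin 4) : ℕ) = 3 from rfl]
      ring

end Value

end FieldTerm

/-! ### A calculus for the ordered field -/

theorem genX_notMem_namedBefore (G : SimpleGraph ℕ) {n : ℕ} (hn : n ≠ 0) :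
    genX n ∉ namedBefore G n := by
  obtain ⟨k, hk, hq⟩ := exists_isPresentation_realBefore G hn
  rw [namedBefore_eq_range G hn, hk.range_eq]
  simpa using IsPresentation.x_pow_notMem hq 0

theorem IsQuarticExtension.y_notMem {k : Subfield ℝ} {x y : ℝ} (h : IsQuarticExtension k x y) :
    y ∉ k := by
  intro hy
  have := h.indep ![-Polynomial.C ⟨y, hy⟩, 1, 0, 0] (by
    simp only [Fin.sum_univ_four, Matrix.cons_val_zero, Matrix.cons_val_one, Matrix.cons_val,
      map_neg, Polynomial.aeval_C, map_one, map_zero, Fin.val_zero, Fin.val_one, pow_zero]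
    rw [show algebraMap k ℝ ⟨y, hy⟩ = y from rfl]
    ring) 1
  simp at this

theorem genY_notMem_namedBefore (G : SimpleGraph ℕ) {n : ℕ} (hn : n ≠ 0) :
    genY G n ∉ namedBefore G n := by
  obtain ⟨k, hk, hq⟩ := exists_isPresentation_realBefore G hn
  rw [namedBefore_eq_range G hn, hk.range_eq]
  exact hq.y_notMem

/-- The shift by two skips the generators at the start of the sequence. The criterion refers only to
values of named coefficients, so its negation can be expressed by premises of rules. -/
theorem columnSeq_mem_namedBefore_iff (G : SimpleGraph ℕ) {n : ℕ} (hn : n ≠ 0) (c : ℕ) :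
    columnSeq G n (c + 2) ∈ namedBefore G n ↔
      (∀ j, j ≠ 0 → (∀ i, listCoeff (realBefore G n) (codeAt c j).1 i = 0) ∨
        ∀ i, listCoeff (realBefore G n) (codeAt c j).2 i = 0) ∧
      ∀ i i', listCoeff (realBefore G n) (codeAt c 0).1 i *
          listCoeff (realBefore G n) (codeAt c 0).2 i' =
        listCoeff (realBefore G n) (codeAt c 0).1 i' *
          listCoeff (realBefore G n) (codeAt c 0).2 i := by
  obtain ⟨k, hk, hq⟩ := exists_isPresentation_realBefore G hn
  choose P hP hPc using fun j => hk.exists_poly (genX n) (codeAt c j).1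
  choose Q hQ hQc using fun j => hk.exists_poly (genX n) (codeAt c j).2
  rw [namedBefore_eq_range G hn, hk.range_eq, columnSeq, if_neg hn, extensionSeq_add_two]
  simp only [← hP, ← hQ]
  rw [SetLike.mem_coe, hq.div_mem_iff]
  have h0 : ∀ (R : Polynomial k), R = 0 ↔ ∀ i, (R.coeff i : ℝ) = 0 := fun R => by
    rw [Polynomial.ext_iff]
    simp
  simp only [h0, ← hPc, ← hQc]
  norm_cast

/-- The assertions of the calculus. -/
abbrev FieldFact : Type := ℕ × ℕ × ℕ × ℕ × FieldTerm × FieldTerm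

namespace FieldFact

/-- The terms `a` and `b` have the same value. -/
def eq (a b : FieldTerm) : FieldFact := (0, 0, 0, 0, a, b)

/-- The value of `a` is positive. -/
def pos (a : FieldTerm) : FieldFact := (1, 0, 0, 0, a, a)

/-- The `c`-th term of the sequence for column `n` is not named before this column, and is not
among the first `d` terms. -/
def fresh (n c d : ℕ) : FieldFact := (2, n, c, d, FieldTerm.zero, FieldTerm.zero)

/-- The `c`-th term of the sequence for column `n` is skipped in the naming. -/
def old (n c : ℕ) : FieldFact := (3, n, c, 0, FieldTerm.zero, FieldTerm.zero)

/-- Among the first `c` terms of the sequence for column `n`, exactly `m` get names. -/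
def count (n c m : ℕ) : FieldFact := (4, n, c, m, FieldTerm.zero, FieldTerm.zero)

open Classical in
/-- The truth of an assertion. -/
def Holds (G : SimpleGraph ℕ) : FieldFact → Prop
  | (0, _, _, _, a, b) => a.value G = b.value G
  | (1, _, _, _, a, _) => 0 < a.value G
  | (2, n, c, d, _, _) => columnSeq G n c ∉ namedBefore G n ∧
      ∀ e < d, columnSeq G n e ≠ columnSeq G n c
  | (3, n, c, _, _, _) => ¬ IsNew (namedBefore G n) (columnSeq G n) c
  | (4, n, c, m, _, _) => Nat.count (IsNew (namedBefore G n) (columnSeq G n)) c = m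
  | _ => True

section Primrec

variable {α : Type*} [Primcodable α] {f g : α → FieldTerm} {i j k : α → ℕ}

@[fun_prop]
theorem primrec_eq (hf : Primrec f) (hg : Primrec g) : Primrec fun a => eq (f a) (g a) := by
  unfold eq; fun_prop

@[fun_prop]
theorem primrec_pos (hf : Primrec f) : Primrec fun a => pos (f a) := by unfold pos; fun_prop

@[fun_prop]
theorem primrec_fresh (hi : Primrec i) (hj : Primrec j) (hk : Primrec k) :
    Primrec fun a => fresh (i a) (j a) (k a) := by
  unfold fresh; fun_prop

@[fun_prop]
theorem primrec_old (hi : Primrec i) (hj : Primrec j) : Primrec fun a => old (i a) (j a) := by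
  unfold old; fun_prop

@[fun_prop]
theorem primrec_count (hi : Primrec i) (hj : Primrec j) (hk : Primrec k) :
    Primrec fun a => count (i a) (j a) (k a) := by
  unfold count; fun_prop

end Primrec

end FieldFact

/-- Rules with premises and a conclusion that depend on three terms and four numbers. -/
abbrev RuleScheme : Type :=
  FieldTerm → FieldTerm → FieldTerm → ℕ → ℕ → ℕ → ℕ → List FieldFact × FieldFact

namespace RuleScheme

open FieldTerm FieldFact

/-! #### Equality and the ring operations -/

def eqRefl : RuleScheme := fun a _ _ _ _ _ _ => ([], eq a a)
def eqSymm : RuleScheme := fun a b _ _ _ _ _ => ([eq a b], eq b a)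
def eqTrans : RuleScheme := fun a b c _ _ _ _ => ([eq a b, eq b c], eq a c)
def addCongr : RuleScheme := fun a b c _ _ _ _ => ([eq a b], eq (add a c) (add b c))
def mulCongr : RuleScheme := fun a b c _ _ _ _ => ([eq a b], eq (mul a c) (mul b c))
def invCongr : RuleScheme := fun a b _ _ _ _ _ => ([eq a b], eq (inv a) (inv b))
def addAssoc : RuleScheme := fun a b c _ _ _ _ => ([], eq (add (add a b) c) (add a (add b c)))
def addComm : RuleScheme := fun a b _ _ _ _ _ => ([], eq (add a b) (add b a))
def zeroAdd : RuleScheme := fun a _ _ _ _ _ _ => ([], eq (add zero a) a)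
def negAdd : RuleScheme := fun a _ _ _ _ _ _ => ([], eq (add (neg a) a) zero)
def mulAssoc : RuleScheme := fun a b c _ _ _ _ => ([], eq (mul (mul a b) c) (mul a (mul b c)))
def mulComm : RuleScheme := fun a b _ _ _ _ _ => ([], eq (mul a b) (mul b a))
def oneMul : RuleScheme := fun a _ _ _ _ _ _ => ([], eq (mul one a) a)
def zeroMul : RuleScheme := fun a _ _ _ _ _ _ => ([], eq (mul zero a) zero)
def mulAdd : RuleScheme := fun a b c _ _ _ _ =>
  ([], eq (mul a (add b c)) (add (mul a b) (mul a c)))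
-- Here and below, `a ≠ 0` is expressed by positivity of `a ^ 2`, as there are no negative facts.
def mulInv : RuleScheme := fun a _ _ _ _ _ _ => ([pos (sq a)], eq (mul a (inv a)) one)
def invZero : RuleScheme := fun _ _ _ _ _ _ _ => ([], eq (inv zero) zero)
def numZero : RuleScheme := fun _ _ _ _ _ _ _ => ([], eq (num 0) zero)
def numSucc : RuleScheme := fun _ _ _ n _ _ _ => ([], eq (num (n + 1)) (add (num n) one))

def ringRules : List RuleScheme :=
  [eqRefl, eqSymm, eqTrans, addCongr, mulCongr, invCongr, addAssoc, addComm, zeroAdd, negAdd,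
    mulAssoc, mulComm, oneMul, zeroMul, mulAdd, mulInv, invZero, numZero, numSucc]

/-! #### The ordering and the generators -/

def posOne : RuleScheme := fun _ _ _ _ _ _ _ => ([], pos one)
def posAdd : RuleScheme := fun a b _ _ _ _ _ => ([pos a, pos b], pos (add a b))
def posMul : RuleScheme := fun a b _ _ _ _ _ => ([pos a, pos b], pos (mul a b))
def posInv : RuleScheme := fun a _ _ _ _ _ _ => ([pos a], pos (inv a))
def posCongr : RuleScheme := fun a b _ _ _ _ _ => ([eq a b, pos a], pos b)
def eqCurveP : RuleScheme := fun _ _ _ i _ _ _ => ([], eq (curveP (u i) (v i)) zero)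
def eqCurveQ : RuleScheme := fun _ _ _ k _ _ _ => ([], eq (curveQ (t k) (x k) (y k)) zero)
def gapZero : RuleScheme := fun _ _ _ j _ _ _ => ([], eq (gap 0 j) zero)
def gapSucc : RuleScheme := fun _ _ _ k j _ _ =>
  ([], eq (gap (k + 1) j)
    (add (gap k j) (gapTerm k j)))
def ltU : RuleScheme := fun _ _ _ i k _ _ =>
  ([], pos (sub (u i) (add (num 2) (gap k (2 * i)))))
-- The tail of the series is at most `2` times the step; the factor `3` makes the bound strict.
def uLt : RuleScheme := fun _ _ _ i k _ _ =>
  ([], pos (sub (add (add (num 2) (gap k (2 * i))) (mul (num 3) (gapStep k))) (u i)))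
def ltX : RuleScheme := fun _ _ _ i k _ _ =>
  ([], pos (sub (x i) (add (num 1) (gap k (2 * i + 1)))))
def xLt : RuleScheme := fun _ _ _ i k _ _ =>
  ([], pos (sub (add (add (num 1) (gap k (2 * i + 1))) (mul (num 3) (gapStep k))) (x i)))
-- A point of `(-1, 0)` where `p(u_i, ·)` is negative lies below the root, by monotonicity.
def ltV : RuleScheme := fun a _ _ i _ _ _ =>
  ([pos (add a one), pos (neg a), pos (neg (curveP (u i) a))], pos (sub (v i) a))
def vLt : RuleScheme := fun a _ _ i _ _ _ =>
  ([pos (add a one), pos (neg a), pos (curveP (u i) a)], pos (sub a (v i)))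
def ltY : RuleScheme := fun a _ _ k _ _ _ =>
  ([pos (add a (num 2)), pos (neg a), pos (neg (curveQ (t k) (x k) a))], pos (sub (y k) a))
def yLt : RuleScheme := fun a _ _ k _ _ _ =>
  ([pos (add a (num 2)), pos (neg a), pos (curveQ (t k) (x k) a)], pos (sub a (y k)))

def orderRules : List RuleScheme :=
  [posOne, posAdd, posMul, posInv, posCongr, eqCurveP, eqCurveQ, gapZero, gapSucc, ltU, uLt, ltX,
    xLt, ltV, vLt, ltY, yLt]

/-! #### The names -/

def countZero : RuleScheme := fun _ _ _ n _ _ _ => ([], count n 0 0)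
def countFresh : RuleScheme := fun _ _ _ n c m _ =>
  ([count n c m, fresh n c c], count n (c + 1) (m + 1))
def countOld : RuleScheme := fun _ _ _ n c m _ => ([count n c m, old n c], count n (c + 1) m)
def eqNamed : RuleScheme := fun _ _ _ n c m _ =>
  ([count n c m, fresh n c c], eq (named (Nat.pair n m)) (columnSeq n c))
-- The side condition on columns is decidable; where it fails, the rule degenerates to a trivial
-- equation.
def oldNamed : RuleScheme := fun _ _ _ n c a _ =>
  bif decide (ColumnBefore n a.unpair.1) then ([eq (columnSeq n c) (named a)], old n c)
    else ([], eq zero zero)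
-- The index `c + d + 1` stands for an arbitrary index greater than `c`.
def oldRepeated : RuleScheme := fun _ _ _ n c d _ =>
  ([eq (columnSeq n (c + d + 1)) (columnSeq n c)], old n (c + d + 1))
def freshFirst : RuleScheme := fun _ _ _ n _ _ _ => ([], fresh (n + 1) 0 0)
def freshSecond : RuleScheme := fun _ _ _ n _ _ _ => ([], fresh (n + 1) 1 0)
-- Nothing is named before column `0`.
def freshRat : RuleScheme := fun _ _ _ c _ _ _ => ([], fresh 0 c 0)
-- For `j ≠ 0`, nonzero coefficients in numerator and denominator of the `j`-th component show that
-- the element is outside the smaller field. Only `j = 1, 2, 3` occur among the rules.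
def freshTerm (j : Fin 4) : RuleScheme := fun _ _ _ n c i i' =>
  ([pos (sq (coeff (n + 1) (codeAt c j).1 i)), pos (sq (coeff (n + 1) (codeAt c j).2 i'))],
    fresh (n + 1) (c + 2) 0)
-- A nonvanishing minor shows that the first component is not constant.
def freshConst : RuleScheme := fun _ _ _ n c i i' =>
  ([pos (sq (sub
      (mul (coeff (n + 1) (codeAt c 0).1 i) (coeff (n + 1) (codeAt c 0).2 i'))
      (mul (coeff (n + 1) (codeAt c 0).1 i') (coeff (n + 1) (codeAt c 0).2 i))))],
    fresh (n + 1) (c + 2) 0)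
def freshSucc : RuleScheme := fun _ _ _ n c d _ =>
  ([fresh n c d, pos (sq (sub (columnSeq n c) (columnSeq n d)))], fresh n c (d + 1))

def nameRules : List RuleScheme :=
  [countZero, countFresh, countOld, eqNamed, oldNamed, oldRepeated, freshFirst, freshSecond,
    freshRat, freshTerm 1, freshTerm 2, freshTerm 3, freshConst, freshSucc]

def rules : List RuleScheme := ringRules ++ (orderRules ++ nameRules)

/-- The arguments of a rule. -/
abbrev Args : Type := FieldTerm × FieldTerm × FieldTerm × ℕ × ℕ × ℕ × ℕ

/-- The rule as a function of all its arguments. -/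
def uncurry (r : RuleScheme) (p : Args) : List FieldFact × FieldFact :=
  r p.1 p.2.1 p.2.2.1 p.2.2.2.1 p.2.2.2.2.1 p.2.2.2.2.2.1 p.2.2.2.2.2.2

theorem primrec_uncurry_ringRules : ∀ r ∈ ringRules, Primrec (uncurry r) := by
  simp only [ringRules, List.forall_mem_cons, List.not_mem_nil, false_imp_iff, implies_true,
    and_true]
  unfold uncurry eqRefl eqSymm eqTrans addCongr mulCongr invCongr addAssoc addComm zeroAdd negAdd
    mulAssoc mulComm oneMul zeroMul mulAdd mulInv invZero numZero numSucc
  and_intros <;> fun_prop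

theorem primrec_uncurry_orderRules : ∀ r ∈ orderRules, Primrec (uncurry r) := by
  simp only [orderRules, List.forall_mem_cons, List.not_mem_nil, false_imp_iff, implies_true,
    and_true]
  unfold uncurry posOne posAdd posMul posInv posCongr eqCurveP eqCurveQ gapZero gapSucc ltU uLt
    ltX xLt ltV vLt ltY yLt
  and_intros <;> fun_prop

theorem primrec_uncurry_nameRules : ∀ r ∈ nameRules, Primrec (uncurry r) := by
  simp only [nameRules, List.forall_mem_cons, List.not_mem_nil, false_imp_iff, implies_true,
    and_true]
  unfold uncurry countZero countFresh countOld eqNamed oldNamed oldRepeated freshFirst freshSecond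
    freshRat freshTerm freshConst freshSucc
  and_intros <;> fun_prop

theorem primrec_uncurry : ∀ r ∈ rules, Primrec (uncurry r) :=
  List.forall_mem_append.mpr ⟨primrec_uncurry_ringRules, List.forall_mem_append.mpr
    ⟨primrec_uncurry_orderRules, primrec_uncurry_nameRules⟩⟩

end RuleScheme

/-! ### Soundness of the rules -/

section Soundness

open FieldTerm FieldFact

namespace FieldFact

variable {G : SimpleGraph ℕ}

theorem holds_eq {a b : FieldTerm} : Holds G (eq a b) ↔ a.value G = b.value G := Iff.rfl

theorem holds_pos {a : FieldTerm} : Holds G (pos a) ↔ 0 < a.value G := Iff.rfl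

theorem holds_fresh {n c d : ℕ} : Holds G (fresh n c d) ↔
    _root_.columnSeq G n c ∉ namedBefore G n ∧
      ∀ e < d, _root_.columnSeq G n e ≠ _root_.columnSeq G n c := Iff.rfl

theorem holds_old {n c : ℕ} : Holds G (old n c) ↔
    ¬ IsNew (namedBefore G n) (_root_.columnSeq G n) c := Iff.rfl

open Classical in
theorem holds_count {n c m : ℕ} : Holds G (count n c m) ↔
    Nat.count (IsNew (namedBefore G n) (_root_.columnSeq G n)) c = m := Iff.rfl

end FieldFact

namespace RuleScheme

/-- The conclusion of the rule is true if its premises are. -/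
def Sound (G : SimpleGraph ℕ) (r : RuleScheme) : Prop := ∀ a b c i j k l,
  (∀ f ∈ (r a b c i j k l).1, f.Holds G) → (r a b c i j k l).2.Holds G

variable (G : SimpleGraph ℕ)

theorem sound_ringRules : ∀ r ∈ ringRules, r.Sound G := by
  simp only [ringRules, List.forall_mem_cons, List.not_mem_nil, false_imp_iff, implies_true,
    and_true, true_and, forall_const, Sound,
    eqRefl, eqSymm, eqTrans, addCongr, mulCongr, invCongr, addAssoc, addComm,
    zeroAdd, negAdd, mulAssoc, mulComm, oneMul, zeroMul, mulAdd, mulInv, invZero, numZero, numSucc,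
    holds_eq, holds_pos, value_add, value_mul, value_neg, value_inv, value_zero, value_one, value_num,
    value_sq, Nat.cast_zero, Nat.cast_succ]
  refine ⟨fun a b h => h.symm, fun a b c h => h.1.trans h.2,
    fun a b c h => by rw [h], fun a b c h => by rw [h], fun a b h => by rw [h],
    fun a b c => by ring, fun a b => by ring, fun a => by ring, fun a => by ring,
    fun a b c => by ring, fun a b => by ring, fun a => by ring, fun a => by ring, fun a b c => by ring,
    fun a h => mul_inv_cancel₀ (fun h0 => by simp [h0] at h), inv_zero⟩

/-- For the bounds on `v` and `y`: a point on the wrong side of the root, or the root itself, would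
give `p` or `q` the wrong sign. -/
theorem sound_orderRules : ∀ r ∈ orderRules, r.Sound G := by
  have hgap : ∀ k j, gapNum j < gapSum k j + 3 * (1 / 2) ^ (k + 4).factorial := fun k j => by
    have h1 := gapNum_sub_gapSum_le k j
    have h2 : (0 : ℝ) < (1 / 2) ^ (k + 4).factorial := by positivity
    linarith
  have hV : ∀ i, ∀ a : ℝ, 0 < a + 1 → 0 < -a → 0 < -_root_.curveP (uR i) a → 0 < vR i - a := by
    intro i a h1 h2 h3
    have h0 := vR_mem i
    by_contra h4
    rcases (sub_nonpos.mp (not_lt.mp h4)).eq_or_lt with h5 | h5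
    · rw [← h5, curveP_uR_vR] at h3; simp at h3
    · have := curveP_lt_curveP (two_lt_uR i) h0.1 h5 (by linarith)
      rw [curveP_uR_vR] at this
      linarith
  have hV' : ∀ i, ∀ a : ℝ, 0 < a + 1 → 0 < -a → 0 < _root_.curveP (uR i) a → 0 < a - vR i := by
    intro i a h1 h2 h3
    have h0 := vR_mem i
    by_contra h4
    rcases (sub_nonpos.mp (not_lt.mp h4)).eq_or_lt with h5 | h5
    · rw [h5, curveP_uR_vR] at h3; simp at h3
    · have := curveP_lt_curveP (two_lt_uR i) (by linarith) h5 h0.2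
      rw [curveP_uR_vR] at this
      linarith
  have hY : ∀ k, ∀ a : ℝ, 0 < a + 2 → 0 < -a → 0 < -_root_.curveQ (tR G k) (xR k) a →
      0 < yR G k - a := by
    intro k a h1 h2 h3
    have h0 := yR_mem G k
    by_contra h4
    rcases (sub_nonpos.mp (not_lt.mp h4)).eq_or_lt with h5 | h5
    · rw [← h5, curveQ_tR_xR_yR] at h3; simp at h3
    · have := curveQ_lt_curveQ (four_lt_tR G k) (one_lt_xR k) h0.1 h5 (by linarith)
      rw [curveQ_tR_xR_yR] at this
      linarith
  have hY' : ∀ k, ∀ a : ℝ, 0 < a + 2 → 0 < -a → 0 < _root_.curveQ (tR G k) (xR k) a →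
      0 < a - yR G k := by
    intro k a h1 h2 h3
    have h0 := yR_mem G k
    by_contra h4
    rcases (sub_nonpos.mp (not_lt.mp h4)).eq_or_lt with h5 | h5
    · rw [h5, curveQ_tR_xR_yR] at h3; simp at h3
    · have := curveQ_lt_curveQ (four_lt_tR G k) (one_lt_xR k) (by linarith) h5 h0.2
      rw [curveQ_tR_xR_yR] at this
      linarith
  simp only [orderRules, List.forall_mem_cons, List.not_mem_nil, false_imp_iff, implies_true,
    and_true, true_and, forall_const, Sound,
    posOne, posAdd, posMul, posInv, posCongr, eqCurveP, eqCurveQ, gapZero,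
    gapSucc, ltU, uLt, ltX, xLt, ltV, vLt, ltY, yLt, holds_eq,
    holds_pos, value_add, value_mul, value_neg, value_inv, value_zero, value_one, value_num,
    value_sub, value_curveP, value_curveQ, value_u, value_v, value_x, value_y, value_t,
    value_gap, value_gapStep, value_gapTerm, curveP_uR_vR, curveQ_tR_xR_yR, Nat.cast_ofNat,
    Nat.cast_one, and_imp]
  refine ⟨zero_lt_one, fun a b h h' => add_pos h h', fun a b h h' => mul_pos h h',
    fun a h => inv_pos.mpr h, fun a b h h' => h ▸ h', fun i => by simp [gapSum],
    fun k j => Finset.sum_range_succ _ _, fun i k => ?_, fun i k => ?_, fun i k => ?_,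
    fun i k => ?_, fun a i => hV i _, fun a i => hV' i _, fun a k => hY k _, fun a k => hY' k _⟩
  · have := gapSum_lt_gapNum k (2 * i)
    rw [uR]; push_cast; linarith
  · have := hgap k (2 * i)
    rw [uR]; push_cast; linarith
  · have := gapSum_lt_gapNum k (2 * i + 1)
    rw [xR]; push_cast; linarith
  · have := hgap k (2 * i + 1)
    rw [xR]; push_cast; linarith

theorem sound_nameRules : ∀ r ∈ nameRules, r.Sound G := by
  classical
  have hcoeff : ∀ n c (j : Fin 4), j ≠ 0 → ∀ i i',
      0 < listCoeff (realBefore G (n + 1)) (codeAt c j).1 i *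
        listCoeff (realBefore G (n + 1)) (codeAt c j).1 i →
      0 < listCoeff (realBefore G (n + 1)) (codeAt c j).2 i' *
        listCoeff (realBefore G (n + 1)) (codeAt c j).2 i' →
      _root_.columnSeq G (n + 1) (c + 2) ∉ namedBefore G (n + 1) := by
    intro n c j hj i i' h1 h2 h
    rcases ((columnSeq_mem_namedBefore_iff G n.succ_ne_zero c).mp h).1 j hj with h3 | h3
    · simp [h3] at h1
    · simp [h3] at h2
  simp only [nameRules, List.forall_mem_cons, List.not_mem_nil, false_imp_iff, implies_true,
    and_true, true_and, forall_const, Sound,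
    countZero, countFresh, countOld, eqNamed, oldRepeated, freshFirst,
    freshSecond, freshRat, freshTerm, freshConst, freshSucc, holds_eq, holds_pos, holds_fresh,
    holds_old, holds_count, value_mul, value_sub, value_sq, value_coeff, value_named,
    value_columnSeq, and_imp, Nat.not_lt_zero, Nat.count_zero]
  refine ⟨fun n c m h1 h2 h3 => ?_, fun n c m h1 h2 => ?_, fun n c m h1 h2 h3 => ?_, ?_,
    fun n c d h1 h2 => h2.2 c (by omega) h1.symm, fun n => ?_, fun n => ?_, fun c => ?_,
    fun n c i i' => hcoeff n c 1 (by decide) i i', fun n c i i' => hcoeff n c 2 (by decide) i i',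
    fun n c i i' => hcoeff n c 3 (by decide) i i', fun n c i i' h1 h2 => ?_,
    fun n c d h1 h2 h3 => ⟨h1, fun e he => ?_⟩⟩
  · rw [Nat.count_succ, if_pos ⟨h2, h3⟩, h1]
  · rw [Nat.count_succ, if_neg h2, h1, add_zero]
  · rw [realElement_pair, enumNew_eq, ← h1, Nat.nth_count ⟨h2, h3⟩]
  · intro a b c i j k l h
    unfold oldNamed at h ⊢
    by_cases hcol : ColumnBefore i k.unpair.1
    · simp only [hcol, decide_true, cond_true, List.forall_mem_cons, List.not_mem_nil,
        false_imp_iff, implies_true, and_true, holds_eq, value_columnSeq, value_named,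
        holds_old] at h ⊢
      exact fun h' => h'.1 ⟨k, hcol, h.symm⟩
    · simp only [hcol, decide_false, cond_false, holds_eq]
  · rw [_root_.columnSeq, if_neg n.succ_ne_zero]
    exact genX_notMem_namedBefore G n.succ_ne_zero
  · rw [_root_.columnSeq, if_neg n.succ_ne_zero]
    exact genY_notMem_namedBefore G n.succ_ne_zero
  · rw [namedBefore_zero]
    exact Set.notMem_empty _
  · rw [((columnSeq_mem_namedBefore_iff G n.succ_ne_zero c).mp h2).2 i i'] at h1
    simp at h1
  · rcases Nat.lt_succ_iff_lt_or_eq.mp he with he | rfl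
    · exact h2 e he
    · intro h4
      simp [h4] at h3

theorem sound : ∀ r ∈ rules, r.Sound G :=
  List.forall_mem_append.mpr ⟨sound_ringRules G, List.forall_mem_append.mpr
    ⟨sound_orderRules G, sound_nameRules G⟩⟩

end RuleScheme

end Soundness

/-! ### Derivations from finitely many edges -/

section Derivations

open FieldTerm FieldFact RuleScheme

/-- The steps of derivations, where `L` is an initial segment of the characteristic function of
the edge relation. -/
def Step (L : List ℕ) (l : List FieldFact) (f : FieldFact) : Prop :=
  (∃ r ∈ rules, ∃ p : Args, r.uncurry p = (l, f)) ∨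
  (∃ k, L[Nat.pair (pairAt k).1.1 (pairAt k).1.2]? = some 1 ∧
    ([], eq (t k) (mul (u (pairAt k).1.1) (u (pairAt k).1.2))) = (l, f)) ∨
  ∃ k, L[Nat.pair (pairAt k).1.1 (pairAt k).1.2]? = some 0 ∧
    ([], eq (t k) (add (u (pairAt k).1.1) (u (pairAt k).1.2))) = (l, f)

theorem primrec_pairAt : Primrec fun k => (pairAt k).1 := by
  have h : Primrec₂ fun (_ : ℕ) (p : ℕ × ℕ) =>
      bif decide (p.2 + 1 < p.1) then (p.1, p.2 + 1) else (p.1 + 1, 0) := by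
    unfold Primrec₂; fun_prop
  refine (Primrec.nat_rec₁ (1, 0) h).of_eq fun k => ?_
  induction k with
  | zero => rfl
  | succ k ih =>
    simp only [ih]
    by_cases hk : (pairAt k).1.2 + 1 < (pairAt k).1.1
    · rw [pairAt_succ_of_lt hk]; simp [hk]
    · rw [pairAt_succ_of_not_lt hk]; simp [hk]

@[fun_prop]
theorem Primrec.apply_pairAt {α : Type*} [Primcodable α] {f : α → ℕ} (hf : Primrec f) :
    Primrec fun a => (pairAt (f a)).1 := primrec_pairAt.comp hf

theorem isSigmaOne_step : IsSigmaOne fun z : List ℕ × List FieldFact × FieldFact =>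
    Step z.1 z.2.1 z.2.2 := by
  refine IsSigmaOne.or ?_ (IsSigmaOne.or ?_ ?_)
  · have h : ∀ R : List RuleScheme, (∀ r ∈ R, Primrec (uncurry r)) →
        IsSigmaOne fun z : List ℕ × List FieldFact × FieldFact =>
          ∃ r ∈ R, ∃ p : Args, r.uncurry p = (z.2.1, z.2.2) := by
      intro R hR
      induction R with
      | nil => exact ⟨fun _ _ => false, Primrec.const false, by simp⟩
      | cons r R ih =>
        rw [List.forall_mem_cons] at hR
        simp only [List.exists_mem_cons_iff]
        refine IsSigmaOne.or (IsSigmaOne.of_exists (β := Args)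
          (R := fun z p => r.uncurry p = (z.2.1, z.2.2)) ?_ fun z => Iff.rfl) (ih hR.2)
        exact Primrec.eq.comp (hR.1.comp Primrec.snd) (by fun_prop)
    exact h rules primrec_uncurry
  · refine IsSigmaOne.of_exists (β := ℕ) (R := fun z k =>
      z.1[Nat.pair (pairAt k).1.1 (pairAt k).1.2]? = some 1 ∧
        ([], eq (t k) (mul (u (pairAt k).1.1) (u (pairAt k).1.2))) = (z.2.1, z.2.2))
      (PrimrecPred.and (Primrec.eq.comp ?_ (Primrec.const (some 1))) (Primrec.eq.comp ?_ ?_))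
      fun z => Iff.rfl
    all_goals fun_prop
  · refine IsSigmaOne.of_exists (β := ℕ) (R := fun z k =>
      z.1[Nat.pair (pairAt k).1.1 (pairAt k).1.2]? = some 0 ∧
        ([], eq (t k) (add (u (pairAt k).1.1) (u (pairAt k).1.2))) = (z.2.1, z.2.2))
      (PrimrecPred.and (Primrec.eq.comp ?_ (Primrec.const (some 0))) (Primrec.eq.comp ?_ ?_))
      fun z => Iff.rfl
    all_goals fun_prop

open Classical in
/-- The characteristic function of the edge relation. -/
noncomputable def edgeChar (G : SimpleGraph ℕ) (n : ℕ) : ℕ :=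
  if G.Adj n.unpair.1 n.unpair.2 then 1 else 0

theorem initialSegment_getElem? {χ : ℕ → ℕ} {N n : ℕ} :
    (initialSegment χ N)[n]? = if n < N then some (χ n) else none := by
  by_cases h : n < N
  · simp [initialSegment, h]
  · simp [initialSegment, h]

theorem Step.holds {G : SimpleGraph ℕ} {N : ℕ} {l : List FieldFact} {f : FieldFact}
    (h : Step (initialSegment (edgeChar G) N) l f) (hl : ∀ g ∈ l, g.Holds G) : f.Holds G := by
  rcases h with ⟨r, hr, p, hp⟩ | ⟨k, hk, hp⟩ | ⟨k, hk, hp⟩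
  · have := RuleScheme.sound G r hr p.1 p.2.1 p.2.2.1 p.2.2.2.1 p.2.2.2.2.1 p.2.2.2.2.2.1
      p.2.2.2.2.2.2
    change (∀ f ∈ (r.uncurry p).1, f.Holds G) → (r.uncurry p).2.Holds G at this
    rw [hp] at this
    exact this hl
  all_goals
    rw [Prod.mk.injEq] at hp
    rw [← hp.2, holds_eq]
    rw [initialSegment_getElem?] at hk
    split_ifs at hk
    simp only [edgeChar, Nat.unpair_pair, Option.some.injEq, ite_eq_left_iff, ite_eq_right_iff,
      zero_ne_one, one_ne_zero, imp_false, not_not] at hk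
    simp [tR, hk]

theorem Derivable.holds {G : SimpleGraph ℕ} {N : ℕ} {f : FieldFact}
    (h : Derivable Step (initialSegment (edgeChar G) N) f) : f.Holds G := by
  induction h with
  | intro l a h _ ih => exact h.holds ih

/-- The facts that are derivable from information on finitely many edges. -/
def Provable (G : SimpleGraph ℕ) (f : FieldFact) : Prop :=
  ∃ N, Derivable Step (initialSegment (edgeChar G) N) f

theorem Step.mono {χ : ℕ → ℕ} {M N : ℕ} (hMN : M ≤ N) {l : List FieldFact} {f : FieldFact}
    (h : Step (initialSegment χ M) l f) : Step (initialSegment χ N) l f := by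
  have hL : ∀ n m : ℕ, (initialSegment χ M)[n]? = some m → (initialSegment χ N)[n]? = some m := by
    intro n m
    rw [initialSegment_getElem?, initialSegment_getElem?]
    split_ifs with h1 h2
    · exact id
    · omega
    · simp
    · simp
  exact h.imp_right (Or.imp (fun ⟨k, hk, hp⟩ => ⟨k, hL _ _ hk, hp⟩)
    fun ⟨k, hk, hp⟩ => ⟨k, hL _ _ hk, hp⟩)

theorem Derivable.mono {χ : ℕ → ℕ} {M N : ℕ} (hMN : M ≤ N) {f : FieldFact}
    (h : Derivable Step (initialSegment χ M) f) : Derivable Step (initialSegment χ N) f := by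
  induction h with
  | intro l a h _ ih => exact .intro l a (h.mono hMN) ih

namespace Provable

variable {G : SimpleGraph ℕ}

theorem holds {f : FieldFact} (h : Provable G f) : f.Holds G := h.choose_spec.holds

/-- The finitely many premises have derivations over a common initial segment. -/
theorem of_step {l : List FieldFact} {f : FieldFact} {M : ℕ}
    (h : Step (initialSegment (edgeChar G) M) l f) (hl : ∀ g ∈ l, Provable G g) :
    Provable G f := by
  obtain ⟨N, hN⟩ : ∃ N, ∀ g ∈ l, Derivable Step (initialSegment (edgeChar G) N) g := by
    clear h
    induction l with
    | nil => exact ⟨0, by simp⟩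
    | cons g l ih =>
      rw [List.forall_mem_cons] at hl
      obtain ⟨A, hA⟩ := hl.1
      obtain ⟨B, hB⟩ := ih hl.2
      exact ⟨max A B, List.forall_mem_cons.mpr
        ⟨hA.mono (le_max_left _ _), fun g hg => (hB g hg).mono (le_max_right _ _)⟩⟩
  exact ⟨max M N, .intro l f (h.mono (le_max_left _ _))
    fun g hg => (hN g hg).mono (le_max_right _ _)⟩

theorem of_rule {r : RuleScheme} (hr : r ∈ rules) (a b c : FieldTerm) (i j k l : ℕ)
    (h : ∀ f ∈ (r a b c i j k l).1, Provable G f) : Provable G (r a b c i j k l).2 :=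
  of_step (M := 0) (Or.inl ⟨r, hr, (a, b, c, i, j, k, l), rfl⟩) h

/-- The only place where completeness consults the graph: one entry of the initial segment settles
the parameter. -/
theorem eq_t (k : ℕ) : Provable G (eq (t k) (mul (u (pairAt k).1.1) (u (pairAt k).1.2))) ∨
    Provable G (eq (t k) (add (u (pairAt k).1.1) (u (pairAt k).1.2))) := by
  have hL : (initialSegment (edgeChar G) (Nat.pair (pairAt k).1.1 (pairAt k).1.2 + 1))[
      Nat.pair (pairAt k).1.1 (pairAt k).1.2]? =
        some (edgeChar G (Nat.pair (pairAt k).1.1 (pairAt k).1.2)) := by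
    rw [initialSegment_getElem?, if_pos (Nat.lt_succ_self _)]
  by_cases h : G.Adj (pairAt k).1.1 (pairAt k).1.2
  · exact Or.inl (of_step (Or.inr (Or.inl ⟨k, hL.trans (by simp [edgeChar, h]), rfl⟩)) (by simp))
  · exact Or.inr (of_step (Or.inr (Or.inr ⟨k, hL.trans (by simp [edgeChar, h]), rfl⟩)) (by simp))

end Provable

end Derivations

/-! ### Elements determined by rational bounds -/

section Cone

variable {A : Type*} [CommRing A] [Algebra ℚ A]

/-- `P` is a set of positive elements closed under addition and multiplication. -/
structure IsPositiveCone (φ : A →+* ℝ) (P : Set A) : Prop where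
  add_mem : ∀ {a b}, a ∈ P → b ∈ P → a + b ∈ P
  mul_mem : ∀ {a b}, a ∈ P → b ∈ P → a * b ∈ P
  rat_mem : ∀ r : ℚ, 0 < r → algebraMap ℚ A r ∈ P
  map_pos : ∀ {a}, a ∈ P → 0 < φ a

/-- All rational bounds of `φ z` come from the set `P` of positive elements. -/
def IsBounded (φ : A →+* ℝ) (P : Set A) (z : A) : Prop :=
  (∀ r : ℚ, (r : ℝ) < φ z → z - algebraMap ℚ A r ∈ P) ∧
    ∀ r : ℚ, φ z < r → algebraMap ℚ A r - z ∈ P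

variable {φ : A →+* ℝ} {P : Set A}

theorem map_algebraMap_rat (φ : A →+* ℝ) (r : ℚ) : φ (algebraMap ℚ A r) = r :=
  eq_ratCast (φ.comp (algebraMap ℚ A)) r

namespace IsBounded

theorem mem_of_pos {z : A} (hz : IsBounded φ P z) (h : 0 < φ z) : z ∈ P := by
  simpa using hz.1 0 (by simpa using h)

theorem rat (hP : IsPositiveCone φ P) (q : ℚ) : IsBounded φ P (algebraMap ℚ A q) := by
  rw [IsBounded, map_algebraMap_rat]
  refine ⟨fun r hr => ?_, fun r hr => ?_⟩ <;> rw [← map_sub] <;>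
    exact hP.rat_mem _ (sub_pos.mpr (by exact_mod_cast hr))

theorem neg {z : A} (hz : IsBounded φ P z) : IsBounded φ P (-z) := by
  rw [IsBounded, map_neg]
  refine ⟨fun r hr => ?_, fun r hr => ?_⟩
  · have := hz.2 (-r) (by push_cast; linarith)
    rwa [map_neg, show -algebraMap ℚ A r - z = -z - algebraMap ℚ A r by ring] at this
  · have := hz.1 (-r) (by push_cast; linarith)
    rwa [map_neg, show z - -algebraMap ℚ A r = algebraMap ℚ A r - -z by ring] at this

/-- Upper bounds of `z` are lower bounds of `-z`, so lower bounds suffice in statements that are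
stable under negation. -/
theorem of_lower (z : A) (h : ∀ r : ℚ, (r : ℝ) < φ z → z - algebraMap ℚ A r ∈ P)
    (h' : ∀ r : ℚ, (r : ℝ) < φ (-z) → -z - algebraMap ℚ A r ∈ P) : IsBounded φ P z := by
  refine ⟨h, fun r hr => ?_⟩
  have := h' (-r) (by push_cast; rw [map_neg]; linarith)
  rwa [map_neg, show -z - -algebraMap ℚ A r = algebraMap ℚ A r - z by ring] at this

theorem add (hP : IsPositiveCone φ P) {z w : A} (hz : IsBounded φ P z) (hw : IsBounded φ P w) :
    IsBounded φ P (z + w) := by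
  have H : ∀ {z w : A}, IsBounded φ P z → IsBounded φ P w → ∀ r : ℚ, (r : ℝ) < φ (z + w) →
      z + w - algebraMap ℚ A r ∈ P := by
    intro z w hz hw r hr
    rw [map_add] at hr
    obtain ⟨s, hs1, hs2⟩ := exists_rat_btwn (show (r : ℝ) - φ w < φ z by linarith)
    have := hP.add_mem (hz.1 s hs2) (hw.1 (r - s) (by push_cast; linarith))
    rwa [map_sub, show z - algebraMap ℚ A s + (w - (algebraMap ℚ A r - algebraMap ℚ A s)) =
      z + w - algebraMap ℚ A r by ring] at this
  refine of_lower _ (H hz hw) fun r hr => ?_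
  rw [neg_add] at hr ⊢
  exact H hz.neg hw.neg r hr

theorem rat_mul (hP : IsPositiveCone φ P) (q : ℚ) {z : A} (hz : IsBounded φ P z) :
    IsBounded φ P (algebraMap ℚ A q * z) := by
  have H : ∀ {z : A}, IsBounded φ P z → ∀ q : ℚ, 0 < q → ∀ r : ℚ,
      (r : ℝ) < φ (algebraMap ℚ A q * z) → algebraMap ℚ A q * z - algebraMap ℚ A r ∈ P := by
    intro z hz q hq r hr
    have hq' : (0 : ℝ) < q := by exact_mod_cast hq
    rw [map_mul, map_algebraMap_rat] at hr
    have h1 := hP.mul_mem (hP.rat_mem q hq) (hz.1 (r / q) (by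
      push_cast
      rw [div_lt_iff₀ hq']
      linarith))
    rwa [mul_sub, ← map_mul, mul_div_cancel₀ _ hq.ne'] at h1
  have hpos : ∀ {z : A}, IsBounded φ P z → ∀ q : ℚ, 0 < q →
      IsBounded φ P (algebraMap ℚ A q * z) := fun {z} hz q hq => by
    refine of_lower _ (H hz q hq) fun r hr => ?_
    rw [← mul_neg] at hr ⊢
    exact H hz.neg q hq r hr
  rcases lt_trichotomy q 0 with hq | rfl | hq
  · have := (hpos hz (-q) (neg_pos.mpr hq)).neg
    rwa [map_neg, neg_mul, neg_neg] at this
  · simpa using rat hP 0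
  · exact hpos hz q hq

theorem mul (hP : IsPositiveCone φ P) {z w : A} (hz : IsBounded φ P z) (hw : IsBounded φ P w) :
    IsBounded φ P (z * w) := by
  have H : ∀ {z w : A}, IsBounded φ P z → IsBounded φ P w → ∀ r : ℚ, (r : ℝ) < φ (z * w) →
      z * w - algebraMap ℚ A r ∈ P := by
    intro z w hz hw r hr
    rw [map_mul] at hr
    -- With rational `a < φ z` and `b < φ w`, use `z w - r = (z - a) (w - b) + (a w + b z - a b -
    -- r)`. The first summand is in `P`. The second is bounded, being linear in `z` and `w`, and its
    -- value is positive once `(φ z - a) (φ w - b) < φ z φ w - r`; approximation within `δ` achieves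
    -- this.
    let δ : ℝ := min 1 (φ z * φ w - r)
    have hδ : 0 < δ := lt_min one_pos (sub_pos.mpr hr)
    obtain ⟨a, ha1, ha2⟩ := exists_rat_btwn (show φ z - δ < φ z by linarith)
    obtain ⟨b, hb1, hb2⟩ := exists_rat_btwn (show φ w - δ < φ w by linarith)
    have hab : (φ z - a) * (φ w - b) < φ z * φ w - r := by
      calc (φ z - a) * (φ w - b) < δ * δ := by
            apply mul_lt_mul'' <;> linarith
        _ ≤ 1 * (φ z * φ w - r) :=
            mul_le_mul (min_le_left _ _) (min_le_right _ _) hδ.le zero_le_one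
        _ = _ := one_mul _
    have h1 : IsBounded φ P (algebraMap ℚ A a * w + algebraMap ℚ A b * z +
        algebraMap ℚ A (-(a * b) - r)) :=
      add hP (add hP (rat_mul hP a hw) (rat_mul hP b hz)) (rat hP _)
    have h2 := hP.add_mem (hP.mul_mem (hz.1 a ha2) (hw.1 b hb2)) (h1.mem_of_pos (by
      simp only [map_add, map_mul, map_algebraMap_rat]
      push_cast
      linarith))
    rwa [map_sub, map_neg, map_mul, show (z - algebraMap ℚ A a) * (w - algebraMap ℚ A b) +
      (algebraMap ℚ A a * w + algebraMap ℚ A b * z +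
        (-(algebraMap ℚ A a * algebraMap ℚ A b) - algebraMap ℚ A r)) =
      z * w - algebraMap ℚ A r by ring] at h2
  refine of_lower _ (H hz hw) fun r hr => ?_
  rw [← neg_mul] at hr ⊢
  exact H hz.neg hw r hr

/-- The ring of the elements all of whose rational bounds come from `P`. -/
def subring (hP : IsPositiveCone φ P) : Subring A where
  carrier := {z | IsBounded φ P z}
  zero_mem' := by simpa using rat hP 0
  one_mem' := by simpa using rat hP 1
  add_mem' ha hb := add hP ha hb
  neg_mem' ha := neg ha
  mul_mem' ha hb := mul hP ha hb

/-- Bounds from `P` are true by `map_pos`, so an interval shorter than the distance from `φ z` to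
`r` lies on one side of `r`. -/
theorem of_small_intervals (hP : IsPositiveCone φ P) {z : A} (h : ∀ ε : ℝ, 0 < ε → ∃ a b : ℚ,
    z - algebraMap ℚ A a ∈ P ∧ algebraMap ℚ A b - z ∈ P ∧ (b : ℝ) - a < ε) :
    IsBounded φ P z := by
  refine ⟨fun r hr => ?_, fun r hr => ?_⟩
  · obtain ⟨a, b, ha, hb, hab⟩ := h (φ z - r) (by linarith)
    have hb' := hP.map_pos hb
    rw [map_sub, map_algebraMap_rat] at hb'
    have h1 : (r : ℝ) < a := by linarith
    have := hP.add_mem ha (hP.rat_mem (a - r) (sub_pos.mpr (by exact_mod_cast h1)))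
    rwa [map_sub, sub_add_sub_cancel] at this
  · obtain ⟨a, b, ha, hb, hab⟩ := h (r - φ z) (by linarith)
    have ha' := hP.map_pos ha
    rw [map_sub, map_algebraMap_rat] at ha'
    have h1 : (b : ℝ) < r := by linarith
    have := hP.add_mem (hP.rat_mem (r - b) (sub_pos.mpr (by exact_mod_cast h1))) hb
    rwa [map_sub, sub_add_sub_cancel] at this

/-- An element is bounded if its image is an isolated zero of a monotone function, and signs of
this function prove bounds. -/
theorem of_monotone_zero {z : A} {m : ℝ} (hz : φ z ∈ Set.Ioo m 0) (hP : IsPositiveCone φ P)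
    (hlow : ∀ r : ℚ, m < r → (r : ℝ) < φ z → z - algebraMap ℚ A r ∈ P)
    (hupp : ∀ r : ℚ, (r : ℝ) < 0 → φ z < r → algebraMap ℚ A r - z ∈ P) : IsBounded φ P z := by
  refine ⟨fun r hr => ?_, fun r hr => ?_⟩
  · obtain ⟨s, hs1, hs2⟩ := exists_rat_btwn (max_lt hr hz.1)
    rw [max_lt_iff] at hs1
    have := hP.add_mem (hlow s hs1.2 hs2) (hP.rat_mem (s - r) (sub_pos.mpr (by
      exact_mod_cast hs1.1)))
    rwa [map_sub, sub_add_sub_cancel] at this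
  · obtain ⟨s, hs1, hs2⟩ := exists_rat_btwn (lt_min hr hz.2)
    rw [lt_min_iff] at hs2
    have := hP.add_mem (hP.rat_mem (r - s) (sub_pos.mpr (by exact_mod_cast hs2.1)))
      (hupp s hs2.2 hs1)
    rwa [map_sub, sub_add_sub_cancel] at this

end IsBounded

end Cone

/-! ### The ring of terms modulo provable equality -/

section TermRing

open FieldTerm FieldFact RuleScheme

variable {G : SimpleGraph ℕ}

namespace Provable

theorem refl (a : FieldTerm) : Provable G (eq a a) :=
  of_rule (r := eqRefl) (by simp [rules, ringRules]) a a a 0 0 0 0 (by simp [eqRefl])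

theorem symm {a b : FieldTerm} (h : Provable G (eq a b)) : Provable G (eq b a) :=
  of_rule (r := eqSymm) (by simp [rules, ringRules]) a b a 0 0 0 0 (by simpa [eqSymm] using h)

theorem trans {a b c : FieldTerm} (h : Provable G (eq a b)) (h' : Provable G (eq b c)) :
    Provable G (eq a c) :=
  of_rule (r := eqTrans) (by simp [rules, ringRules]) a b c 0 0 0 0
    (by simpa [eqTrans] using ⟨h, h'⟩)

theorem ring_axiom {r : RuleScheme} (hr : r ∈ ringRules) (a b c : FieldTerm) (i : ℕ)
    (h : ∀ f ∈ (r a b c i 0 0 0).1, Provable G f) : Provable G (r a b c i 0 0 0).2 :=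
  of_rule (List.mem_append_left _ hr) a b c i 0 0 0 h

theorem add_comm (a b : FieldTerm) : Provable G (eq (add a b) (add b a)) :=
  ring_axiom (r := addComm) (by simp [ringRules]) a b a 0 (by simp [addComm])

theorem mul_comm (a b : FieldTerm) : Provable G (eq (mul a b) (mul b a)) :=
  ring_axiom (r := mulComm) (by simp [ringRules]) a b a 0 (by simp [mulComm])

theorem add_congr {a b c d : FieldTerm} (h : Provable G (eq a b)) (h' : Provable G (eq c d)) :
    Provable G (eq (add a c) (add b d)) := by
  have H : ∀ {a b : FieldTerm} (c : FieldTerm), Provable G (eq a b) →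
      Provable G (eq (add a c) (add b c)) := fun {a b} c h =>
    ring_axiom (r := addCongr) (by simp [ringRules]) a b c 0 (by simpa [addCongr] using h)
  exact (H c h).trans ((add_comm _ _).trans ((H b h').trans (add_comm _ _)))

theorem mul_congr {a b c d : FieldTerm} (h : Provable G (eq a b)) (h' : Provable G (eq c d)) :
    Provable G (eq (mul a c) (mul b d)) := by
  have H : ∀ {a b : FieldTerm} (c : FieldTerm), Provable G (eq a b) →
      Provable G (eq (mul a c) (mul b c)) := fun {a b} c h =>
    ring_axiom (r := mulCongr) (by simp [ringRules]) a b c 0 (by simpa [mulCongr] using h)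
  exact (H c h).trans ((mul_comm _ _).trans ((H b h').trans (mul_comm _ _)))

theorem inv_congr {a b : FieldTerm} (h : Provable G (eq a b)) : Provable G (eq (inv a) (inv b)) :=
  ring_axiom (r := invCongr) (by simp [ringRules]) a b a 0 (by simpa [invCongr] using h)

end Provable

variable (G) in
/-- Provable equality of terms. -/
def termSetoid : Setoid FieldTerm where
  r a b := Provable G (eq a b)
  iseqv := ⟨.refl, .symm, .trans⟩

variable (G) in
/-- The ring of terms modulo provable equality. -/
def TermRing : Type := Quotient (termSetoid G)

namespace TermRing

variable (G) in
/-- The class of a term. -/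
def mk (a : FieldTerm) : TermRing G := Quotient.mk (termSetoid G) a

theorem mk_eq_mk {a b : FieldTerm} : mk G a = mk G b ↔ Provable G (eq a b) := Quotient.eq

theorem mk_surjective : Function.Surjective (mk G) := Quotient.mk_surjective

theorem ring_axiom {r : RuleScheme} (hr : r ∈ ringRules) {a b c : FieldTerm} {i : ℕ}
    (h : (r a b c i 0 0 0).1 = []) {d e : FieldTerm} (h' : (r a b c i 0 0 0).2 = eq d e) :
    mk G d = mk G e := by
  have := Provable.ring_axiom (G := G) hr a b c i (by simp [h])
  rw [h'] at this
  exact mk_eq_mk.mpr this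

instance : Zero (TermRing G) := ⟨mk G zero⟩

instance : One (TermRing G) := ⟨mk G one⟩

instance : Add (TermRing G) :=
  ⟨Quotient.map₂ add fun _ _ h _ _ h' => Provable.add_congr h h'⟩

instance : Mul (TermRing G) :=
  ⟨Quotient.map₂ mul fun _ _ h _ _ h' => Provable.mul_congr h h'⟩

instance : Neg (TermRing G) :=
  ⟨Quotient.map neg fun _ _ h => Provable.mul_congr (.refl _) h⟩

@[simp] theorem mk_zero : mk G zero = 0 := rfl

@[simp] theorem mk_one : mk G one = 1 := rfl

@[simp] theorem mk_add (a b : FieldTerm) : mk G (add a b) = mk G a + mk G b := rfl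

@[simp] theorem mk_mul (a b : FieldTerm) : mk G (mul a b) = mk G a * mk G b := rfl

@[simp] theorem mk_neg (a : FieldTerm) : mk G (neg a) = -mk G a := rfl

instance : CommRing (TermRing G) where
  add_assoc := by
    rintro ⟨a⟩ ⟨b⟩ ⟨c⟩
    exact ring_axiom (r := addAssoc) (a := a) (b := b) (c := c) (i := 0) (by simp [ringRules])
      rfl rfl
  zero_add := by
    rintro ⟨a⟩
    exact ring_axiom (r := zeroAdd) (a := a) (b := a) (c := a) (i := 0) (by simp [ringRules])
      rfl rfl
  add_zero := by
    rintro ⟨a⟩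
    exact (mk_eq_mk.mpr (.add_comm _ _)).trans (ring_axiom (r := zeroAdd) (a := a) (b := a) (c := a)
      (i := 0) (by simp [ringRules])
      rfl rfl)
  add_comm := by
    rintro ⟨a⟩ ⟨b⟩
    exact mk_eq_mk.mpr (.add_comm _ _)
  neg_add_cancel := by
    rintro ⟨a⟩
    exact ring_axiom (r := negAdd) (a := a) (b := a) (c := a) (i := 0) (by simp [ringRules])
      rfl rfl
  mul_assoc := by
    rintro ⟨a⟩ ⟨b⟩ ⟨c⟩
    exact ring_axiom (r := mulAssoc) (a := a) (b := b) (c := c) (i := 0) (by simp [ringRules])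
      rfl rfl
  one_mul := by
    rintro ⟨a⟩
    exact ring_axiom (r := oneMul) (a := a) (b := a) (c := a) (i := 0) (by simp [ringRules])
      rfl rfl
  mul_one := by
    rintro ⟨a⟩
    exact (mk_eq_mk.mpr (.mul_comm _ _)).trans (ring_axiom (r := oneMul) (a := a) (b := a) (c := a)
      (i := 0) (by simp [ringRules])
      rfl rfl)
  mul_comm := by
    rintro ⟨a⟩ ⟨b⟩
    exact mk_eq_mk.mpr (.mul_comm _ _)
  left_distrib := by
    rintro ⟨a⟩ ⟨b⟩ ⟨c⟩
    exact ring_axiom (r := mulAdd) (a := a) (b := b) (c := c) (i := 0) (by simp [ringRules])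
      rfl rfl
  right_distrib := by
    rintro ⟨a⟩ ⟨b⟩ ⟨c⟩
    refine (mk_eq_mk.mpr (.mul_comm _ _)).trans ((ring_axiom (r := mulAdd) (a := c) (b := a) (c := b)
      (i := 0) (by simp [ringRules])
      rfl rfl).trans (mk_eq_mk.mpr ?_))
    exact .add_congr (.mul_comm _ _) (.mul_comm _ _)
  zero_mul := by
    rintro ⟨a⟩
    exact ring_axiom (r := zeroMul) (a := a) (b := a) (c := a) (i := 0) (by simp [ringRules])
      rfl rfl
  mul_zero := by
    rintro ⟨a⟩
    exact (mk_eq_mk.mpr (.mul_comm _ _)).trans (ring_axiom (r := zeroMul) (a := a) (b := a) (c := a)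
      (i := 0) (by simp [ringRules])
      rfl rfl)
  nsmul := nsmulRec
  zsmul := zsmulRec

@[simp] theorem mk_sub (a b : FieldTerm) : mk G (sub a b) = mk G a - mk G b :=
  (sub_eq_add_neg (mk G a) (mk G b)).symm

@[simp] theorem mk_sq (a : FieldTerm) : mk G (sq a) = mk G a * mk G a := rfl

@[simp] theorem mk_num (n : ℕ) : mk G (num n) = n := by
  induction n with
  | zero =>
    rw [Nat.cast_zero]
    exact ring_axiom (r := numZero) (a := zero) (b := zero) (c := zero) (i := 0)
      (by simp [ringRules])
      rfl rfl
  | succ n ih =>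
    rw [Nat.cast_succ, ← ih]
    exact ring_axiom (r := numSucc) (a := zero) (b := zero) (c := zero) (i := n)
      (by simp [ringRules])
      rfl rfl

@[simp] theorem mk_curveP (a b : FieldTerm) :
    mk G (FieldTerm.curveP a b) = _root_.curveP (mk G a) (mk G b) := by
  simp only [FieldTerm.curveP, mk_sub, mk_add, mk_mul, mk_sq, mk_num, _root_.curveP]
  push_cast
  ring

@[simp] theorem mk_curveQ (c a b : FieldTerm) :
    mk G (FieldTerm.curveQ c a b) = _root_.curveQ (mk G c) (mk G a) (mk G b) := by
  simp only [FieldTerm.curveQ, mk_add, mk_mul, mk_sq, mk_one, _root_.curveQ]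
  ring

variable (G) in
/-- The value of a class of terms. -/
noncomputable def val : TermRing G →+* ℝ where
  toFun := Quotient.lift (FieldTerm.value G) fun _ _ h => holds_eq.mp h.holds
  map_one' := rfl
  map_mul' := by rintro ⟨a⟩ ⟨b⟩; rfl
  map_zero' := rfl
  map_add' := by rintro ⟨a⟩ ⟨b⟩; rfl

@[simp] theorem val_mk (a : FieldTerm) : val G (mk G a) = a.value G := rfl

variable (G) in
/-- The classes of the provably positive terms. -/
def cone : Set (TermRing G) := {z | ∃ a, mk G a = z ∧ Provable G (pos a)}

theorem order_rule {r : RuleScheme} (hr : r ∈ orderRules) {a b : FieldTerm} {i k : ℕ}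
    (h : ∀ f ∈ (r a b a i k 0 0).1, Provable G f) {d : FieldTerm}
    (h' : (r a b a i k 0 0).2 = pos d) : mk G d ∈ cone G := by
  have := Provable.of_rule (G := G) (List.mem_append_right _ (List.mem_append_left _ hr)) a b a i k
    0 0 h
  rw [h'] at this
  exact ⟨d, rfl, this⟩

theorem mk_mem_cone {a : FieldTerm} : mk G a ∈ cone G ↔ Provable G (pos a) := by
  refine ⟨?_, fun h => ⟨a, rfl, h⟩⟩
  rintro ⟨b, hb, h⟩
  exact Provable.of_rule (r := posCongr) (by simp [rules, orderRules]) b a a 0 0 0 0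
    (by simpa [posCongr] using ⟨mk_eq_mk.mp hb, h⟩)

theorem val_pos {z : TermRing G} (hz : z ∈ cone G) : 0 < val G z := by
  obtain ⟨a, rfl, h⟩ := hz
  exact holds_pos.mp h.holds

theorem one_mem_cone : (1 : TermRing G) ∈ cone G :=
  order_rule (r := posOne) (a := zero) (b := zero) (i := 0) (k := 0) (by simp [orderRules])
    (by simp [posOne]) rfl

theorem add_mem_cone {z w : TermRing G} (hz : z ∈ cone G) (hw : w ∈ cone G) :
    z + w ∈ cone G := by
  obtain ⟨a, rfl, ha⟩ := hz
  obtain ⟨b, rfl, hb⟩ := hw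
  exact order_rule (r := posAdd) (a := a) (b := b) (i := 0) (k := 0) (by simp [orderRules])
    (by simpa [posAdd] using ⟨ha, hb⟩) rfl

theorem mul_mem_cone {z w : TermRing G} (hz : z ∈ cone G) (hw : w ∈ cone G) :
    z * w ∈ cone G := by
  obtain ⟨a, rfl, ha⟩ := hz
  obtain ⟨b, rfl, hb⟩ := hw
  exact order_rule (r := posMul) (a := a) (b := b) (i := 0) (k := 0) (by simp [orderRules])
    (by simpa [posMul] using ⟨ha, hb⟩) rfl

theorem inv_mem_cone {a : FieldTerm} (ha : mk G a ∈ cone G) : mk G (inv a) ∈ cone G :=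
  order_rule (r := posInv) (a := a) (b := a) (i := 0) (k := 0) (by simp [orderRules])
    (by simpa [posInv] using mk_mem_cone.mp ha) rfl

theorem mk_mul_inv {a : FieldTerm} (ha : mk G a * mk G a ∈ cone G) :
    mk G a * mk G (inv a) = 1 :=
  mk_eq_mk.mpr (Provable.ring_axiom (r := mulInv) (by simp [ringRules]) a a a 0
    (by simpa [mulInv] using mk_mem_cone.mp (show mk G (sq a) ∈ cone G from ha)))

theorem mk_inv_zero : mk G (inv zero) = 0 :=
  ring_axiom (r := invZero) (a := zero) (b := zero) (c := zero) (i := 0)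
      (by simp [ringRules])
      rfl rfl

theorem mk_inv_congr {a b : FieldTerm} (h : mk G a = mk G b) : mk G (inv a) = mk G (inv b) :=
  mk_eq_mk.mpr (.inv_congr (mk_eq_mk.mp h))

theorem natCast_mem_cone (n : ℕ) : ((n + 1 : ℕ) : TermRing G) ∈ cone G := by
  induction n with
  | zero => simpa using one_mem_cone
  | succ n ih =>
    rw [Nat.cast_succ]
    exact add_mem_cone ih one_mem_cone

theorem natCast_mul_inv {n : ℕ} (hn : n ≠ 0) : (n : TermRing G) * mk G (inv (num n)) = 1 := by
  obtain ⟨n, rfl⟩ := Nat.exists_eq_succ_of_ne_zero hn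
  have := mk_mul_inv (G := G) (a := num (n + 1)) (by
    rw [mk_num]; exact mul_mem_cone (natCast_mem_cone n) (natCast_mem_cone n))
  rwa [mk_num] at this

variable (G) in
/-- The homomorphism from the rational numbers. -/
noncomputable def ratHom : ℚ →+* TermRing G :=
  IsLocalization.lift (M := nonZeroDivisors ℤ) (g := Int.castRingHom (TermRing G)) fun y => by
    -- Nonzero integers are provably invertible, so the map from `ℤ` extends to `ℚ`.
    have h : IsUnit (((y : ℤ).natAbs : ℕ) : TermRing G) := IsUnit.of_mul_eq_one _
      (natCast_mul_inv (Int.natAbs_ne_zero.mpr (nonZeroDivisors.ne_zero y.2)))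
    rcases Int.natAbs_eq (y : ℤ) with hy | hy
    · rw [eq_intCast, hy, Int.cast_natCast]; exact h
    · rw [eq_intCast, hy, Int.cast_neg, Int.cast_natCast]; exact h.neg

noncomputable instance : Algebra ℚ (TermRing G) := (ratHom G).toAlgebra

theorem isPositiveCone : IsPositiveCone (val G) (cone G) where
  add_mem := add_mem_cone
  mul_mem := mul_mem_cone
  map_pos := val_pos
  rat_mem r hr := by
    obtain ⟨n, hn⟩ : ∃ n : ℕ, r.num = (n + 1 : ℕ) :=
      ⟨r.num.toNat - 1, by have := Rat.num_pos.mpr hr; omega⟩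
    obtain ⟨d, hd⟩ : ∃ d : ℕ, r.den = d + 1 := ⟨r.den - 1, by have := r.den_pos; omega⟩
    have h1 : algebraMap ℚ (TermRing G) r * ((d + 1 : ℕ) : TermRing G) = ((n + 1 : ℕ)) := by
      rw [← map_natCast (algebraMap ℚ (TermRing G)), ← map_natCast (algebraMap ℚ (TermRing G)),
        ← map_mul, ← hd]
      congr 1
      rw [Rat.mul_den_eq_num, hn]
      rfl
    have h2 : algebraMap ℚ (TermRing G) r =
        ((n + 1 : ℕ) : TermRing G) * mk G (inv (num (d + 1))) := by
      rw [← h1, mul_assoc, natCast_mul_inv d.succ_ne_zero, mul_one]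
    rw [h2]
    exact mul_mem_cone (natCast_mem_cone n) (inv_mem_cone (by
      rw [mk_num]; exact natCast_mem_cone d))

end TermRing

end TermRing

/-! ### Completeness of the calculus -/

theorem curveP_mem {A : Type*} [CommRing A] {S : Subring A} {a b : A} (ha : a ∈ S) (hb : b ∈ S) :
    curveP a b ∈ S :=
  sub_mem (add_mem (add_mem (add_mem (pow_mem ha 4) (mul_mem (mul_mem (ofNat_mem S 16) ha)
    (pow_mem hb 3))) (mul_mem (ofNat_mem S 10) (pow_mem hb 4))) (mul_mem (ofNat_mem S 16) hb))
    (ofNat_mem S 4)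

theorem curveQ_mem {A : Type*} [CommRing A] {S : Subring A} {c a b : A} (hc : c ∈ S) (ha : a ∈ S)
    (hb : b ∈ S) : curveQ c a b ∈ S :=
  add_mem (add_mem (add_mem (pow_mem ha 4) (pow_mem hb 4)) (one_mem S)) (mul_mem hc
    (add_mem (add_mem (add_mem (pow_mem ha 4) (mul_mem ha (pow_mem hb 3))) hb) (one_mem S)))

section Completeness

open FieldTerm FieldFact RuleScheme

variable {G : SimpleGraph ℕ}

namespace TermRing

theorem algebraMap_natCast (n : ℕ) : algebraMap ℚ (TermRing G) n = mk G (num n) := by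
  rw [mk_num, map_natCast]

theorem mk_inv_of_rat {a : FieldTerm} {q : ℚ} (hq : q ≠ 0)
    (h : mk G a = algebraMap ℚ (TermRing G) q) :
    mk G (inv a) = algebraMap ℚ (TermRing G) q⁻¹ := by
  have h1 := mk_mul_inv (G := G) (a := a) (by
    rw [h, ← map_mul]
    exact isPositiveCone.rat_mem _ (mul_self_pos.mpr hq))
  calc mk G (inv a) = algebraMap ℚ (TermRing G) (q⁻¹ * q) * mk G (inv a) := by
        rw [inv_mul_cancel₀ hq, map_one, one_mul]
    _ = algebraMap ℚ (TermRing G) q⁻¹ * (mk G a * mk G (inv a)) := by rw [map_mul, h, mul_assoc]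
    _ = _ := by rw [h1, mul_one]

theorem exists_mk_gapStep (k : ℕ) :
    ∃ q : ℚ, mk G (gapStep k) = algebraMap ℚ (TermRing G) q :=
  ⟨_, mk_inv_of_rat (q := ((2 ^ (k + 4).factorial : ℕ) : ℚ)) (by positivity)
    (algebraMap_natCast _).symm⟩

/-- Partial sums are provably equal to rational numbers, so they can serve as bounds. -/
theorem exists_mk_gap (k j : ℕ) : ∃ q : ℚ, mk G (gap k j) = algebraMap ℚ (TermRing G) q := by
  induction k with
  | zero =>
    refine ⟨0, ?_⟩
    rw [map_zero]
    exact mk_eq_mk.mpr (Provable.of_rule (r := gapZero) (by simp [rules, orderRules]) zero zero zero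
      j 0 0 0 (by simp [gapZero]))
  | succ k ih =>
    obtain ⟨q, hq⟩ := ih
    have h : mk G (gap (k + 1) j) = mk G (gap k j) + mk G (gapTerm k j) :=
      mk_eq_mk.mpr (Provable.of_rule (r := gapSucc) (by simp [rules, orderRules]) zero zero zero
        k j 0 0 (by simp [gapSucc]))
    obtain ⟨s, hs⟩ : ∃ s : ℚ, mk G (gapTerm k j) = algebraMap ℚ (TermRing G) s := by
      rw [FieldTerm.gapTerm]
      by_cases hk : k.unpair.1 = j
      · simpa [hk] using exists_mk_gapStep k
      · exact ⟨0, by simp [hk]⟩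
    exact ⟨q + s, by rw [h, hq, hs, map_add]⟩

theorem isBounded_of_gap {z : TermRing G} (m j : ℕ)
    (hl : ∀ k, z - mk G (add (num m) (gap k j)) ∈ cone G)
    (hu : ∀ k, mk G (add (add (num m) (gap k j)) (mul (num 3) (gapStep k))) - z ∈ cone G) :
    IsBounded (val G) (cone G) z := by
  refine IsBounded.of_small_intervals isPositiveCone fun ε hε => ?_
  -- This gives `2 s < ε / 2` for the step `s`, hence `3 s < ε`.
  obtain ⟨k, hk⟩ := (tendsto_gap.eventually_lt_const (show (0 : ℝ) < ε / 2 by linarith)).exists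
  obtain ⟨q, hq⟩ := exists_mk_gap (G := G) k j
  obtain ⟨s, hs⟩ := exists_mk_gapStep (G := G) k
  have hs' : (s : ℝ) = (1 / 2) ^ (k + 4).factorial := by
    have := congrArg (val G) hs
    rw [map_algebraMap_rat, val_mk, value_gapStep] at this
    exact this.symm
  refine ⟨m + q, m + q + 3 * s, ?_, ?_, ?_⟩
  · have := hl k
    rwa [mk_add, mk_num, hq, ← map_natCast (algebraMap ℚ (TermRing G)), ← map_add] at this
  · have := hu k
    rwa [mk_add, mk_mul, mk_add, mk_num, mk_num, hq, hs,
      ← map_natCast (algebraMap ℚ (TermRing G)), ← map_natCast (algebraMap ℚ (TermRing G)),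
      ← map_add, ← map_mul, ← map_add] at this
  · push_cast
    rw [hs']
    linarith

variable (G) in
/-- The ring of the elements all of whose rational bounds are provable. -/
noncomputable def boundedRing : Subring (TermRing G) := IsBounded.subring isPositiveCone

theorem mem_boundedRing {z : TermRing G} :
    z ∈ boundedRing G ↔ IsBounded (val G) (cone G) z := Iff.rfl

theorem rat_mem_boundedRing (q : ℚ) : algebraMap ℚ (TermRing G) q ∈ boundedRing G :=
  IsBounded.rat isPositiveCone q

theorem mk_mem_cone_of_pos {a : FieldTerm} (h : mk G a ∈ boundedRing G) (h0 : 0 < a.value G) :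
    Provable G (pos a) :=
  mk_mem_cone.mp (IsBounded.mem_of_pos (mem_boundedRing.mp h) h0)

theorem u_mem_boundedRing (i : ℕ) : mk G (u i) ∈ boundedRing G :=
  isBounded_of_gap 2 (2 * i)
    (fun k => order_rule (r := ltU) (a := zero) (b := zero) (i := i) (k := k)
      (by simp [orderRules]) (by simp [ltU]) rfl)
    (fun k => order_rule (r := uLt) (a := zero) (b := zero) (i := i) (k := k)
      (by simp [orderRules]) (by simp [uLt]) rfl)

theorem x_mem_boundedRing (i : ℕ) : mk G (x i) ∈ boundedRing G :=
  isBounded_of_gap 1 (2 * i + 1)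
    (fun k => order_rule (r := ltX) (a := zero) (b := zero) (i := i) (k := k)
      (by simp [orderRules]) (by simp [ltX]) rfl)
    (fun k => order_rule (r := xLt) (a := zero) (b := zero) (i := i) (k := k)
      (by simp [orderRules]) (by simp [xLt]) rfl)

theorem t_mem {S : Subring (TermRing G)} (h : ∀ i, mk G (u i) ∈ S) (k : ℕ) : mk G (t k) ∈ S := by
  rcases Provable.eq_t (G := G) k with h' | h'
  · rw [mk_eq_mk.mpr h', mk_mul]
    exact mul_mem (h _) (h _)
  · rw [mk_eq_mk.mpr h', mk_add]
    exact add_mem (h _) (h _)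

/-- For rational `r` near the root, `p(u_i, r)` is in the bounded ring because `u_i` is. Its sign is
therefore provable, and the rules `ltV` and `vLt` turn it into a bound for `v_i`. -/
theorem v_mem_boundedRing (i : ℕ) : mk G (v i) ∈ boundedRing G := by
  have hval : ∀ {r : ℚ} {a : FieldTerm}, mk G a = algebraMap ℚ (TermRing G) r →
      a.value G = r := fun {r a} ha => by
    rw [← val_mk, ha, map_algebraMap_rat]
  refine IsBounded.of_monotone_zero (m := -1) (by simpa using vR_mem i) isPositiveCone
    (fun r hr1 hr2 => ?_) fun r hr1 hr2 => ?_
  all_goals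
    obtain ⟨a, ha⟩ := mk_surjective (algebraMap ℚ (TermRing G) r)
    have hB : mk G a ∈ boundedRing G := ha ▸ rat_mem_boundedRing r
    have hP : mk G (FieldTerm.curveP (u i) a) ∈ boundedRing G := by
      rw [mk_curveP]
      exact curveP_mem (u_mem_boundedRing i) hB
    have hv := vR_mem i
    rw [← ha]
    rw [val_mk, value_v, ← hval ha] at hr2
  · rw [← hval ha] at hr1
    refine order_rule (r := ltV) (a := a) (b := a) (i := i) (k := 0) (by simp [orderRules]) ?_ rfl
    simp only [ltV, List.forall_mem_cons, List.not_mem_nil, false_imp_iff, implies_true, and_true]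
    refine ⟨mk_mem_cone_of_pos (add_mem hB (one_mem _)) ?_, mk_mem_cone_of_pos (neg_mem hB) ?_,
      mk_mem_cone_of_pos (neg_mem hP) ?_⟩
    · rw [value_add, value_one]; linarith
    · rw [value_neg]; linarith [hv.2]
    · rw [value_neg, value_curveP, value_u]
      have := curveP_lt_curveP (two_lt_uR i) hr1 hr2 hv.2
      rw [curveP_uR_vR] at this
      linarith
  · have hr1' : a.value G < 0 := by rw [hval ha]; exact hr1
    refine order_rule (r := vLt) (a := a) (b := a) (i := i) (k := 0) (by simp [orderRules]) ?_ rfl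
    simp only [vLt, List.forall_mem_cons, List.not_mem_nil, false_imp_iff, implies_true, and_true]
    refine ⟨mk_mem_cone_of_pos (add_mem hB (one_mem _)) ?_, mk_mem_cone_of_pos (neg_mem hB) ?_,
      mk_mem_cone_of_pos hP ?_⟩
    · rw [value_add, value_one]; linarith [hv.1]
    · rw [value_neg]; linarith
    · rw [value_curveP, value_u]
      have := curveP_lt_curveP (two_lt_uR i) hv.1 hr2 hr1'
      rwa [curveP_uR_vR] at this

theorem y_mem_boundedRing (k : ℕ) : mk G (y k) ∈ boundedRing G := by
  have hval : ∀ {r : ℚ} {a : FieldTerm}, mk G a = algebraMap ℚ (TermRing G) r →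
      a.value G = r := fun {r a} ha => by
    rw [← val_mk, ha, map_algebraMap_rat]
  refine IsBounded.of_monotone_zero (m := -2) (by simpa using yR_mem G k) isPositiveCone
    (fun r hr1 hr2 => ?_) fun r hr1 hr2 => ?_
  all_goals
    obtain ⟨a, ha⟩ := mk_surjective (algebraMap ℚ (TermRing G) r)
    have hB : mk G a ∈ boundedRing G := ha ▸ rat_mem_boundedRing r
    have hB2 : mk G (add a (num 2)) ∈ boundedRing G := by
      rw [mk_add, mk_num]
      exact add_mem hB (natCast_mem _ 2)
    have hQ : mk G (FieldTerm.curveQ (t k) (x k) a) ∈ boundedRing G := by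
      rw [mk_curveQ]
      exact curveQ_mem (t_mem u_mem_boundedRing k) (x_mem_boundedRing k) hB
    have hv := yR_mem G k
    rw [← ha]
    rw [val_mk, value_y, ← hval ha] at hr2
  · rw [← hval ha] at hr1
    refine order_rule (r := ltY) (a := a) (b := a) (i := k) (k := 0) (by simp [orderRules]) ?_ rfl
    simp only [ltY, List.forall_mem_cons, List.not_mem_nil, false_imp_iff, implies_true, and_true]
    refine ⟨mk_mem_cone_of_pos hB2 ?_, mk_mem_cone_of_pos (neg_mem hB) ?_,
      mk_mem_cone_of_pos (neg_mem hQ) ?_⟩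
    · rw [value_add, value_num]; push_cast; linarith
    · rw [value_neg]; linarith [hv.2]
    · rw [value_neg, value_curveQ, value_t, value_x]
      have := curveQ_lt_curveQ (four_lt_tR G k) (one_lt_xR k) hr1 hr2 hv.2
      rw [curveQ_tR_xR_yR] at this
      linarith
  · have hr1' : a.value G < 0 := by rw [hval ha]; exact hr1
    refine order_rule (r := yLt) (a := a) (b := a) (i := k) (k := 0) (by simp [orderRules]) ?_ rfl
    simp only [yLt, List.forall_mem_cons, List.not_mem_nil, false_imp_iff, implies_true, and_true]
    refine ⟨mk_mem_cone_of_pos hB2 ?_, mk_mem_cone_of_pos (neg_mem hB) ?_,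
      mk_mem_cone_of_pos hQ ?_⟩
    · rw [value_add, value_num]; push_cast; linarith [hv.1]
    · rw [value_neg]; linarith
    · rw [value_curveQ, value_t, value_x]
      have := curveQ_lt_curveQ (four_lt_tR G k) (one_lt_xR k) hv.1 hr2 hr1'
      rwa [curveQ_tR_xR_yR] at this

/-! ### The ring of the generators and its fractions -/

variable (G) in
/-- The subring generated by the rational numbers, the `u_i` and the `v_i`. -/
noncomputable def ringK : Subring (TermRing G) :=
  Subring.closure (((algebraMap ℚ (TermRing G)).range : Set (TermRing G)) ∪
    (Set.range (fun i => mk G (u i)) ∪ Set.range fun i => mk G (v i)))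

variable (G) in
/-- The subring generated by the rational numbers and all generators. -/
noncomputable def ringF : Subring (TermRing G) :=
  Subring.closure ((ringK G : Set (TermRing G)) ∪
    (Set.range (fun k => mk G (x k)) ∪ Set.range fun k => mk G (y k)))

theorem u_mem_ringK (i : ℕ) : mk G (u i) ∈ ringK G :=
  Subring.subset_closure (Or.inr (Or.inl ⟨i, rfl⟩))

theorem v_mem_ringK (i : ℕ) : mk G (v i) ∈ ringK G :=
  Subring.subset_closure (Or.inr (Or.inr ⟨i, rfl⟩))

theorem ringK_le_ringF : ringK G ≤ ringF G := fun _ h => Subring.subset_closure (Or.inl h)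

theorem x_mem_ringF (k : ℕ) : mk G (x k) ∈ ringF G :=
  Subring.subset_closure (Or.inr (Or.inl ⟨k, rfl⟩))

theorem y_mem_ringF (k : ℕ) : mk G (y k) ∈ ringF G :=
  Subring.subset_closure (Or.inr (Or.inr ⟨k, rfl⟩))

theorem ringF_le_boundedRing : ringF G ≤ boundedRing G := by
  refine Subring.closure_le.mpr (Set.union_subset (Subring.closure_le.mpr
    (Set.union_subset ?_ (Set.union_subset ?_ ?_))) (Set.union_subset ?_ ?_))
  · rintro _ ⟨q, rfl⟩
    exact rat_mem_boundedRing q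
  · rintro _ ⟨i, rfl⟩
    exact u_mem_boundedRing i
  · rintro _ ⟨i, rfl⟩
    exact v_mem_boundedRing i
  · rintro _ ⟨k, rfl⟩
    exact x_mem_boundedRing k
  · rintro _ ⟨k, rfl⟩
    exact y_mem_boundedRing k

theorem mk_curveP_eq_zero (i : ℕ) : _root_.curveP (mk G (u i)) (mk G (v i)) = 0 := by
  rw [← mk_curveP]
  exact mk_eq_mk.mpr (Provable.of_rule (r := eqCurveP) (by simp [rules, orderRules]) zero zero zero
    i 0 0 0 (by simp [eqCurveP]))

theorem mk_curveQ_eq_zero (k : ℕ) :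
    _root_.curveQ (mk G (t k)) (mk G (x k)) (mk G (y k)) = 0 := by
  rw [← mk_curveQ]
  exact mk_eq_mk.mpr (Provable.of_rule (r := eqCurveQ) (by simp [rules, orderRules]) zero zero zero
    k 0 0 0 (by simp [eqCurveQ]))

/-- The tower argument inside the ring of terms: it uses only the curve equations, which are axioms
of the calculus, and the independence of the real values. Hence every true equality in this ring is
provable. -/
theorem eq_zero_of_mem_ringK {z : TermRing G} (hz : z ∈ ringK G) (h0 : val G z = 0) : z = 0 := by
  refine eq_zero_of_mem_closure_range (val G) (k := realK) ?_ ?_ realK_mono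
    (fun i => by simpa using uR_mem_realK i) (fun i => by simpa using vR_mem_realK i)
    (fun i => by simpa using isQuarticExtension_realK i)
    (fun i => exists_relation_of_curveP (B := (algebraMap ℚ (TermRing G)).range)
      (fun q => ⟨q, rfl⟩) (mk_curveP_eq_zero i)) hz h0
  · rintro _ ⟨q, rfl⟩ hq
    rw [map_algebraMap_rat, Rat.cast_eq_zero] at hq
    rw [hq, map_zero]
  · rintro _ ⟨q, rfl⟩
    rw [map_algebraMap_rat]
    exact SubfieldClass.ratCast_mem _ q

theorem eq_zero_of_mem_ringF {z : TermRing G} (hz : z ∈ ringF G) (h0 : val G z = 0) : z = 0 := by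
  refine eq_zero_of_mem_closure_range (val G) (k := realF G)
    (fun z hz => eq_zero_of_mem_ringK hz) ?_ (realF_mono G)
    (fun k => by simpa using xR_mem_realF G k) (fun k => by simpa using yR_mem_realF G k)
    (fun k => by simpa using isQuarticExtension_realF G k)
    (fun k => exists_relation_of_curveQ (t_mem u_mem_ringK k) (mk_curveQ_eq_zero k)) hz h0
  have : ringK G ≤ ((realF G 0).toSubring).comap (val G) := by
    refine Subring.closure_le.mpr (Set.union_subset ?_ (Set.union_subset ?_ ?_))
    · rintro _ ⟨q, rfl⟩
      change val G _ ∈ realF G 0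
      rw [map_algebraMap_rat]
      exact SubfieldClass.ratCast_mem _ q
    · rintro _ ⟨i, rfl⟩
      change val G _ ∈ realF G 0
      simpa using realK_le_realF G _ _ (uR_mem_realK i)
    · rintro _ ⟨i, rfl⟩
      change val G _ ∈ realF G 0
      simpa using realK_le_realF G _ _ (vR_mem_realK i)
  exact fun z hz => this hz

/-- An element of `ringF` with nonzero value is invertible, and its square is provably positive. -/
theorem exists_inverse {d : TermRing G} (hd : d ∈ ringF G) (h0 : val G d ≠ 0) :
    ∃ e, d * e = 1 ∧ e * e ∈ cone G := by
  obtain ⟨a, rfl⟩ := mk_surjective d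
  have hsq : mk G a * mk G a ∈ cone G :=
    IsBounded.mem_of_pos (mem_boundedRing.mp (ringF_le_boundedRing (mul_mem hd hd)))
      (by rw [map_mul]; exact mul_self_pos.mpr h0)
  have h1 := mk_mul_inv hsq
  have h2 : mk G (inv (sq a)) ∈ cone G := inv_mem_cone hsq
  have h3 : mk G (sq a) * mk G (inv (sq a)) = 1 := mk_mul_inv (mul_mem_cone hsq hsq)
  refine ⟨mk G (inv a), h1, ?_⟩
  have h4 : mk G (inv a) * mk G (inv a) = mk G (inv (sq a)) := by
    calc mk G (inv a) * mk G (inv a)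
        = mk G (inv a) * mk G (inv a) * (mk G (sq a) * mk G (inv (sq a))) := by rw [h3, mul_one]
      _ = (mk G a * mk G (inv a)) * (mk G a * mk G (inv a)) * mk G (inv (sq a)) := by
          rw [mk_sq]; ring
      _ = _ := by rw [h1, one_mul, one_mul]
  rwa [h4]

/-- The fractions of elements of `ringF`. -/
def IsRegular (z : TermRing G) : Prop := ∃ d ∈ ringF G, val G d ≠ 0 ∧ z * d ∈ ringF G

namespace IsRegular

theorem of_mem {z : TermRing G} (hz : z ∈ ringF G) : IsRegular z :=
  ⟨1, one_mem _, by simp, by simpa using hz⟩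

theorem add {z w : TermRing G} (hz : IsRegular z) (hw : IsRegular w) : IsRegular (z + w) := by
  obtain ⟨d, hd, hd0, hzd⟩ := hz
  obtain ⟨e, he, he0, hwe⟩ := hw
  refine ⟨d * e, mul_mem hd he, by rw [map_mul]; exact mul_ne_zero hd0 he0, ?_⟩
  rw [show (z + w) * (d * e) = z * d * e + w * e * d by ring]
  exact add_mem (mul_mem hzd he) (mul_mem hwe hd)

theorem mul {z w : TermRing G} (hz : IsRegular z) (hw : IsRegular w) : IsRegular (z * w) := by
  obtain ⟨d, hd, hd0, hzd⟩ := hz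
  obtain ⟨e, he, he0, hwe⟩ := hw
  refine ⟨d * e, mul_mem hd he, by rw [map_mul]; exact mul_ne_zero hd0 he0, ?_⟩
  rw [show z * w * (d * e) = z * d * (w * e) by ring]
  exact mul_mem hzd hwe

theorem neg {z : TermRing G} (hz : IsRegular z) : IsRegular (-z) := by
  rw [← neg_one_mul]
  exact mul (of_mem (neg_mem (one_mem _))) hz

theorem sub {z w : TermRing G} (hz : IsRegular z) (hw : IsRegular w) : IsRegular (z - w) := by
  rw [sub_eq_add_neg]
  exact add hz hw.neg

/-- A denominator with nonzero value is provably invertible, and the numerator is provably zero. -/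
theorem eq_zero {z : TermRing G} (hz : IsRegular z) (h0 : val G z = 0) : z = 0 := by
  obtain ⟨d, hd, hd0, hzd⟩ := hz
  obtain ⟨e, hde, -⟩ := exists_inverse hd hd0
  have := eq_zero_of_mem_ringF hzd (by rw [map_mul, h0, zero_mul])
  rw [← mul_one z, ← hde, ← mul_assoc, this, zero_mul]

theorem eq_of_val {z w : TermRing G} (hz : IsRegular z) (hw : IsRegular w)
    (h : val G z = val G w) : z = w :=
  sub_eq_zero.mp ((hz.sub hw).eq_zero (by rw [map_sub, h, sub_self]))

/-- With `e` inverse to the denominator `d`, write `z = (z d) d e ^ 2`. Here `(z d) d` is an element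
of `ringF` with positive value, and `e ^ 2` is provably positive. -/
theorem mem_cone {z : TermRing G} (hz : IsRegular z) (h0 : 0 < val G z) : z ∈ cone G := by
  obtain ⟨d, hd, hd0, hzd⟩ := hz
  obtain ⟨e, hde, hee⟩ := exists_inverse hd hd0
  have h1 : z * d * d ∈ cone G :=
    IsBounded.mem_of_pos (mem_boundedRing.mp (ringF_le_boundedRing (mul_mem hzd hd))) (by
      rw [map_mul, map_mul, mul_assoc]
      exact mul_pos h0 (mul_self_pos.mpr hd0))
  have h2 : z = z * d * d * (e * e) := by
    rw [show z * d * d * (e * e) = z * (d * e) * (d * e) by ring, hde, mul_one, mul_one]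
  rw [h2]
  exact mul_mem_cone h1 hee

/-- Inversion is total, so two cases arise. If the value is zero, then `a` is provably zero and the
axiom for `inv zero` applies. Otherwise `d / (a d)` represents the inverse. -/
theorem inv {a : FieldTerm} (ha : IsRegular (mk G a)) : IsRegular (mk G (inv a)) := by
  by_cases h0 : val G (mk G a) = 0
  · rw [mk_inv_congr ((ha.eq_zero h0).trans mk_zero.symm), mk_inv_zero]
    exact of_mem (zero_mem _)
  · have h1 := mk_mul_inv ((ha.mul ha).mem_cone (by rw [map_mul]; exact mul_self_pos.mpr h0))
    obtain ⟨d, hd, hd0, hzd⟩ := ha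
    refine ⟨mk G a * d, hzd, by rw [map_mul]; exact mul_ne_zero h0 hd0, ?_⟩
    rw [← mul_assoc, mul_comm (mk G (FieldTerm.inv a)), h1, one_mul]
    exact hd

theorem provable_pos {a : FieldTerm} (ha : IsRegular (mk G a)) (h : 0 < a.value G) :
    Provable G (pos a) := mk_mem_cone.mp (ha.mem_cone h)

theorem provable_pos_sq {a : FieldTerm} (ha : IsRegular (mk G a)) (h : a.value G ≠ 0) :
    Provable G (pos (sq a)) :=
  provable_pos (ha.mul ha) (by rw [value_sq]; exact mul_self_pos.mpr h)

theorem provable_eq {a b : FieldTerm} (ha : IsRegular (mk G a)) (hb : IsRegular (mk G b))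
    (h : a.value G = b.value G) : Provable G (eq a b) := mk_eq_mk.mp (ha.eq_of_val hb h)

end IsRegular

/-! #### The names -/

section Column

variable (G) in
/-- The names before column `n` are names of regular elements. -/
def RegularBefore (n : ℕ) : Prop :=
  ∀ a : ℕ, ColumnBefore n a.unpair.1 → IsRegular (mk G (named a))

variable {n : ℕ}

theorem isRegular_before (hn : RegularBefore G n) (a : ℕ) : IsRegular (mk G (before n a)) := by
  rw [before]
  by_cases h : ColumnBefore n a.unpair.1
  · simpa [h] using hn a h
  · simpa [h] using IsRegular.of_mem (zero_mem _)

theorem isRegular_coeff (hn : RegularBefore G n) (l : List ℕ) (i : ℕ) :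
    IsRegular (mk G (coeff n l i)) := by
  rw [coeff]
  cases l[i]? with
  | none => exact .of_mem (zero_mem _)
  | some a => exact isRegular_before hn a

theorem isRegular_genX (n : ℕ) : IsRegular (mk G (genX n)) := by
  rw [FieldTerm.genX]
  by_cases h : n % 2 = 0
  · simpa [h] using IsRegular.of_mem (ringK_le_ringF (u_mem_ringK (n / 2 - 1)))
  · simpa [h] using IsRegular.of_mem (x_mem_ringF (n / 2))

theorem isRegular_genY (n : ℕ) : IsRegular (mk G (genY n)) := by
  rw [FieldTerm.genY]
  by_cases h : n % 2 = 0
  · simpa [h] using IsRegular.of_mem (ringK_le_ringF (v_mem_ringK (n / 2 - 1)))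
  · simpa [h] using IsRegular.of_mem (y_mem_ringF (n / 2))

theorem isRegular_num (m : ℕ) : IsRegular (mk G (num m)) := by
  rw [mk_num]
  exact .of_mem (natCast_mem _ m)

theorem isRegular_poly (hn : RegularBefore G n) (l : List ℕ) : IsRegular (mk G (poly n l)) := by
  induction l with
  | nil => exact .of_mem (zero_mem _)
  | cons a l ih => exact .add (isRegular_before hn a) (.mul (isRegular_genX n) ih)

theorem isRegular_frac (hn : RegularBefore G n) (r : List ℕ × List ℕ) :
    IsRegular (mk G (frac n r)) :=
  .mul (isRegular_poly hn _) (.inv (isRegular_poly hn _))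

theorem isRegular_columnSeq (hn : RegularBefore G n) (c : ℕ) :
    IsRegular (mk G (columnSeq n c)) := by
  have hy := isRegular_genY (G := G) n
  rw [FieldTerm.columnSeq]
  by_cases h0 : n = 0
  · simp only [h0, decide_true, cond_true]
    exact .mul (.add (isRegular_num _) (.neg (isRegular_num _))) (.inv (isRegular_num _))
  by_cases h1 : c = 0
  · simpa [h0, h1] using isRegular_genX n
  by_cases h2 : c = 1
  · simpa [h0, h2] using hy
  simp only [h0, h1, h2, decide_false, cond_false]
  exact .add (.add (.add (isRegular_frac hn _) (.mul (isRegular_frac hn _) hy))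
    (.mul (isRegular_frac hn _) (.mul hy hy))) (.mul (isRegular_frac hn _) (.mul hy (.mul hy hy)))

/-- The negated membership criterion supplies explicit nonzero coefficients or a nonzero minor;
these are regular, so the positivity of their squares is provable. -/
theorem provable_fresh_zero (hn : RegularBefore G n) {c : ℕ}
    (hc : _root_.columnSeq G n c ∉ namedBefore G n) :
    Provable G (fresh n c 0) := by
  obtain rfl | ⟨n, rfl⟩ : n = 0 ∨ ∃ m, n = m + 1 := by cases n <;> simp
  · exact .of_rule (r := freshRat) (by simp [rules, nameRules]) zero zero zero c 0 0 0
      (by simp [freshRat])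
  match c, hc with
  | 0, _ =>
    exact .of_rule (r := freshFirst) (by simp [rules, nameRules]) zero zero zero n 0 0 0
      (by simp [freshFirst])
  | 1, _ =>
    exact .of_rule (r := freshSecond) (by simp [rules, nameRules]) zero zero zero n 0 0 0
      (by simp [freshSecond])
  | c + 2, hc =>
    have hpos := fun l i (h : listCoeff (realBefore G (n + 1)) l i ≠ 0) =>
      (isRegular_coeff hn l i).provable_pos_sq (by rwa [value_coeff])
    rw [columnSeq_mem_namedBefore_iff G n.succ_ne_zero, not_and_or] at hc
    push Not at hc
    rcases hc with ⟨j, hj, ⟨i, hi⟩, i', hi'⟩ | ⟨i, i', h⟩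
    · have hmem : freshTerm j ∈ rules := by
        fin_cases j
        · exact absurd rfl hj
        all_goals simp [rules, nameRules]
      refine .of_rule hmem zero zero zero n c i i' ?_
      simp only [freshTerm, List.forall_mem_cons, List.not_mem_nil, false_imp_iff, implies_true,
        and_true]
      exact ⟨hpos _ _ hi, hpos _ _ hi'⟩
    · refine .of_rule (r := freshConst) (by simp [rules, nameRules]) zero zero zero n c i i' ?_
      simp only [freshConst, List.forall_mem_cons, List.not_mem_nil, false_imp_iff, implies_true,
        and_true]
      refine IsRegular.provable_pos_sq (.add (.mul (isRegular_coeff hn _ _)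
        (isRegular_coeff hn _ _)) (.neg (.mul (isRegular_coeff hn _ _)
        (isRegular_coeff hn _ _)))) ?_
      simpa [sub_eq_zero] using h

theorem provable_fresh (hn : RegularBefore G n) {c d : ℕ}
    (hc : _root_.columnSeq G n c ∉ namedBefore G n)
    (h : ∀ e < d, _root_.columnSeq G n e ≠ _root_.columnSeq G n c) :
    Provable G (fresh n c d) := by
  induction d with
  | zero => exact provable_fresh_zero hn hc
  | succ d ih =>
    refine .of_rule (r := freshSucc) (by simp [rules, nameRules]) zero zero zero n c d 0 ?_
    simp only [freshSucc, List.forall_mem_cons, List.not_mem_nil, false_imp_iff, implies_true,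
      and_true]
    refine ⟨ih fun e he => h e (he.trans d.lt_succ_self),
      IsRegular.provable_pos_sq (.add (isRegular_columnSeq hn c)
        (.neg (isRegular_columnSeq hn d))) ?_⟩
    rw [value_sub, value_columnSeq, value_columnSeq]
    exact sub_ne_zero.mpr (h d d.lt_succ_self).symm

theorem provable_old (hn : RegularBefore G n) {c : ℕ}
    (h : ¬ IsNew (namedBefore G n) (_root_.columnSeq G n) c) :
    Provable G (old n c) := by
  rw [IsNew, not_and_or, not_not] at h
  push Not at h
  rcases h with ⟨a, ha, hac⟩ | ⟨e, he, hec⟩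
  · have := Provable.of_rule (G := G) (r := oldNamed) (by simp [rules, nameRules]) zero zero zero
      n c a 0 (by
        simp only [oldNamed, ha, decide_true, cond_true, List.forall_mem_cons, List.not_mem_nil,
          false_imp_iff, implies_true, and_true]
        exact (isRegular_columnSeq hn c).provable_eq (hn a ha)
          (by rw [value_columnSeq, value_named, hac]))
    simpa only [oldNamed, ha, decide_true, cond_true] using this
  · obtain ⟨d, rfl⟩ : ∃ d, c = e + d + 1 := ⟨c - e - 1, by omega⟩
    refine .of_rule (r := oldRepeated) (by simp [rules, nameRules]) zero zero zero n e d 0 ?_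
    simp only [oldRepeated, List.forall_mem_cons, List.not_mem_nil, false_imp_iff, implies_true,
      and_true]
    exact (isRegular_columnSeq hn _).provable_eq (isRegular_columnSeq hn e)
      (by rw [value_columnSeq, value_columnSeq, hec])

open Classical in
theorem provable_count (hn : RegularBefore G n) (c : ℕ) :
    Provable G (count n c (Nat.count (IsNew (namedBefore G n) (_root_.columnSeq G n)) c)) := by
  induction c with
  | zero =>
    rw [Nat.count_zero]
    exact .of_rule (r := countZero) (by simp [rules, nameRules]) zero zero zero n 0 0 0
      (by simp [countZero])
  | succ c ih =>
    rw [Nat.count_succ]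
    split_ifs with h
    · refine .of_rule (r := countFresh) (by simp [rules, nameRules]) zero zero zero n c
        (Nat.count (IsNew (namedBefore G n) (_root_.columnSeq G n)) c) 0 ?_
      simpa [countFresh] using ⟨ih, provable_fresh hn h.1 h.2⟩
    · refine .of_rule (r := countOld) (by simp [rules, nameRules]) zero zero zero n c
        (Nat.count (IsNew (namedBefore G n) (_root_.columnSeq G n)) c) 0 ?_
      simpa [countOld] using ⟨ih, provable_old hn h⟩

/-- The position `c` of the `m`-th new element is fixed by a provable count. So the name provably
equals a term of the column's sequence, which is built from earlier names and the generators. -/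
theorem isRegular_named_pair (hn : RegularBefore G n) (m : ℕ) :
    IsRegular (mk G (named (Nat.pair n m))) := by
  classical
  have hinf := infinite_isNew (infinite_columnSeq G n)
  let c := Nat.nth (IsNew (namedBefore G n) (_root_.columnSeq G n)) m
  have hc : IsNew (namedBefore G n) (_root_.columnSeq G n) c := Nat.nth_mem_of_infinite hinf m
  have hcount := provable_count hn c
  rw [Nat.count_nth_of_infinite hinf] at hcount
  have h : Provable G (eq (named (Nat.pair n m)) (columnSeq n c)) := by
    refine .of_rule (r := eqNamed) (by simp [rules, nameRules]) zero zero zero n c m 0 ?_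
    simpa [eqNamed] using ⟨hcount, provable_fresh hn hc.1 hc.2⟩
  rw [mk_eq_mk.mpr h]
  exact isRegular_columnSeq hn c

end Column

/-- An odd column builds on all even columns, including those with larger numbers, while an even
column builds only on smaller even ones. So all even columns are settled first. -/
theorem isRegular_named (a : ℕ) : IsRegular (mk G (named a)) := by
  have heven : ∀ n, Even n → ∀ a : ℕ, a.unpair.1 = n → IsRegular (mk G (named a)) := by
    intro n
    induction n using Nat.strong_induction_on with
    | _ n ih =>
      rintro hn a rfl
      rw [← Nat.pair_unpair a]
      refine isRegular_named_pair (fun b hb => ?_) _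
      rw [ColumnBefore, if_pos hn] at hb
      exact ih _ hb.2 hb.1 b rfl
  have hall : ∀ n, ∀ a : ℕ, a.unpair.1 = n → IsRegular (mk G (named a)) := by
    intro n
    induction n using Nat.strong_induction_on with
    | _ n ih =>
      intro a ha
      by_cases hn : Even n
      · exact heven n hn a ha
      subst ha
      rw [← Nat.pair_unpair a]
      refine isRegular_named_pair (fun b hb => ?_) _
      rw [ColumnBefore, if_neg hn] at hb
      rcases hb with hb | hb
      · exact heven _ hb b rfl
      · exact ih _ hb b rfl
  exact hall _ a rfl

end TermRing

/-- The ordering of the named elements can be proved from information on finitely many edges. -/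
theorem realElement_lt_iff_provable {a b : ℕ} : realElement G a < realElement G b ↔
    Provable G (pos (sub (named b) (named a))) := by
  constructor
  · intro h
    refine TermRing.IsRegular.provable_pos
      ((TermRing.isRegular_named b).add (TermRing.isRegular_named a).neg) ?_
    rw [value_sub, value_named, value_named]
    exact sub_pos.mpr h
  · intro h
    have := holds_pos.mp h.holds
    rw [value_sub, value_named, value_named] at this
    exact sub_pos.mp this

end Completeness

/-! ### The main theorem -/

section Main

open FieldTerm FieldFact

variable {G : SimpleGraph ℕ}

/-- The complement of the ordering is `a = b` or `b < a`. Since names are unique, equality of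
elements is equality of numbers, so it needs no proof in the calculus. -/
theorem relComputableFrom_realElement (G : SimpleGraph ℕ) :
    RelComputableFrom (fun a b => realElement G a < realElement G b) G.Adj := by
  have hlt : Primrec fun z : List ℕ × ℕ =>
      (z.1, pos (sub (named z.2.unpair.2) (named z.2.unpair.1))) := by fun_prop
  have hgt : Primrec fun z : List ℕ × ℕ =>
      (z.1, pos (sub (named z.2.unpair.1) (named z.2.unpair.2))) := by fun_prop
  have heq : IsSigmaOne fun z : List ℕ × ℕ => z.2.unpair.1 = z.2.unpair.2 :=
    IsSigmaOne.of_exists (β := ℕ) (R := fun z _ => z.2.unpair.1 = z.2.unpair.2)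
      (Primrec.eq.comp (by fun_prop) (by fun_prop)) fun z => by simp
  have hD := IsSigmaOne.derivable isSigmaOne_step
  refine relComputableFrom_of_isSigmaOne (χ := edgeChar G) ?_ (hD.comp hlt)
    (heq.or (hD.comp hgt)) (fun n => realElement_lt_iff_provable) fun n => ?_
  · funext n
    simp only [relChar, edgeChar]
  · rw [not_lt, le_iff_eq_or_lt, (realElement_injective G).eq_iff, realElement_lt_iff_provable]
    simp only [exists_or, exists_const]
    exact or_congr_left eq_comm

end Main

theorem mainTheorem11 (G : SimpleGraph ℕ) :
    Function.Bijective (element G) ∧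
      ∃ (S : Subfield ℝ) (f : FOmega G ≃+* S),
        RelComputableFrom (inducedLT fun a => (f a : ℝ)) G.Adj := by
  obtain ⟨φ, hu, hv, hx, hy, hinj, hmem, hunit⟩ := exists_embedding_fieldF G
  have hφ := map_element hu hv hx hy hinj hunit
  have hbij : Function.Bijective (element G) := by
    refine ⟨fun a b hab => realElement_injective G (by rw [← hφ, ← hφ, hab]), fun z => ?_⟩
    obtain ⟨a, ha⟩ := mem_range_realElement G (hmem z)
    exact ⟨a, hinj ((hφ a).trans ha)⟩
  have hname : ∀ z, element G (name G z) = z :=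
    fun z => Function.invFun_eq (hbij.2 z)
  -- The range is closed under inverses because nonzero elements of `F(G)` are units.
  let S : Subfield ℝ :=
    { φ.range with
      inv_mem' := by
        rintro _ ⟨z, rfl⟩
        by_cases hz : z = 0
        · exact ⟨0, by simp [hz]⟩
        · obtain ⟨w, hw⟩ := (hunit z hz).exists_right_inv
          exact ⟨w, eq_inv_of_mul_eq_one_right (by rw [← map_mul, hw, map_one])⟩ }
  let e : FOmega G → S := fun a => ⟨φ (element G a), ⟨_, rfl⟩⟩
  have he : Function.Bijective e := by
    refine ⟨fun a b hab => hbij.1 (hinj (congrArg Subtype.val hab)), ?_⟩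
    rintro ⟨_, z, rfl⟩
    exact ⟨name G z, Subtype.ext (congrArg φ (hname z))⟩
  let f : FOmega G ≃+* S :=
    { Equiv.ofBijective e he with
      map_mul' := fun a b => Subtype.ext ((congrArg φ (hname _)).trans (map_mul φ _ _))
      map_add' := fun a b => Subtype.ext ((congrArg φ (hname _)).trans (map_add φ _ _)) }
  refine ⟨hbij, S, f, ?_⟩
  have : (inducedLT fun a => (f a : ℝ)) = fun a b => realElement G a < realElement G b := by
    funext a b
    rw [← hφ a, ← hφ b]
    rfl
  rw [this]
  exact relComputableFrom_realElement G
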